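/- **Theorem.** Let $V$ be a smooth manifold (Hausdorff, second countable, without boundary, not necessarily closed) of dimension $2n+1$ with a contact form $\lambda$ whose Reeb vector field generates a circle action $e_t$, $t\in S^1=\mathbb R/\mathbb Z$. Let $\mathcal G_c$ be the identity component of the group of compactly supported contactomorphisms of $(V,\ker\lambda)$, let $\mathcal G_e$ be the group of contactomorphisms of the form $e_t\phi$ with $\phi\in\mathcal G_c$, and let $\widetilde{\mathcal G}_e$ be its universal cover, i.e. paths in $\mathcal G_e$ from the identity modulo homotopy with fixed end points. Let $\widetilde{\mathcal G}_c\subset\widetilde{\mathcal G}_e$ be the subgroup of classes of compactly supported contact isotopies (the universal cover of $\mathcal G_c$), and for $c\in\mathbb R$ let $e^c$ be the class of $\{e_{ct}\}_{t\in[0,1]}$. Let $SV=(V\times\mathbb R_+,\,d(s\lambda))$ be the symplectization, with $\mathbb R_+$ acting by $\sigma\cdot(x,s)=(x,\sigma s)$. A contactomorphism $f$ lifts to the $\mathbb R_+$-equivariant symplectomorphism $\overline f$ of $SV$ covering it. A contact Hamiltonian is a smooth time-dependent function $F_t$ on $SV$ with $F_t(\sigma z)=\sigma F_t(z)$; it generates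 the contact isotopy $\{f_t\}$, $f_0=\mathrm{id}$, if $\{\overline f_t\}$ is its Hamiltonian flow (sign convention: $e_t$ is generated by $s$), and it then generates the class of $\{f_t\}_{t\in[0,1]}$. For $f,g\in\widetilde{\mathcal G}_e$ write $f\succeq g$ if $fg^{-1}$ is generated by a contact Hamiltonian that is non-negative for all $t\in[0,1]$, and put $$\nu_+(f)=\min\{m\in\mathbb Z: e^m\succeq f\},\quad \nu_-(f)=\max\{m\in\mathbb Z: f\succeq e^m\},\quad \nu(f)=\max(|\nu_+(f)|,|\nu_-(f)|).$$ Let $A,B\subset SV$ be closed with $B$ compact, and assume that $(A,B)$ has the stable intersection property: writing $\mathrm{Stab}(X)=X\times S^1\subset SV\times T^*S^1$, with $S^1$ the zero section, no $\mathbb R_+$-equivariant Hamiltonian diffeomorphism $g$ of $(SV\times T^*S^1,\,d(s\lambda+r\,dt))$ (the time-one map of a Hamiltonian isotopy commuting with $\sigma\cdot(z,r,t)=(\sigma z,\sigma r,t)$) satisfies $g(\mathrm{Stab}(A))\cap\mathrm{Stab}(B)=\emptyset$. Assume that $B$ is invariant under the lifted Reeb flow $\overline e_t$. Then: 1. The minimum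 and the maximum defining $\nu_\pm(f)$ exist for every $f\in\widetilde{\mathcal G}_e$. 2. If $f\in\widetilde{\mathcal G}_e$ is generated by a contact Hamiltonian $F_t$ with $F_t>cs$ on $B$ for all $t\in[0,1]$, where $c>0$, then $\nu_+(f)\ge\lfloor c\rfloor$ and $\nu(f)\ge\lfloor c\rfloor$; moreover $\nu(f^k)\ge\lfloor c\rfloor\,k$ for all integers $k\ge 0$. 3. For all $0<c<C$ there is a time-independent contact Hamiltonian $F$, generating a compactly supported contact isotopy $\{f_t\}_{t\in\mathbb R}$, with $F>cs$ on $B$ and $F\le Cs$ on $SV$. 4. $(\widetilde{\mathcal G}_c,\nu)$ is stably unbounded: there are $g\in\widetilde{\mathcal G}_c$ and $a>0$ with $\nu(g^k)\ge a|k|$ for all $k\in\mathbb Z$. 5. If a time-independent contact Hamiltonian $F$ generates a compactly supported contact isotopy $\{f_t\}_{t\in\mathbb R}$ and $F>cs$ on $B$ for some $c>0$, then sending $t\in\mathbb R$ to the class of $\{f_{t\tau}\}_{\tau\in[0,1]}$ defines an injective homomorphism $\rho:\mathbb R\to\widetilde{\mathcal G}_c$ that is a quasi-isometric embedding: there are $K\ge1$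 and $L\ge0$ with $$K^{-1}|t-t'|-L\le\nu\big(\rho(t)\rho(t')^{-1}\big)\le K|t-t'|+L\qquad\text{for all }t,t'\in\mathbb R.$$ -/

import Mathlib

open scoped Manifold ContDiff

noncomputable section

namespace ContactNorm

section Forms

variable {E : Type*} [NormedAddCommGroup E] [NormedSpace ℝ E]
  {H : Type*} [TopologicalSpace H] {I : ModelWithCorners ℝ E H}
  {M : Type*} [TopologicalSpace M] [ChartedSpace H M]
  {E' : Type*} [NormedAddCommGroup E'] [NormedSpace ℝ E']
  {H' : Type*} [TopologicalSpace H'] {I' : ModelWithCorners ℝ E' H'}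
  {M' : Type*} [TopologicalSpace M'] [ChartedSpace H' M']

/-- Differential 1-forms on a manifold `M`. -/
abbrev OneForm (I : ModelWithCorners ℝ E H) (M : Type*) [TopologicalSpace M] [ChartedSpace H M] :=
  (x : M) → (TangentSpace I x →L[ℝ] ℝ)

/-- Smoothness of a 1-form, as a fibrewise linear function on the tangent bundle (for a finite
dimensional manifold this is smoothness as a section of the cotangent bundle). -/
def OneForm.IsSmooth [IsManifold I 1 M] (θ : OneForm I M) : Prop :=
  ContMDiff I.tangent 𝓘(ℝ, ℝ) ∞ (fun v : TangentBundle I M => θ v.1 v.2)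

/-- The pullback `f^* θ`. -/
def OneForm.pullback (f : M → M') (θ : OneForm I' M') : OneForm I M :=
  fun x => (θ (f x)).comp (mfderiv I I' f x)

/-- The 1-form `θ` read in the preferred chart at `x₀`, i.e. its pullback by the inverse of the
chart, a 1-form on (an open subset of) the model vector space. -/
def OneForm.inChart (θ : OneForm I M) (x₀ : M) : E → (E →L[ℝ] ℝ) :=
  OneForm.pullback (I := 𝓘(ℝ, E)) (extChartAt I x₀).symm θ

/-- The exterior derivative `dθ` at `x`, computed in the preferred chart at `x`:
`dθ(v, w) = (D_v θ)(w) - (D_w θ)(v)`. A tangent vector at `x` is by definition its coordinate vector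
in that chart. -/
def OneForm.d (θ : OneForm I M) (x : M) (v w : TangentSpace I x) : ℝ :=
  fderiv ℝ (θ.inChart x) (extChartAt I x x) v w - fderiv ℝ (θ.inChart x) (extChartAt I x x) w v

/-- The velocity vector `c'(t)` of a curve `c` in a manifold. -/
def velocity (I : ModelWithCorners ℝ E H) (c : ℝ → M) (t : ℝ) : TangentSpace I (c t) :=
  mfderiv 𝓘(ℝ, ℝ) I c t (1 : ℝ)

end Forms

/-- Cartan's formula in a vector space: if `A(∂_t G) = 1` and `dA(∂_t G, ·) = 0` then
`G_t^* A` has zero derivative. -/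
theorem cartan_aux {E : Type*} [NormedAddCommGroup E] [NormedSpace ℝ E]
    (G : ℝ × E → E) (A : E → (E →L[ℝ] ℝ)) (u₀ w : E)
    (hG : ContDiffAt ℝ ∞ G (0, u₀)) (hA : DifferentiableAt ℝ A (G (0, u₀)))
    (h1 : ∀ᶠ p in nhds ((0 : ℝ), u₀), A (G p) (fderiv ℝ G p (1, 0)) = 1)
    (h2 : fderiv ℝ A (G (0, u₀)) (fderiv ℝ G (0, u₀) (1, 0)) (fderiv ℝ G (0, u₀) (0, w))
      - fderiv ℝ A (G (0, u₀)) (fderiv ℝ G (0, u₀) (0, w)) (fderiv ℝ G (0, u₀) (1, 0)) = 0) :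
    HasDerivAt (fun t : ℝ => A (G (t, u₀)) (fderiv ℝ G (t, u₀) (0, w))) 0 0 := by
  have hG1 : HasFDerivAt G (fderiv ℝ G (0, u₀)) (0, u₀) :=
    (hG.differentiableAt (by simp)).hasFDerivAt
  have hG2 : HasFDerivAt (fderiv ℝ G) (fderiv ℝ (fderiv ℝ G) (0, u₀)) (0, u₀) :=
    ((hG.fderiv_right (m := 1) (by norm_cast)).differentiableAt (by simp)).hasFDerivAt
  have hsymm : IsSymmSndFDerivAt ℝ G (0, u₀) :=
    hG.isSymmSndFDerivAt (by simp [minSmoothness_of_isRCLikeNormedField]; norm_cast)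
  have hAG : HasFDerivAt (fun p => A (G p))
      ((fderiv ℝ A (G (0, u₀))).comp (fderiv ℝ G (0, u₀))) (0, u₀) :=
    hA.hasFDerivAt.comp _ hG1
  have key : ∀ a : ℝ × E, HasFDerivAt (fun p => A (G p) (fderiv ℝ G p a)) _ (0, u₀) := fun a =>
    hAG.clm_apply (hG2.clm_apply (hasFDerivAt_const a _))
  have e1 : HasFDerivAt (fun p => A (G p) (fderiv ℝ G p (1, 0))) (0 : ℝ × E →L[ℝ] ℝ) (0, u₀) :=
    (hasFDerivAt_const (1 : ℝ) _).congr_of_eventuallyEq h1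
  have e2 := congrArg (fun T => T (0, w)) ((key (1, 0)).unique e1)
  have e3 := (key (0, w)).comp_hasDerivAt (0 : ℝ)
    ((hasDerivAt_id (0 : ℝ)).prodMk (hasDerivAt_const (0 : ℝ) u₀))
  refine e3.congr_deriv ?_
  have e4 := hsymm (1, 0) (0, w)
  simp at e2 ⊢
  rw [e4]
  linarith


section Contact

variable {d : ℕ} {V : Type*} [TopologicalSpace V] [ChartedSpace (EuclideanSpace ℝ (Fin d)) V]

variable (d V) in
/-- A contact form on the `d`-dimensional manifold `V`: a smooth nowhere vanishing 1-form `λ` such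
that `dλ` is nondegenerate on the hyperplanes `ker λ`, i.e. (in dimension `2n + 1`)
`λ ∧ (dλ)^n` is a volume form. The contact structure is `ker λ`, co-oriented by `λ`. -/
structure ContactForm [IsManifold (𝓡 d) ∞ V] where
  form : OneForm (𝓡 d) V
  smooth : form.IsSmooth
  ne_zero : ∀ x, form x ≠ 0
  nondegenerate : ∀ (x : V) (v : TangentSpace (𝓡 d) x), form x v = 0 →
    (∀ w : TangentSpace (𝓡 d) x, form x w = 0 → form.d x v w = 0) → v = 0

variable [IsManifold (𝓡 d) ∞ V]

/-- The Reeb vector field `R` of `λ` (`λ(R) = 1`, `dλ(R, ·) = 0`) generates a circle action, with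
`S¹ = ℝ/ℤ`: its flow `e_t` is a smooth 1-periodic action of `ℝ`. -/
structure ReebCircleAction (lam : ContactForm d V) where
  flow : ℝ → Equiv.Perm V
  smooth : ContMDiff (𝓘(ℝ, ℝ).prod (𝓡 d)) (𝓡 d) ∞ (fun z : ℝ × V => flow z.1 z.2)
  flow_add : ∀ s t, flow (s + t) = flow s * flow t
  flow_one : flow 1 = 1
  form_velocity : ∀ (t : ℝ) (x : V),
    lam.form (flow t x) (velocity (𝓡 d) (fun τ => flow τ x) t) = 1
  d_velocity : ∀ (t : ℝ) (x : V) (w : TangentSpace (𝓡 d) (flow t x)),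
    lam.form.d (flow t x) (velocity (𝓡 d) (fun τ => flow τ x) t) w = 0

variable {lam : ContactForm d V} (e : ReebCircleAction lam)

theorem ReebCircleAction.flow_zero : e.flow 0 = 1 := by
  have h := e.flow_add 0 0
  rw [add_zero] at h
  exact mul_eq_left.mp h.symm

theorem OneForm.pullback_comp
    {E₁ : Type*} [NormedAddCommGroup E₁] [NormedSpace ℝ E₁]
    {H₁ : Type*} [TopologicalSpace H₁] {I₁ : ModelWithCorners ℝ E₁ H₁}
    {M₁ : Type*} [TopologicalSpace M₁] [ChartedSpace H₁ M₁]
    {E₂ : Type*} [NormedAddCommGroup E₂] [NormedSpace ℝ E₂]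
    {H₂ : Type*} [TopologicalSpace H₂] {I₂ : ModelWithCorners ℝ E₂ H₂}
    {M₂ : Type*} [TopologicalSpace M₂] [ChartedSpace H₂ M₂]
    {E₃ : Type*} [NormedAddCommGroup E₃] [NormedSpace ℝ E₃]
    {H₃ : Type*} [TopologicalSpace H₃] {I₃ : ModelWithCorners ℝ E₃ H₃}
    {M₃ : Type*} [TopologicalSpace M₃] [ChartedSpace H₃ M₃]
    (θ : OneForm I₃ M₃) {g : M₂ → M₃} {f : M₁ → M₂} {x : M₁}
    (hg : MDifferentiableAt I₂ I₃ g (f x)) (hf : MDifferentiableAt I₁ I₂ f x) :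
    OneForm.pullback (I := I₁) (g ∘ f) θ x
      = (OneForm.pullback (I := I₂) g θ (f x)).comp (mfderiv I₁ I₂ f x) := by
  unfold OneForm.pullback
  rw [mfderiv_comp x hg hf]
  rfl

theorem OneForm.pullback_congr
    {E₁ : Type*} [NormedAddCommGroup E₁] [NormedSpace ℝ E₁]
    {H₁ : Type*} [TopologicalSpace H₁] {I₁ : ModelWithCorners ℝ E₁ H₁}
    {M₁ : Type*} [TopologicalSpace M₁] [ChartedSpace H₁ M₁]
    {E₂ : Type*} [NormedAddCommGroup E₂] [NormedSpace ℝ E₂]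
    {H₂ : Type*} [TopologicalSpace H₂] {I₂ : ModelWithCorners ℝ E₂ H₂}
    {M₂ : Type*} [TopologicalSpace M₂] [ChartedSpace H₂ M₂]
    (θ : OneForm I₂ M₂) {f g : M₁ → M₂} {x : M₁} (h : f =ᶠ[nhds x] g) :
    OneForm.pullback (I := I₁) f θ x = OneForm.pullback g θ x := by
  unfold OneForm.pullback
  have h1 : (mfderiv I₁ I₂ f x : E₁ →L[ℝ] E₂) = mfderiv I₁ I₂ g x := h.mfderiv_eq
  have key : ∀ (a b : M₂) (D D' : E₁ →L[ℝ] E₂), a = b → D = D' →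
      (θ a : E₂ →L[ℝ] ℝ).comp D = (θ b : E₂ →L[ℝ] ℝ).comp D' := by
    rintro a _ D _ rfl rfl
    rfl
  exact key _ _ _ _ h.eq_of_nhds h1

theorem OneForm.IsSmooth.differentiableAt_inChart {θ : OneForm (𝓡 d) V} (h : θ.IsSmooth) (x : V)
    {u : EuclideanSpace ℝ (Fin d)} (hu : u ∈ (extChartAt (𝓡 d) x).target) :
    DifferentiableAt ℝ (θ.inChart x) u := by
  have hopen : IsOpen (extChartAt (𝓡 d) x).target := isOpen_extChartAt_target x
  have hsymm : ContMDiffOn 𝓘(ℝ, EuclideanSpace ℝ (Fin d)) (𝓡 d) ∞ (extChartAt (𝓡 d) x).symm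
      (extChartAt (𝓡 d) x).target := contMDiffOn_extChartAt_symm x
  suffices H : ContDiffOn ℝ ∞ (θ.inChart x) (extChartAt (𝓡 d) x).target from
    (H.differentiableOn (by simp)).differentiableAt (hopen.mem_nhds hu)
  rw [contDiffOn_clm_apply]
  intro w
  have h1 := hsymm.contMDiffOn_tangentMapWithin (m := ∞) (by simp) hopen.uniqueMDiffOn
  have h2 : ContMDiff 𝓘(ℝ, EuclideanSpace ℝ (Fin d)) 𝓘(ℝ, EuclideanSpace ℝ (Fin d)).tangent ∞
      (fun y : EuclideanSpace ℝ (Fin d) =>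
        (⟨y, w⟩ : TangentBundle 𝓘(ℝ, EuclideanSpace ℝ (Fin d)) (EuclideanSpace ℝ (Fin d)))) :=
    contMDiff_vectorSpace_iff_contDiff.2 contDiff_const
  have h3 := h.comp_contMDiffOn (h1.comp
    (h2.contMDiffOn (s := (extChartAt (𝓡 d) x).target)) (fun y hy => hy))
  refine (contMDiffOn_iff_contDiffOn.1 h3).congr ?_
  intro y hy
  simp only [OneForm.inChart, OneForm.pullback, Function.comp_apply, tangentMapWithin]
  rw [mfderivWithin_of_isOpen hopen hy]
  rfl

theorem ReebCircleAction.contact_aux (y : V) (w : EuclideanSpace ℝ (Fin d)) :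
    HasDerivAt (fun t => (OneForm.pullback (I := 𝓡 d) (e.flow t) lam.form y : EuclideanSpace ℝ (Fin d) →L[ℝ] ℝ)
      w) 0 0 := by
  set φ := extChartAt (𝓡 d) y with hφ
  have hys : y ∈ φ.source := mem_extChartAt_source y
  have hut : φ y ∈ φ.target := mem_extChartAt_target y
  have hleft : φ.symm (φ y) = y := φ.left_inv hys
  have hopen : IsOpen φ.target := isOpen_extChartAt_target y
  have hsymm : ContMDiffOn 𝓘(ℝ, EuclideanSpace ℝ (Fin d)) (𝓡 d) ∞ φ.symm φ.target :=
    contMDiffOn_extChartAt_symm y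
  have hφs : ContMDiffOn (𝓡 d) 𝓘(ℝ, EuclideanSpace ℝ (Fin d)) ∞ φ φ.source := by
    rw [hφ, extChartAt_source]
    exact contMDiffOn_extChartAt
  have hso : IsOpen φ.source := isOpen_extChartAt_source y
  have e0 : ∀ z, e.flow 0 z = z := fun z => by rw [e.flow_zero]; rfl
  -- the flow in the chart, first with values in `V`
  let Ψ : ℝ × EuclideanSpace ℝ (Fin d) → V := fun p => e.flow p.1 (φ.symm p.2)
  let G : ℝ × EuclideanSpace ℝ (Fin d) → EuclideanSpace ℝ (Fin d) := fun p => φ (Ψ p)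
  have hΨ0 : Ψ (0, φ y) = y := by simp [Ψ, e0, hleft]
  have hG0 : G (0, φ y) = φ y := by simp [G, hΨ0]
  have hΨs : ∀ p : ℝ × EuclideanSpace ℝ (Fin d), p.2 ∈ φ.target →
      ContMDiffAt 𝓘(ℝ, ℝ × EuclideanSpace ℝ (Fin d)) (𝓡 d) ∞ Ψ p := by
    intro p hp
    have a1 : ContMDiffAt 𝓘(ℝ, ℝ × EuclideanSpace ℝ (Fin d)) 𝓘(ℝ, ℝ) ∞
        (fun q : ℝ × EuclideanSpace ℝ (Fin d) => q.1) p := contDiff_fst.contMDiff.contMDiffAt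
    have a2 : ContMDiffAt 𝓘(ℝ, ℝ × EuclideanSpace ℝ (Fin d)) 𝓘(ℝ, EuclideanSpace ℝ (Fin d)) ∞
        (fun q : ℝ × EuclideanSpace ℝ (Fin d) => q.2) p := contDiff_snd.contMDiff.contMDiffAt
    have a3 := (hsymm.contMDiffAt (hopen.mem_nhds hp)).comp p a2
    exact (e.smooth.contMDiffAt (x := (p.1, φ.symm p.2))).comp p (a1.prodMk a3)
  have hgood : ∀ᶠ p in nhds ((0 : ℝ), φ y), p.2 ∈ φ.target ∧ Ψ p ∈ φ.source := by
    have b1 : ContinuousAt Ψ (0, φ y) := (hΨs (0, φ y) hut).continuousAt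
    refine (continuousAt_snd.eventually (hopen.mem_nhds hut)).and (b1.eventually ?_)
    rw [hΨ0]
    exact hso.mem_nhds hys
  have hGs : ∀ p : ℝ × EuclideanSpace ℝ (Fin d), p.2 ∈ φ.target → Ψ p ∈ φ.source →
      ContDiffAt ℝ ∞ G p := fun p hp hp' =>
    contMDiffAt_iff_contDiffAt.1
      ((hφs.contMDiffAt (hso.mem_nhds hp')).comp p (hΨs p hp))
  have hpull : ∀ᶠ p in nhds ((0 : ℝ), φ y), ∀ a : ℝ × EuclideanSpace ℝ (Fin d),
      lam.form.inChart y (G p) (fderiv ℝ G p a)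
        = (OneForm.pullback (I := 𝓘(ℝ, ℝ × EuclideanSpace ℝ (Fin d))) Ψ lam.form p :
            ℝ × EuclideanSpace ℝ (Fin d) →L[ℝ] ℝ) a := by
    filter_upwards [hgood.eventually_nhds] with p hp a
    have hp' := hp.self_of_nhds
    have c1 : (φ.symm ∘ G) =ᶠ[nhds p] Ψ := by
      filter_upwards [hp] with q hq
      exact φ.left_inv hq.2
    have c2 : MDifferentiableAt 𝓘(ℝ, EuclideanSpace ℝ (Fin d)) (𝓡 d) φ.symm (G p) :=
      (hsymm.contMDiffAt (hopen.mem_nhds (φ.map_source hp'.2))).mdifferentiableAt (by simp)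
    have c3 : MDifferentiableAt 𝓘(ℝ, ℝ × EuclideanSpace ℝ (Fin d))
        𝓘(ℝ, EuclideanSpace ℝ (Fin d)) G p :=
      ((hGs p hp'.1 hp'.2).differentiableAt (by simp)).mdifferentiableAt
    rw [← OneForm.pullback_congr lam.form c1, OneForm.pullback_comp lam.form c2 c3, mfderiv_eq_fderiv]
    rfl
  have hvel : ∀ p : ℝ × EuclideanSpace ℝ (Fin d), p.2 ∈ φ.target →
      (OneForm.pullback (I := 𝓘(ℝ, ℝ × EuclideanSpace ℝ (Fin d))) Ψ lam.form p :
            ℝ × EuclideanSpace ℝ (Fin d) →L[ℝ] ℝ) (1, 0) = 1 := by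
    intro p hp
    let c : ℝ → ℝ × EuclideanSpace ℝ (Fin d) := fun τ => (τ, p.2)
    have hc : HasFDerivAt c (ContinuousLinearMap.prod (ContinuousLinearMap.id ℝ ℝ) 0) p.1 :=
      (hasFDerivAt_id p.1).prodMk (hasFDerivAt_const p.2 p.1)
    have c1 := OneForm.pullback_comp (I₁ := 𝓘(ℝ, ℝ)) (I₂ := 𝓘(ℝ, ℝ × EuclideanSpace ℝ (Fin d)))
      lam.form (g := Ψ) (f := c) (x := p.1) ((hΨs p hp).mdifferentiableAt (by simp))
      hc.differentiableAt.mdifferentiableAt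
    have c2 := e.form_velocity p.1 (φ.symm p.2)
    have c3 := congrArg (fun T : ℝ →L[ℝ] ℝ => T 1) c1
    rw [mfderiv_eq_fderiv, hc.fderiv] at c3
    refine Eq.trans ?_ c2
    refine Eq.trans ?_ c3.symm
    rfl
  have hspace : ∀ t : ℝ,
      (OneForm.pullback (I := 𝓘(ℝ, ℝ × EuclideanSpace ℝ (Fin d))) Ψ lam.form (t, φ y) :
            ℝ × EuclideanSpace ℝ (Fin d) →L[ℝ] ℝ) (0, w)
        = (OneForm.pullback (I := 𝓡 d) (e.flow t) lam.form y : EuclideanSpace ℝ (Fin d) →L[ℝ] ℝ)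
            w := by
    intro t
    let c : EuclideanSpace ℝ (Fin d) → ℝ × EuclideanSpace ℝ (Fin d) := fun u => (t, u)
    have hc : HasFDerivAt c (ContinuousLinearMap.prod 0 (ContinuousLinearMap.id ℝ _)) (φ y) :=
      (hasFDerivAt_const t (φ y)).prodMk (hasFDerivAt_id (φ y))
    have c1 := OneForm.pullback_comp (I₁ := 𝓡 d) (I₂ := 𝓘(ℝ, ℝ × EuclideanSpace ℝ (Fin d)))
      lam.form (g := Ψ) (f := c) (x := φ y) ((hΨs (t, φ y) hut).mdifferentiableAt (by simp))
      hc.differentiableAt.mdifferentiableAt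
    have d1 : ContMDiff (𝓡 d) (𝓡 d) ∞ (e.flow t) :=
      e.smooth.comp (contMDiff_const.prodMk contMDiff_id)
    have d2 : MDifferentiableAt (𝓡 d) (𝓡 d) φ.symm (φ y) :=
      (hsymm.contMDiffAt (hopen.mem_nhds hut)).mdifferentiableAt (by simp)
    have c2 := OneForm.pullback_comp (I₁ := 𝓡 d) (I₂ := 𝓡 d)
      lam.form (g := e.flow t) (f := φ.symm) (x := φ y) (d1.mdifferentiableAt (by simp)) d2
    have d3 : mfderiv (𝓡 d) (𝓡 d) φ.symm (φ y) = ContinuousLinearMap.id ℝ _ := by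
      have := mfderivWithin_range_extChartAt_symm (I := 𝓡 d) (x := y)
      rwa [ModelWithCorners.range_eq_univ, mfderivWithin_univ] at this
    have c3 := congrArg (fun T : EuclideanSpace ℝ (Fin d) →L[ℝ] ℝ => T w) c1
    have c4 := congrArg (fun T : EuclideanSpace ℝ (Fin d) →L[ℝ] ℝ => T w) c2
    rw [mfderiv_eq_fderiv, hc.fderiv] at c3
    rw [d3] at c4
    have key : ∀ z : V, z = y →
        (OneForm.pullback (I := 𝓡 d) (e.flow t) lam.form z : EuclideanSpace ℝ (Fin d) →L[ℝ] ℝ) w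
        = (OneForm.pullback (I := 𝓡 d) (e.flow t) lam.form y : EuclideanSpace ℝ (Fin d) →L[ℝ] ℝ)
            w := by
      rintro z rfl
      rfl
    refine Eq.trans ?_ (key _ hleft)
    refine Eq.trans ?_ c4
    exact c3.symm
  have hX : fderiv ℝ G (0, φ y) (1, 0) = velocity (𝓡 d) (fun τ => e.flow τ y) 0 := by
    have hc : HasFDerivAt (fun τ : ℝ => (τ, φ y))
        (ContinuousLinearMap.prod (ContinuousLinearMap.id ℝ ℝ) 0) 0 :=
      (hasFDerivAt_id (0 : ℝ)).prodMk (hasFDerivAt_const (φ y) (0 : ℝ))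
    have g1 : HasFDerivAt G (fderiv ℝ G (0, φ y)) (0, φ y) :=
      ((hGs _ hut (by rw [hΨ0]; exact hys)).differentiableAt (by simp)).hasFDerivAt
    have g2 := HasFDerivAt.comp (f := fun τ : ℝ => (τ, φ y)) (0 : ℝ) g1 hc
    have g3 : (G ∘ fun τ : ℝ => (τ, φ y)) = φ ∘ (fun τ => e.flow τ y) := by
      funext τ
      simp [G, Ψ, hleft]
    have k1 : MDifferentiableAt 𝓘(ℝ, ℝ) (𝓡 d) (fun τ => e.flow τ y) 0 :=
      (e.smooth.comp (contMDiff_id.prodMk contMDiff_const)).mdifferentiableAt (by simp)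
    have k2 : ∀ z : V, z = y →
        MDifferentiableAt (𝓡 d) 𝓘(ℝ, EuclideanSpace ℝ (Fin d)) φ z ∧
        (mfderiv (𝓡 d) 𝓘(ℝ, EuclideanSpace ℝ (Fin d)) φ z :
          EuclideanSpace ℝ (Fin d) →L[ℝ] EuclideanSpace ℝ (Fin d))
          = ContinuousLinearMap.id ℝ _ := by
      rintro z rfl
      exact ⟨(hφs.contMDiffAt (hso.mem_nhds hys)).mdifferentiableAt (by simp),
        mfderiv_extChartAt_self⟩
    have k3 := mfderiv_comp (0 : ℝ) (k2 _ (e0 y)).1 k1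
    rw [← g3, mfderiv_eq_fderiv, g2.fderiv] at k3
    have k4 := congrArg (fun T : ℝ →L[ℝ] EuclideanSpace ℝ (Fin d) => T 1) k3
    refine Eq.trans ?_ (k4.trans ?_)
    · rfl
    · exact congrArg (fun T : EuclideanSpace ℝ (Fin d) →L[ℝ] EuclideanSpace ℝ (Fin d) =>
        T (velocity (𝓡 d) (fun τ => e.flow τ y) 0)) (k2 _ (e0 y)).2
  have hd : ∀ w' : EuclideanSpace ℝ (Fin d),
      lam.form.d y (velocity (𝓡 d) (fun τ => e.flow τ y) 0 : EuclideanSpace ℝ (Fin d)) w' = 0 := by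
    have key : ∀ z : V, z = y → ∀ X : EuclideanSpace ℝ (Fin d),
        (∀ w' : EuclideanSpace ℝ (Fin d), lam.form.d z X w' = 0) →
        ∀ w' : EuclideanSpace ℝ (Fin d), lam.form.d y X w' = 0 := by
      rintro z rfl X h
      exact h
    exact key _ (e0 y) _ (e.d_velocity 0 y)
  have hmain := cartan_aux G (lam.form.inChart y) (φ y) w
    (hGs _ hut (by rw [hΨ0]; exact hys))
    (by rw [hG0]; exact lam.smooth.differentiableAt_inChart y hut)
    (by
      filter_upwards [hpull, hgood] with p hp hp'
      rw [hp, hvel p hp'.1])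
    (by
      rw [hG0, hX]
      exact hd _)
  refine hmain.congr_of_eventuallyEq ?_
  have hct : ContinuousAt (fun t : ℝ => (t, φ y)) 0 := by fun_prop
  filter_upwards [hct.eventually hpull] with t ht
  rw [ht, hspace]

/-- The Reeb flow preserves the contact form. -/
theorem ReebCircleAction.contact (t : ℝ) (x : V) :
    OneForm.pullback (I := 𝓡 d) (e.flow t) lam.form x = lam.form x := by
  have e0 : ∀ z, e.flow 0 z = z := fun z => by rw [e.flow_zero]; rfl
  have hs : ∀ t, ContMDiff (𝓡 d) (𝓡 d) ∞ (e.flow t) := fun t =>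
    e.smooth.comp (contMDiff_const.prodMk contMDiff_id)
  have hder : ∀ (v : EuclideanSpace ℝ (Fin d)) (t : ℝ), HasDerivAt (fun t =>
      (OneForm.pullback (I := 𝓡 d) (e.flow t) lam.form x : EuclideanSpace ℝ (Fin d) →L[ℝ] ℝ) v)
      0 t := by
    intro v t
    have h1 := e.contact_aux (e.flow t x) (mfderiv (𝓡 d) (𝓡 d) (e.flow t) x v)
    have h2 : HasDerivAt (fun s : ℝ => s - t) 1 t := (hasDerivAt_id t).sub_const t
    have h1' : HasDerivAt (fun r => (OneForm.pullback (I := 𝓡 d) (e.flow r) lam.form (e.flow t x) :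
        EuclideanSpace ℝ (Fin d) →L[ℝ] ℝ) (mfderiv (𝓡 d) (𝓡 d) (e.flow t) x v)) 0 (t - t) := by
      rw [sub_self]
      exact h1
    have h3 := HasDerivAt.comp (h := fun s : ℝ => s - t) t h1' h2
    rw [zero_mul] at h3
    refine h3.congr_of_eventuallyEq (Filter.Eventually.of_forall fun s => ?_)
    have h4 : (e.flow (s - t) ∘ e.flow t : V → V) = e.flow s := by
      funext z
      have := e.flow_add (s - t) t
      rw [sub_add_cancel] at this
      rw [this]
      rfl
    have h5 := OneForm.pullback_comp (I₁ := 𝓡 d) (I₂ := 𝓡 d) lam.form (g := e.flow (s - t))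
      (f := e.flow t) (x := x) ((hs _).mdifferentiableAt (by simp))
      ((hs _).mdifferentiableAt (by simp))
    rw [h4] at h5
    exact congrArg (fun T : EuclideanSpace ℝ (Fin d) →L[ℝ] ℝ => T v) h5
  have hconst : ∀ v : EuclideanSpace ℝ (Fin d),
      (OneForm.pullback (I := 𝓡 d) (e.flow t) lam.form x : EuclideanSpace ℝ (Fin d) →L[ℝ] ℝ) v
      = (OneForm.pullback (I := 𝓡 d) (e.flow 0) lam.form x : EuclideanSpace ℝ (Fin d) →L[ℝ] ℝ) v :=
    fun v => is_const_of_deriv_eq_zero (fun s => (hder v s).differentiableAt)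
      (fun s => (hder v s).deriv) t 0
  have hid : (e.flow 0 : V → V) = id := funext e0
  have h0 : OneForm.pullback (I := 𝓡 d) (e.flow 0) lam.form x = lam.form x := by
    rw [hid]
    unfold OneForm.pullback
    rw [mfderiv_id]
    exact ContinuousLinearMap.comp_id _
  rw [← h0]
  exact ContinuousLinearMap.ext hconst

theorem ReebCircleAction.flow_neg (t : ℝ) : e.flow (-t) = (e.flow t)⁻¹ := by
  have h := e.flow_add (-t) t
  rw [neg_add_cancel, e.flow_zero] at h
  exact eq_inv_of_mul_eq_one_left h.symm

theorem ReebCircleAction.exists_fract (t : ℝ) : ∃ s ∈ Set.Icc (0 : ℝ) 1, e.flow s = e.flow t := by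
  have hint : ∀ k : ℤ, e.flow (k : ℝ) = 1 := by
    have hnat : ∀ k : ℕ, e.flow (k : ℝ) = 1 := by
      intro k
      induction k with
      | zero => simpa using e.flow_zero
      | succ k ih => rw [Nat.cast_succ, e.flow_add, ih, e.flow_one, one_mul]
    intro k
    obtain ⟨m, rfl | rfl⟩ := k.eq_nat_or_neg
    · exact_mod_cast hnat m
    · rw [Int.cast_neg, e.flow_neg, Int.cast_natCast, hnat, inv_one]
  refine ⟨Int.fract t, ⟨Int.fract_nonneg t, (Int.fract_lt_one t).le⟩, ?_⟩
  have h := e.flow_add (Int.fract t) ⌊t⌋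
  rw [Int.fract_add_floor, hint, mul_one] at h
  exact h.symm

theorem ReebCircleAction.exists_compact_invariant {K : Set V} (hK : IsCompact K) :
    ∃ K' : Set V, K ⊆ K' ∧ IsCompact K' ∧ ∀ t x, e.flow t x ∈ K' → x ∈ K' := by
  refine ⟨(fun z : ℝ × V => e.flow z.1 z.2) '' (Set.Icc 0 1 ×ˢ K), ?_,
    (isCompact_Icc.prod hK).image e.smooth.continuous, ?_⟩
  · intro x hx
    exact ⟨(0, x), ⟨⟨le_rfl, zero_le_one⟩, hx⟩, by simp [e.flow_zero]⟩
  · rintro t x ⟨⟨s, y⟩, ⟨hs, hy⟩, h⟩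
    obtain ⟨r, hr, hr'⟩ := e.exists_fract (-t + s)
    refine ⟨(r, y), ⟨hr, hy⟩, ?_⟩
    change e.flow r y = x
    change e.flow s y = e.flow t x at h
    rw [hr', e.flow_add, e.flow_neg, Equiv.Perm.mul_apply, h]
    simp

section Family

variable {P : Type*} [NormedAddCommGroup P] [NormedSpace ℝ P]
  {Q : Type*} [NormedAddCommGroup Q] [NormedSpace ℝ Q]

/-- A smooth family `(f_p)` in the group `G_e` of contactomorphisms (preserving the co-oriented
contact structure) which coincide with some `e_a` outside a compact set: `f_p` and its inverse depend
smoothly on `(p, x)`, and outside a compact set (the same for all `p`) `f_p = e_{a(p)}` with `a`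
smooth. -/
structure IsSmoothFamily (f : P → Equiv.Perm V) : Prop where
  smooth : ContMDiff (𝓘(ℝ, P).prod (𝓡 d)) (𝓡 d) ∞ (fun z : P × V => f z.1 z.2)
  smooth_inv : ContMDiff (𝓘(ℝ, P).prod (𝓡 d)) (𝓡 d) ∞ (fun z : P × V => (f z.1)⁻¹ z.2)
  contact : ∀ p x, ∃ ρ : ℝ, 0 < ρ ∧
    OneForm.pullback (I := 𝓡 d) (f p) lam.form x = ρ • lam.form x
  reeb_at_infinity : ∃ (a : P → ℝ) (K : Set V), ContDiff ℝ ∞ a ∧ IsCompact K ∧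
    ∀ p, ∀ x ∉ K, f p x = e.flow (a p) x

variable {e}

theorem IsSmoothFamily.slice {f : P → Equiv.Perm V} (hf : IsSmoothFamily e f) (p : P) (x : V) :
    MDifferentiableAt (𝓡 d) (𝓡 d) (f p) x :=
  (hf.smooth.comp (contMDiff_const.prodMk contMDiff_id)).mdifferentiableAt (by simp)

theorem IsSmoothFamily.slice_inv {f : P → Equiv.Perm V} (hf : IsSmoothFamily e f) (p : P) (x : V) :
    MDifferentiableAt (𝓡 d) (𝓡 d) ((f p)⁻¹ : Equiv.Perm V) x :=
  (hf.smooth_inv.comp (contMDiff_const.prodMk contMDiff_id)).mdifferentiableAt (by simp)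

theorem pullback_id (θ : OneForm (𝓡 d) V) (x : V) :
    OneForm.pullback (I := 𝓡 d) (fun y : V => y) θ x = θ x := by
  unfold OneForm.pullback
  have : mfderiv (𝓡 d) (𝓡 d) (fun y : V => y) x = ContinuousLinearMap.id ℝ _ := mfderiv_id
  rw [this]
  exact ContinuousLinearMap.comp_id _

variable (e) in
theorem IsSmoothFamily.one : IsSmoothFamily e (1 : P → Equiv.Perm V) where
  smooth := contMDiff_snd
  smooth_inv := contMDiff_snd
  contact p x := ⟨1, one_pos, by rw [one_smul]; exact pullback_id _ x⟩
  reeb_at_infinity := ⟨fun _ => 0, ∅, contDiff_const, isCompact_empty, fun p x _ => by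
    rw [e.flow_zero]; rfl⟩

theorem IsSmoothFamily.mul {f g : P → Equiv.Perm V} (hf : IsSmoothFamily e f)
    (hg : IsSmoothFamily e g) : IsSmoothFamily e (f * g) where
  smooth := hf.smooth.comp (contMDiff_fst.prodMk hg.smooth)
  smooth_inv := by
    have h : (fun z : P × V => ((f * g) z.1)⁻¹ z.2)
        = (fun z : P × V => (g z.1)⁻¹ z.2) ∘ fun z : P × V => (z.1, (f z.1)⁻¹ z.2) := by
      funext z
      simp [mul_inv_rev]
    rw [h]
    exact hg.smooth_inv.comp (contMDiff_fst.prodMk hf.smooth_inv)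
  contact p x := by
    obtain ⟨ρ, hρ, h⟩ := hf.contact p (g p x)
    obtain ⟨σ, hσ, h'⟩ := hg.contact p x
    refine ⟨ρ * σ, mul_pos hρ hσ, ?_⟩
    have h1 := OneForm.pullback_comp (I₁ := 𝓡 d) (I₂ := 𝓡 d) lam.form (g := f p) (f := g p) (x := x)
      (hf.slice p _) (hg.slice p x)
    rw [h, ContinuousLinearMap.smul_comp] at h1
    rw [mul_smul, ← h']
    exact h1
  reeb_at_infinity := by
    obtain ⟨a, K, ha, hK, h⟩ := hf.reeb_at_infinity
    obtain ⟨b, L, hb, hL, h'⟩ := hg.reeb_at_infinity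
    obtain ⟨K', hKK', hK', hinv⟩ := e.exists_compact_invariant hK
    refine ⟨fun p => a p + b p, K' ∪ L, ha.add hb, hK'.union hL, fun p x hx => ?_⟩
    rw [Set.mem_union, not_or] at hx
    rw [Pi.mul_apply, Equiv.Perm.mul_apply, h' p x hx.2,
      h p _ (fun hm => hx.1 (hinv _ _ (hKK' hm))), e.flow_add, Equiv.Perm.mul_apply]

theorem IsSmoothFamily.inv {f : P → Equiv.Perm V} (hf : IsSmoothFamily e f) :
    IsSmoothFamily e f⁻¹ where
  smooth := hf.smooth_inv
  smooth_inv := by simpa using hf.smooth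
  contact p x := by
    obtain ⟨ρ, hρ, h⟩ := hf.contact p ((f p)⁻¹ x)
    refine ⟨ρ⁻¹, inv_pos.2 hρ, ?_⟩
    have h1 := OneForm.pullback_comp (I₁ := 𝓡 d) (I₂ := 𝓡 d) lam.form (g := f p)
      (f := ((f p)⁻¹ : Equiv.Perm V)) (x := x) (hf.slice p _) (hf.slice_inv p x)
    have h2 : ((f p : V → V) ∘ ((f p)⁻¹ : Equiv.Perm V)) = fun y => y := by
      funext y
      simp
    rw [h, ContinuousLinearMap.smul_comp, h2, pullback_id] at h1
    rw [h1, smul_smul, inv_mul_cancel₀ hρ.ne', one_smul]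
    rfl
  reeb_at_infinity := by
    obtain ⟨a, K, ha, hK, h⟩ := hf.reeb_at_infinity
    obtain ⟨K', hKK', hK', hinv⟩ := e.exists_compact_invariant hK
    refine ⟨fun p => - a p, K', ha.neg, hK', fun p x hx => ?_⟩
    rw [Pi.inv_apply, Equiv.Perm.inv_eq_iff_eq, e.flow_neg]
    have hx' : (e.flow (a p))⁻¹ x ∉ K := by
      intro hm
      rw [← e.flow_neg] at hm
      exact hx (hinv _ _ (hKK' hm))
    rw [h p _ hx']
    simp

theorem IsSmoothFamily.comp {f : P → Equiv.Perm V} (hf : IsSmoothFamily e f) {u : Q → P}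
    (hu : ContDiff ℝ ∞ u) : IsSmoothFamily e (fun q => f (u q)) where
  smooth := hf.smooth.comp ((hu.contMDiff.comp contMDiff_fst).prodMk contMDiff_snd)
  smooth_inv := hf.smooth_inv.comp ((hu.contMDiff.comp contMDiff_fst).prodMk contMDiff_snd)
  contact q x := hf.contact (u q) x
  reeb_at_infinity := by
    obtain ⟨a, K, ha, hK, h⟩ := hf.reeb_at_infinity
    exact ⟨fun q => a (u q), K, ha.comp hu, hK, fun q x hx => h _ x hx⟩

variable (e) in
theorem ReebCircleAction.isSmoothFamily : IsSmoothFamily e e.flow where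
  smooth := e.smooth
  smooth_inv := by
    have h : (fun z : ℝ × V => (e.flow z.1)⁻¹ z.2)
        = (fun z : ℝ × V => e.flow z.1 z.2) ∘ fun z : ℝ × V => (-z.1, z.2) := by
      funext z
      simp [e.flow_neg]
    rw [h]
    exact e.smooth.comp ((contDiff_neg.contMDiff.comp contMDiff_fst).prodMk contMDiff_snd)
  contact t x := ⟨1, one_pos, by rw [one_smul]; exact e.contact t x⟩
  reeb_at_infinity := ⟨fun t => t, ∅, contDiff_id, isCompact_empty, fun _ _ _ => rfl⟩

end Family

/-- Smooth paths in `G_e` starting at the identity, a group under pointwise composition. Only the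
restriction to the time interval `[0, 1]` matters for the classes below. -/
def contactPath : Subgroup (ℝ → Equiv.Perm V) where
  carrier := {f | IsSmoothFamily e f ∧ f 0 = 1}
  one_mem' := ⟨IsSmoothFamily.one e, rfl⟩
  mul_mem' := by
    rintro f g ⟨hf, hf0⟩ ⟨hg, hg0⟩
    exact ⟨hf.mul hg, by rw [Pi.mul_apply, hf0, hg0, one_mul]⟩
  inv_mem' := by
    rintro f ⟨hf, hf0⟩
    exact ⟨hf.inv, by rw [Pi.inv_apply, hf0, inv_one]⟩

/-- `h` is a smooth homotopy in `G_e`, relative to the end points, from the loop `φ_t`,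
`t ∈ [0, 1]`, to the constant loop at the identity. -/
structure IsContraction (φ : ℝ → Equiv.Perm V) (h : ℝ × ℝ → Equiv.Perm V) : Prop where
  family : IsSmoothFamily e h
  left : ∀ t ∈ Set.Icc (0 : ℝ) 1, h (0, t) = φ t
  right : ∀ t ∈ Set.Icc (0 : ℝ) 1, h (1, t) = 1
  ends : ∀ s ∈ Set.Icc (0 : ℝ) 1, h (s, 0) = 1 ∧ h (s, 1) = 1

/-- The normal subgroup of contractible loops in `G_e` based at the identity. -/
def contractibleLoops : Subgroup (contactPath e) where
  carrier := {φ | ∃ h, IsContraction e φ.1 h}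
  one_mem' := ⟨1, IsSmoothFamily.one e, fun _ _ => rfl, fun _ _ => rfl, fun _ _ => ⟨rfl, rfl⟩⟩
  mul_mem' := by
    rintro φ ψ ⟨h, H⟩ ⟨k, L⟩
    refine ⟨h * k, H.family.mul L.family, fun t ht => ?_, fun t ht => ?_, fun s hs => ?_⟩
    · rw [Pi.mul_apply, H.left t ht, L.left t ht]; rfl
    · rw [Pi.mul_apply, H.right t ht, L.right t ht, one_mul]
    · simp [H.ends s hs, L.ends s hs]
  inv_mem' := by
    rintro φ ⟨h, H⟩
    refine ⟨h⁻¹, H.family.inv, fun t ht => ?_, fun t ht => ?_, fun s hs => ?_⟩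
    · rw [Pi.inv_apply, H.left t ht]; rfl
    · rw [Pi.inv_apply, H.right t ht, inv_one]
    · simp [H.ends s hs]

instance contractibleLoops_normal : (contractibleLoops e).Normal where
  conj_mem := by
    rintro φ ⟨h, H⟩ g
    have hg : IsSmoothFamily e (fun q : ℝ × ℝ => g.1 q.2) := g.2.1.comp contDiff_snd
    refine ⟨(fun q => g.1 q.2) * h * (fun q => g.1 q.2)⁻¹, (hg.mul H.family).mul hg.inv,
      fun t ht => ?_, fun t ht => ?_, fun s hs => ?_⟩
    · simp [H.left t ht]
    · simp [H.right t ht]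
    · simp [H.ends s hs]

/-- The universal cover of `G_e`: smooth paths in `G_e` starting at the identity, modulo smooth
homotopies relative to the end points (see `cls_eq_iff`). -/
abbrev TildeGe : Type _ := contactPath e ⧸ contractibleLoops e

variable {e} in
/-- The class of a path in the universal cover of `G_e`. -/
abbrev cls (p : contactPath e) : TildeGe e := QuotientGroup.mk p

variable {e} in
/-- Two paths have the same class if and only if they are homotopic relative to the end points. -/
theorem cls_eq_iff (p q : contactPath e) : cls p = cls q ↔
    ∃ h : ℝ × ℝ → Equiv.Perm V, IsSmoothFamily e h ∧
      (∀ t ∈ Set.Icc (0 : ℝ) 1, h (0, t) = p.1 t ∧ h (1, t) = q.1 t) ∧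
      ∀ s ∈ Set.Icc (0 : ℝ) 1, h (s, 0) = 1 ∧ h (s, 1) = p.1 1 := by
  have hp : IsSmoothFamily e (fun z : ℝ × ℝ => p.1 z.2) := p.2.1.comp contDiff_snd
  have hu : ContDiff ℝ ∞ (fun z : ℝ × ℝ => ((1 - z.1, z.2) : ℝ × ℝ)) :=
    (contDiff_const.sub contDiff_fst).prodMk contDiff_snd
  have hflip : ∀ s ∈ Set.Icc (0 : ℝ) 1, 1 - s ∈ Set.Icc (0 : ℝ) 1 := fun s hs =>
    ⟨by linarith [hs.2], by linarith [hs.1]⟩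
  rw [QuotientGroup.eq]
  constructor
  · rintro ⟨k, hk⟩
    refine ⟨(fun z => p.1 z.2) * fun z => k (1 - z.1, z.2), hp.mul (hk.family.comp hu),
      fun t ht => ⟨?_, ?_⟩, fun s hs => ⟨?_, ?_⟩⟩
    · simp [hk.right t ht]
    · simp [hk.left t ht]
    · simp [(hk.ends _ (hflip s hs)).1, p.2.2]
    · simp [(hk.ends _ (hflip s hs)).2]
  · rintro ⟨h, hh, hpq, hends⟩
    refine ⟨(fun z => p.1 z.2)⁻¹ * fun z => h (1 - z.1, z.2), hp.inv.mul (hh.comp hu),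
      fun t ht => ?_, fun t ht => ?_, fun s hs => ⟨?_, ?_⟩⟩
    · simp [(hpq t ht).2]
    · simp [(hpq t ht).1]
    · simp [(hends _ (hflip s hs)).1, p.2.2]
    · simp [(hends _ (hflip s hs)).2]

/-- Compactly supported contact isotopies starting at the identity (paths in `G_c`). -/
def compactPaths : Subgroup (contactPath e) where
  carrier := {p | ∃ K : Set V, IsCompact K ∧ ∀ t, ∀ x ∉ K, p.1 t x = x}
  one_mem' := ⟨∅, isCompact_empty, fun _ _ _ => rfl⟩
  mul_mem' := by
    rintro p q ⟨K, hK, h⟩ ⟨L, hL, h'⟩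
    refine ⟨K ∪ L, hK.union hL, fun t x hx => ?_⟩
    rw [Set.mem_union, not_or] at hx
    change p.1 t (q.1 t x) = x
    rw [h' t x hx.2, h t x hx.1]
  inv_mem' := by
    rintro p ⟨K, hK, h⟩
    refine ⟨K, hK, fun t x hx => ?_⟩
    change (p.1 t)⁻¹ x = x
    rw [Equiv.Perm.inv_eq_iff_eq, h t x hx]

/-- The universal cover of `G_c`, as the subgroup of the universal cover of `G_e` formed by the
classes of compactly supported contact isotopies. -/
def tildeGc : Subgroup (TildeGe e) := (compactPaths e).map (QuotientGroup.mk' (contractibleLoops e))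

variable {e} in
/-- The path `t ↦ p_{ct}`. -/
def rescale (p : contactPath e) (c : ℝ) : contactPath e :=
  ⟨fun t => p.1 (c * t), p.2.1.comp (contDiff_const.mul contDiff_id), by
    change p.1 (c * 0) = 1
    rw [mul_zero, p.2.2]⟩

/-- The Reeb flow as a path `t ↦ e_t`. -/
def reebPath : contactPath e := ⟨e.flow, e.isSmoothFamily, e.flow_zero⟩

/-- The element `e^c`, the class of the path `t ↦ e_{ct}`, `t ∈ [0, 1]`. -/
def reebElt (c : ℝ) : TildeGe e := cls (rescale (reebPath e) c)


section Symplectization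

/-- The open ray `ℝ_+ = (0, ∞)`. -/
def posRay : TopologicalSpace.Opens ℝ := ⟨Set.Ioi 0, isOpen_Ioi⟩

variable (V) in
/-- The symplectization `SV = V × ℝ_+`, with points `(x, s)`. -/
abbrev Symplectization : Type _ := V × posRay

variable (V) in
/-- The stabilization `SV × T^*S¹` of `SV`, with points `(z, (r, u))`, `T^*S¹ = ℝ × S¹`. -/
abbrev Stabilization : Type _ := Symplectization V × (ℝ × Circle)

/-- The model of the manifold `SV`. -/
abbrev sympModel (d : ℕ) := (𝓡 d).prod 𝓘(ℝ, ℝ)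

/-- The model of the manifold `SV × T^*S¹`. -/
abbrev stabModel (d : ℕ) := (sympModel d).prod (𝓘(ℝ, ℝ).prod (𝓡 1))

/-- Multiplication on `ℝ_+`. -/
def rayMul (σ s : posRay) : posRay := ⟨σ.1 * s.1, show 0 < σ.1 * s.1 from mul_pos σ.2 s.2⟩

/-- The action of `ℝ_+` on `SV`, `σ · (x, s) = (x, σ s)`. -/
def sympScale (σ : posRay) (z : Symplectization V) : Symplectization V := (z.1, rayMul σ z.2)

/-- The action of `ℝ_+` on `SV × T^*S¹`, `σ · (z, r, u) = (σ · z, σ r, u)`. -/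
def stabScale (σ : posRay) (y : Stabilization V) : Stabilization V :=
  (sympScale σ y.1, (σ.1 * y.2.1, y.2.2))

variable (lam) in
/-- The form `s λ` on `SV`; the symplectic form is `d(s λ)`. -/
def liouvilleForm : OneForm (sympModel d) (Symplectization V) :=
  fun z => z.2.1 • OneForm.pullback (I := sympModel d) Prod.fst lam.form z

/-- The form `dt` on `S¹ = ℝ/ℤ`, in terms of the unit circle `u = exp(2πit)` in `ℂ`:
`dt(v) = Im(ū v) / 2π`. -/
def circleForm : OneForm (𝓡 1) Circle := fun u =>
  (2 * Real.pi)⁻¹ • Complex.imCLM.comp ((ContinuousLinearMap.mul ℝ ℂ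
    ((starRingEnd ℂ) (u : ℂ))).comp (mfderiv (𝓡 1) 𝓘(ℝ, ℂ) (fun v : Circle => (v : ℂ)) u))

variable (lam) in
/-- The form `s λ + r dt` on `SV × T^*S¹`; the symplectic form is `d(s λ + r dt)`. -/
def stabForm : OneForm (stabModel d) (Stabilization V) := fun y =>
  OneForm.pullback (I := stabModel d) Prod.fst (liouvilleForm lam) y
    + y.2.1 • OneForm.pullback (I := stabModel d) (fun y : Stabilization V => y.2.2) circleForm y

/-- `ψ_t` is the flow of the smooth time-dependent Hamiltonian `F_t` on `M` with the exact symplectic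
form `ω = dθ`: `ψ_0 = id` and `ω(∂_t ψ_t, ·) = - dF_t`. With this sign the Reeb flow, lifted to the
symplectization, has Hamiltonian `s`. -/
structure IsHamiltonianFlow {E : Type*} [NormedAddCommGroup E] [NormedSpace ℝ E]
    {H : Type*} [TopologicalSpace H] {J : ModelWithCorners ℝ E H}
    {M : Type*} [TopologicalSpace M] [ChartedSpace H M]
    (θ : OneForm J M) (F : ℝ → M → ℝ) (ψ : ℝ → M → M) : Prop where
  smooth_hamiltonian : ContMDiff (𝓘(ℝ, ℝ).prod J) 𝓘(ℝ, ℝ) ∞ (fun z : ℝ × M => F z.1 z.2)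
  smooth_flow : ContMDiff (𝓘(ℝ, ℝ).prod J) J ∞ (fun z : ℝ × M => ψ z.1 z.2)
  flow_zero : ∀ x, ψ 0 x = x
  hamilton : ∀ (t : ℝ) (x : M) (w : TangentSpace J (ψ t x)),
    θ.d (ψ t x) (velocity J (fun τ => ψ τ x) t) w = - mfderiv J 𝓘(ℝ, ℝ) (F t) (ψ t x) w

variable (lam) in
/-- `gbar` is the lift to `SV` of the contactomorphism `g`: it covers `g` and preserves `s λ`, that is,
`gbar (x, s) = (g x, s / ρ(x))` where `g^* λ = ρ λ`. -/
def IsSymplecticLift (g : V → V) (gbar : Symplectization V → Symplectization V) : Prop :=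
  ∀ z, (gbar z).1 = g z.1 ∧
    (gbar z).2.1 • OneForm.pullback (I := 𝓡 d) g lam.form z.1 = z.2.1 • lam.form z.1

variable (lam) in
/-- `F_t : SV → ℝ` is a contact Hamiltonian (smooth, `F_t(σ · z) = σ F_t(z)`) and its Hamiltonian flow
is the lift to `SV` of the contact isotopy `f_t`. -/
def IsContactHamiltonianOf (F : ℝ → Symplectization V → ℝ) (f : ℝ → Equiv.Perm V) : Prop :=
  (∀ t σ z, F t (sympScale σ z) = σ.1 * F t z) ∧
    ∃ fbar : ℝ → Symplectization V → Symplectization V,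
      (∀ t, IsSymplecticLift lam (f t) (fbar t)) ∧ IsHamiltonianFlow (liouvilleForm lam) F fbar

variable (lam) in
/-- `g` is an `ℝ_+`-equivariant Hamiltonian diffeomorphism of `SV × T^*S¹`: the time one map of an
`ℝ_+`-equivariant Hamiltonian isotopy. -/
def IsEquivariantHamiltonianDiffeo (g : Stabilization V → Stabilization V) : Prop :=
  ∃ (F : ℝ → Stabilization V → ℝ)
    (ψ : ℝ → Diffeomorph (stabModel d) (stabModel d) (Stabilization V) (Stabilization V) ∞),
    IsHamiltonianFlow (stabForm lam) F (fun t => ψ t) ∧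
    (∀ t σ y, ψ t (stabScale σ y) = stabScale σ (ψ t y)) ∧ g = ψ 1

/-- `Stab(X) = X × S¹`, inside `SV ×` the zero section of `T^*S¹`. -/
def stab (X : Set (Symplectization V)) : Set (Stabilization V) := {y | y.1 ∈ X ∧ y.2.1 = 0}

variable (lam) in
/-- The stable intersection property of a pair of closed subsets of `SV`, the second one compact:
`Stab(A)` cannot be displaced from `Stab(B)` by an `ℝ_+`-equivariant Hamiltonian diffeomorphism. -/
structure HasStableIntersection (A B : Set (Symplectization V)) : Prop where
  closed_left : IsClosed A
  closed_right : IsClosed B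
  compact_right : IsCompact B
  inter : ∀ g, IsEquivariantHamiltonianDiffeo lam g → ((g '' stab A) ∩ stab B).Nonempty

/-- The lift `(x, s) ↦ (e_t x, s)` of the Reeb flow to `SV`. -/
def liftedReeb (t : ℝ) (z : Symplectization V) : Symplectization V := (e.flow t z.1, z.2)

theorem liftedReeb_isLift (t : ℝ) : IsSymplecticLift lam (e.flow t) (liftedReeb e t) :=
  fun z => ⟨rfl, by rw [e.contact]; rfl⟩

end Symplectization

section Norm

variable {e}

/-- `f ⪰ id`: some path in the class `f` has a non-negative contact Hamiltonian (for the times in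
`[0, 1]`). -/
def NonnegElt (f : TildeGe e) : Prop :=
  ∃ p : contactPath e, cls p = f ∧ ∃ F, IsContactHamiltonianOf lam F p.1 ∧
    ∀ t ∈ Set.Icc (0 : ℝ) 1, ∀ z, 0 ≤ F t z

/-- `f ⪰ g`, i.e. `f g⁻¹ ⪰ id`. -/
def Dominates (f g : TildeGe e) : Prop := NonnegElt (f * g⁻¹)

/-- `ν_+(f) = min {m ∈ ℤ : e^m ⪰ f}`. -/
def nuPlus (f : TildeGe e) : ℤ := sInf {m : ℤ | Dominates (reebElt e m) f}

/-- `ν_-(f) = max {m ∈ ℤ : e^m ⪯ f}`. -/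
def nuMinus (f : TildeGe e) : ℤ := sSup {m : ℤ | Dominates f (reebElt e m)}

/-- `ν(f) = max (|ν_+(f)|, |ν_-(f)|)`. -/
def nu (f : TildeGe e) : ℤ := max |nuPlus f| |nuMinus f|

variable (e) in
/-- Stable unboundedness of `ν` on the universal cover of `G_c`: `ν(g^k) ≥ a |k|` for all `k ∈ ℤ`, for
some element `g` and some `a > 0`. -/
def NuIsStablyUnboundedOnTildeGc : Prop :=
  ∃ g : tildeGc e, ∃ a : ℝ, 0 < a ∧ ∀ k : ℤ, a * |(k : ℝ)| ≤ (nu (g ^ k : tildeGc e).1 : ℝ)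

/-- `ρ` is a quasi-isometric monomorphism from `ℝ` to the universal cover of `G_c` with the metric
`(f, g) ↦ ν(f g⁻¹)`. -/
structure IsQuasiIsometricMono (ρ : Multiplicative ℝ →* tildeGc e) : Prop where
  injective : Function.Injective ρ
  quasi_isometric : ∃ K L : ℝ, 1 ≤ K ∧ 0 ≤ L ∧ ∀ s t : ℝ,
    K⁻¹ * |s - t| - L
        ≤ (nu (ρ (Multiplicative.ofAdd s) * (ρ (Multiplicative.ofAdd t))⁻¹ : tildeGc e).1 : ℝ) ∧
      (nu (ρ (Multiplicative.ofAdd s) * (ρ (Multiplicative.ofAdd t))⁻¹ : tildeGc e).1 : ℝ)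
        ≤ K * |s - t| + L

end Norm

end Contact

end ContactNorm

end

/-! All contact dynamics is read on `V` rather than on `SV`. For an isotopy `f_t` put `rate = λ(∂_t
f_t)`, a function of the starting point, and `f_t^* λ = ρ λ`. The lift of `f_t` preserves `s λ`, so
Cartan's formula makes it a Hamiltonian flow with Hamiltonian `s · rate(f_t⁻¹ x)`. Hamilton's
equation fixes the differential of the Hamiltonian, and Euler's identity for functions of degree one
then fixes the function (`IsContactHamiltonianOf.eq_rate`). Thus `f ⪰ id` means that some
representative has non-negative rate, and products obey the cocycle rule `rate (f g) = rate f + ρ_f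
· rate g` (`rate_mul`).

The geometric input is `noPositiveLoop`: no contractible loop in `G_e` has a rate bounded below by a
positive constant over the projection of `B`. A contraction `f_{s,t}` of the loop gives the
suspensions `(z, r, t) ↦ (f_{s,t} z, r - F_{s,t}(f_{s,t} z), t)` of `SV × T^*S¹`. They are
equivariant, preserve `s λ + r dt` and start at the identity, hence form an equivariant Hamiltonian
isotopy. Stable intersection produces a point of `Stab(A)` mapped into `Stab(B)`. Since `r = 0` at
both ends, the Hamiltonian of the loop vanishes at a point of `B`.

The rest of the estimate is formal. Say that a class has lower bound `c` if one of its paths has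
rate, over `B`, at least a function of time with integral `c`. Concatenation adds lower bounds, so
`f ^ k` has lower bound `k c` (`HasLowerBound.mul`). If `c > m` and `e^m ⪰ f`, then `f e^{-m}` has a
positive lower bound and a non-negative inverse. Multiplying the two paths, and redistributing the
bound evenly in time by a contractible loop in the Reeb flow, yields a forbidden loop; hence `c ≤
ν_+(f)`. Conversely a path with rate at most `m` is dominated by `e^m`, because `e^m` is central.
Rates are bounded (the paths are Reeb outside a compact set), so `ν_±` are attained and `ν` grows at
most linearly along a one-parameter group.

Existence of `F` requires flows: for compactly supported `h` the nondegeneracy of `λ ⊗ λ + dλ` gives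
a smooth vector field with `λ(X) = h` and `L_X λ = dh(R) λ`. Its flow is smooth and global
(`exists_flow`), and the flow consists of contactomorphisms. Taking `h = C ψ` with a cutoff `ψ`
equal to `1` on the projection of `B` gives the required Hamiltonian. Uniqueness of integral curves
shows, conversely, that any autonomous `F` generates a one-parameter group. -/

noncomputable section

namespace ContactNorm

/-! ### Exterior derivative, pullback and Cartan's formula on manifolds -/

section FormCalculus

variable {E : Type*} [NormedAddCommGroup E] [NormedSpace ℝ E]
  {H : Type*} [TopologicalSpace H] {J : ModelWithCorners ℝ E H}
  {M : Type*} [TopologicalSpace M] [ChartedSpace H M]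
  {E' : Type*} [NormedAddCommGroup E'] [NormedSpace ℝ E']
  {H' : Type*} [TopologicalSpace H'] {I : ModelWithCorners ℝ E' H'}
  {N : Type*} [TopologicalSpace N] [ChartedSpace H' N]

/-- In finite dimension smoothness of a map into covectors can be tested on each fixed vector `w`.
There it is the composition of `θ`, as a function on the tangent bundle, with the push-forward of a
constant vector field. -/
theorem OneForm.IsSmooth.contDiffOn_inChart [FiniteDimensional ℝ E] [J.Boundaryless]
    [IsManifold J ∞ M] {θ : OneForm J M} (h : θ.IsSmooth) (x : M) :
    ContDiffOn ℝ ∞ (θ.inChart x) (extChartAt J x).target := by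
  have hopen : IsOpen (extChartAt J x).target := isOpen_extChartAt_target x
  have hsymm : ContMDiffOn 𝓘(ℝ, E) J ∞ (extChartAt J x).symm
      (extChartAt J x).target := contMDiffOn_extChartAt_symm x
  rw [contDiffOn_clm_apply]
  intro w
  have h1 := hsymm.contMDiffOn_tangentMapWithin (m := ∞) (by simp) hopen.uniqueMDiffOn
  have h2 : ContMDiff 𝓘(ℝ, E) 𝓘(ℝ, E).tangent ∞
      (fun y : E => (⟨y, w⟩ : TangentBundle 𝓘(ℝ, E) E)) :=
    contMDiff_vectorSpace_iff_contDiff.2 contDiff_const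
  have h3 := h.comp_contMDiffOn (h1.comp
    (h2.contMDiffOn (s := (extChartAt J x).target)) (fun y hy => hy))
  refine (contMDiffOn_iff_contDiffOn.1 h3).congr ?_
  intro y hy
  simp only [OneForm.inChart, OneForm.pullback, Function.comp_apply, tangentMapWithin]
  rw [mfderivWithin_of_isOpen hopen hy]
  rfl

theorem OneForm.IsSmooth.pullback [IsManifold J 1 M] [IsManifold I 1 N] {θ : OneForm J M}
    (h : θ.IsSmooth) {f : N → M} (hf : ContMDiff I J ∞ f) :
    (OneForm.pullback (I := I) f θ).IsSmooth :=
  ContMDiff.comp h (hf.contMDiff_tangentMap (m := ∞) (by simp))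

/-- The exterior derivative commutes with pullback by maps from a vector space. -/
theorem OneForm.fderiv_pullback [FiniteDimensional ℝ E] [J.Boundaryless]
    [IsManifold J ∞ M] {θ : OneForm J M} (h : θ.IsSmooth) {G : E' → M} {p : E'}
    (hG : ContMDiffAt 𝓘(ℝ, E') J 2 G p) :
    (∀ v, DifferentiableAt ℝ
      (fun q => (OneForm.pullback (I := 𝓘(ℝ, E')) G θ q : E' →L[ℝ] ℝ) v) p) ∧
    ∀ v w : E',
      fderiv ℝ (fun q => (OneForm.pullback (I := 𝓘(ℝ, E')) G θ q : E' →L[ℝ] ℝ) w) p v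
        - fderiv ℝ (fun q => (OneForm.pullback (I := 𝓘(ℝ, E')) G θ q : E' →L[ℝ] ℝ) v) p w
      = θ.d (G p) (mfderiv 𝓘(ℝ, E') J G p v) (mfderiv 𝓘(ℝ, E') J G p w) := by
  set φ := extChartAt J (G p) with hφ
  have hys : G p ∈ φ.source := mem_extChartAt_source _
  have hopen : IsOpen φ.target := isOpen_extChartAt_target _
  have hso : IsOpen φ.source := isOpen_extChartAt_source _
  have hsymm : ContMDiffOn 𝓘(ℝ, E) J 2 φ.symm φ.target := contMDiffOn_extChartAt_symm _
  have hφs : ContMDiffOn J 𝓘(ℝ, E) 2 φ φ.source := by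
    rw [hφ, extChartAt_source]
    exact contMDiffOn_extChartAt
  set g : E' → E := φ ∘ G with hg
  have hgood : ∀ᶠ q in nhds p, ContMDiffAt 𝓘(ℝ, E') J 2 G q ∧ G q ∈ φ.source :=
    ((contMDiffAt_iff_contMDiffAt_nhds (by simp)).1 hG).and (hG.continuousAt.eventually (hso.mem_nhds hys))
  have hgs : ∀ q, ContMDiffAt 𝓘(ℝ, E') J 2 G q → G q ∈ φ.source → ContDiffAt ℝ 2 g q :=
    fun q h1 h2 => contMDiffAt_iff_contDiffAt.1 ((hφs.contMDiffAt (hso.mem_nhds h2)).comp q h1)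
  have hpull : ∀ᶠ q in nhds p, ∀ a : E',
      (OneForm.pullback (I := 𝓘(ℝ, E')) G θ q : E' →L[ℝ] ℝ) a
        = θ.inChart (G p) (g q) (fderiv ℝ g q a) := by
    filter_upwards [hgood.eventually_nhds] with q hq a
    have hq' := hq.self_of_nhds
    have c1 : (φ.symm ∘ g) =ᶠ[nhds q] G := by
      filter_upwards [hq] with r hr
      exact φ.left_inv hr.2
    have c2 : MDifferentiableAt 𝓘(ℝ, E) J φ.symm (g q) :=
      (hsymm.contMDiffAt (hopen.mem_nhds (φ.map_source hq'.2))).mdifferentiableAt (by simp)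
    have c3 : MDifferentiableAt 𝓘(ℝ, E') 𝓘(ℝ, E) g q :=
      ((hgs q hq'.1 hq'.2).differentiableAt (by simp)).mdifferentiableAt
    rw [← OneForm.pullback_congr θ c1, OneForm.pullback_comp θ c2 c3, mfderiv_eq_fderiv]
    rfl
  have hg2 := hgs p hG hys
  have hG1 : HasFDerivAt g (fderiv ℝ g p) p := (hg2.differentiableAt (by simp)).hasFDerivAt
  have hG2 : HasFDerivAt (fderiv ℝ g) (fderiv ℝ (fderiv ℝ g) p) p :=
    ((hg2.fderiv_right (m := 1) (by norm_num)).differentiableAt (by simp)).hasFDerivAt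
  -- In the chart the pullback is `A(g)(Dg ·)`. Differentiating gives `DA(Dg v)(Dg w)` plus
  -- `A(D²g(v, w))`, and symmetry of `D²g` removes the second term from the antisymmetrized
  -- derivative.
  have hsymm2 : IsSymmSndFDerivAt ℝ g p :=
    hg2.isSymmSndFDerivAt (by simp [minSmoothness_of_isRCLikeNormedField])
  have hA : DifferentiableAt ℝ (θ.inChart (G p)) (g p) :=
    ((h.contDiffOn_inChart (G p)).differentiableOn (by simp)).differentiableAt
      (hopen.mem_nhds (φ.map_source hys))
  have key : ∀ a : E', HasFDerivAt
      (fun q => (OneForm.pullback (I := 𝓘(ℝ, E')) G θ q : E' →L[ℝ] ℝ) a) _ p := fun a =>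
    ((hA.hasFDerivAt.comp p hG1).clm_apply (hG2.clm_apply (hasFDerivAt_const a _))).congr_of_eventuallyEq
      (hpull.mono fun q hq => hq a)
  have hmf : (mfderiv 𝓘(ℝ, E') J G p : E' →L[ℝ] E) = fderiv ℝ g p := by
    have k1 : MDifferentiableAt 𝓘(ℝ, E') J G p := hG.mdifferentiableAt (by simp)
    have k2 : MDifferentiableAt J 𝓘(ℝ, E) φ (G p) :=
      (hφs.contMDiffAt (hso.mem_nhds hys)).mdifferentiableAt (by simp)
    have k3 := mfderiv_comp p k2 k1
    rw [mfderiv_eq_fderiv, hφ, mfderiv_extChartAt_self] at k3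
    exact k3.symm
  refine ⟨fun v => (key v).differentiableAt, fun v w => ?_⟩
  rw [(key v).fderiv, (key w).fderiv]
  have e4 := hsymm2 v w
  simp only [OneForm.d, ← hφ]
  change _ = fderiv ℝ (θ.inChart (G p)) (g p) ((mfderiv 𝓘(ℝ, E') J G p : E' →L[ℝ] E) v)
      ((mfderiv 𝓘(ℝ, E') J G p : E' →L[ℝ] E) w)
    - fderiv ℝ (θ.inChart (G p)) (g p) ((mfderiv 𝓘(ℝ, E') J G p : E' →L[ℝ] E) w)
      ((mfderiv 𝓘(ℝ, E') J G p : E' →L[ℝ] E) v)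
  rw [hmf]
  simp [e4]
  rfl

theorem mfderiv_comp_fderiv {F : Type*} [NormedAddCommGroup F] [NormedSpace ℝ F] {G : F → M}
    {c : E' → F} {q : E'} (hG : MDifferentiableAt 𝓘(ℝ, F) J G (c q)) (hc : DifferentiableAt ℝ c q)
    (v : E') :
    (mfderiv 𝓘(ℝ, E') J (fun r => G (c r)) q : E' →L[ℝ] E) v
      = (mfderiv 𝓘(ℝ, F) J G (c q) : F →L[ℝ] E) (fderiv ℝ c q v) := by
  have h := mfderiv_comp q hG hc.mdifferentiableAt
  rw [mfderiv_eq_fderiv] at h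
  exact congrArg (fun T : E' →L[ℝ] E => T v) h

/-- Cartan's formula for the derivative of the pullback of a 1-form under a smooth family of maps. -/
theorem OneForm.hasDerivAt_pullback [FiniteDimensional ℝ E] [J.Boundaryless]
    [IsManifold J ∞ M] [I.Boundaryless] [IsManifold I ∞ N] {θ : OneForm J M} (h : θ.IsSmooth)
    {ψ : ℝ → N → M} (hψ : ContMDiff (𝓘(ℝ, ℝ).prod I) J ∞ (fun z : ℝ × N => ψ z.1 z.2))
    (t : ℝ) (x : N) (w : TangentSpace I x) :
    HasDerivAt (fun τ => (OneForm.pullback (I := I) (ψ τ) θ x : E' →L[ℝ] ℝ) w)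
      (HAdd.hAdd (α := ℝ) (β := ℝ) (γ := ℝ)
        (θ.d (ψ t x) (velocity J (fun τ => ψ τ x) t) (mfderiv I J (ψ t) x w))
        ((mfderiv I 𝓘(ℝ, ℝ) (fun y => θ (ψ t y) (velocity J (fun τ => ψ τ y) t)) x :
          E' →L[ℝ] ℝ) w)) t := by
  set φ := extChartAt I x with hφ
  have hxs : x ∈ φ.source := mem_extChartAt_source _
  have hut : φ x ∈ φ.target := mem_extChartAt_target x
  have hleft : φ.symm (φ x) = x := φ.left_inv hxs
  have hopen : IsOpen φ.target := isOpen_extChartAt_target _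
  have hso : IsOpen φ.source := isOpen_extChartAt_source _
  have hsymm : ContMDiffOn 𝓘(ℝ, E') I ∞ φ.symm φ.target := contMDiffOn_extChartAt_symm _
  have hφs : ContMDiffOn I 𝓘(ℝ, E') ∞ φ φ.source := by
    rw [hφ, extChartAt_source]
    exact contMDiffOn_extChartAt
  -- With `α = G^* θ` on the vector space `ℝ × E'`, Cartan's formula is just `∂_t α(w) = dα(∂_t, w)
  -- + ∂_w α(∂_t)` for the constant vectors `∂_t = (1, 0)` and `(0, w)`.
  let G : ℝ × E' → M := fun p => ψ p.1 (φ.symm p.2)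
  have hGs : ∀ p : ℝ × E', p.2 ∈ φ.target → ContMDiffAt 𝓘(ℝ, ℝ × E') J ∞ G p := by
    intro p hp
    have a1 : ContMDiffAt 𝓘(ℝ, ℝ × E') 𝓘(ℝ, ℝ) ∞ (fun q : ℝ × E' => q.1) p :=
      contDiff_fst.contMDiff.contMDiffAt
    have a2 : ContMDiffAt 𝓘(ℝ, ℝ × E') 𝓘(ℝ, E') ∞ (fun q : ℝ × E' => q.2) p :=
      contDiff_snd.contMDiff.contMDiffAt
    have a3 := (hsymm.contMDiffAt (hopen.mem_nhds hp)).comp p a2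
    exact (hψ.contMDiffAt (x := (p.1, φ.symm p.2))).comp p (a1.prodMk a3)
  have hGd : ∀ p : ℝ × E', p.2 ∈ φ.target → MDifferentiableAt 𝓘(ℝ, ℝ × E') J G p :=
    fun p hp => (hGs p hp).mdifferentiableAt (by simp)
  have hslice : ∀ τ y, MDifferentiableAt I J (ψ τ) y := fun τ y =>
    (hψ.comp (contMDiff_const.prodMk contMDiff_id)).mdifferentiableAt (by simp)
  have htime : ∀ p : ℝ × E', p.2 ∈ φ.target → (mfderiv 𝓘(ℝ, ℝ × E') J G p : ℝ × E' →L[ℝ] E) (1, 0)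
      = velocity J (fun τ => ψ τ (φ.symm p.2)) p.1 := by
    intro p hp
    have hc : HasFDerivAt (fun τ : ℝ => ((τ, p.2) : ℝ × E'))
        (ContinuousLinearMap.prod (ContinuousLinearMap.id ℝ ℝ) 0) p.1 :=
      (hasFDerivAt_id p.1).prodMk (hasFDerivAt_const p.2 p.1)
    have := mfderiv_comp_fderiv (G := G) (c := fun τ : ℝ => ((τ, p.2) : ℝ × E')) (q := p.1)
      (hGd p hp) hc.differentiableAt 1
    rw [hc.fderiv] at this
    exact this.symm
  have hspace : ∀ τ : ℝ, (mfderiv 𝓘(ℝ, ℝ × E') J G (τ, φ x) : ℝ × E' →L[ℝ] E) (0, w)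
      = (mfderiv I J (ψ τ) x : E' →L[ℝ] E) w := by
    intro τ
    have hc : HasFDerivAt (fun u : E' => ((τ, u) : ℝ × E'))
        (ContinuousLinearMap.prod 0 (ContinuousLinearMap.id ℝ _)) (φ x) :=
      (hasFDerivAt_const τ (φ x)).prodMk (hasFDerivAt_id (φ x))
    have c1 := mfderiv_comp_fderiv (G := G) (c := fun u : E' => ((τ, u) : ℝ × E')) (q := φ x)
      (hGd (τ, φ x) hut) hc.differentiableAt w
    have d2 : MDifferentiableAt 𝓘(ℝ, E') I φ.symm (φ x) :=
      (hsymm.contMDiffAt (hopen.mem_nhds hut)).mdifferentiableAt (by simp)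
    have d3 : mfderiv 𝓘(ℝ, E') I φ.symm (φ x) = ContinuousLinearMap.id ℝ _ := by
      have := mfderivWithin_range_extChartAt_symm (I := I) (x := x)
      rwa [ModelWithCorners.range_eq_univ, mfderivWithin_univ] at this
    have c2 := mfderiv_comp (φ x) (hslice τ (φ.symm (φ x))) d2
    rw [d3] at c2
    have key : ∀ z : N, z = x → (mfderiv I J (ψ τ) z : E' →L[ℝ] E) w
        = (mfderiv I J (ψ τ) x : E' →L[ℝ] E) w := by
      rintro z rfl
      rfl
    rw [hc.fderiv] at c1
    refine c1.symm.trans ?_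
    refine (congrArg (fun T : E' →L[ℝ] E => T w) c2).trans ?_
    exact key _ hleft
  have hval : ∀ τ : ℝ, ∀ u : E', ∀ a : ℝ × E',
      (OneForm.pullback (I := 𝓘(ℝ, ℝ × E')) G θ (τ, u) : ℝ × E' →L[ℝ] ℝ) a
        = (θ (ψ τ (φ.symm u)) : E →L[ℝ] ℝ) ((mfderiv 𝓘(ℝ, ℝ × E') J G (τ, u) : ℝ × E' →L[ℝ] E) a) :=
    fun τ u a => rfl
  have hθ : ∀ z : N, z = x → ∀ τ (v : E), (θ (ψ τ z) : E →L[ℝ] ℝ) v = (θ (ψ τ x) : E →L[ℝ] ℝ) v := by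
    rintro z rfl τ v
    rfl
  have hθd : ∀ z : N, z = x → ∀ v v' : E, θ.d (ψ t z) v v' = θ.d (ψ t x) v v' := by
    rintro z rfl v v'
    rfl
  set b : N → ℝ := fun y => θ (ψ t y) (velocity J (fun τ => ψ τ y) t) with hb
  obtain ⟨hdiff, hform⟩ := OneForm.fderiv_pullback h ((hGs (t, φ x) hut).of_le (by norm_cast))
  have hform' := hform (1, 0) (0, w)
  -- the derivative of `b`
  have hbα : ∀ u ∈ φ.target, (OneForm.pullback (I := 𝓘(ℝ, ℝ × E')) G θ (t, u) : ℝ × E' →L[ℝ] ℝ) (1, 0)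
      = b (φ.symm u) := by
    intro u hu
    rw [hval, htime (t, u) hu]
  have hbd : (mfderiv I 𝓘(ℝ, ℝ) b x : E' →L[ℝ] ℝ) w
      = fderiv ℝ (fun q => (OneForm.pullback (I := 𝓘(ℝ, ℝ × E')) G θ q : ℝ × E' →L[ℝ] ℝ) (1, 0))
        (t, φ x) (0, w) := by
    have hc : HasFDerivAt (fun u : E' => ((t, u) : ℝ × E'))
        (ContinuousLinearMap.prod 0 (ContinuousLinearMap.id ℝ _)) (φ x) :=
      (hasFDerivAt_const t (φ x)).prodMk (hasFDerivAt_id (φ x))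
    have h1 := HasFDerivAt.comp (f := fun u : E' => ((t, u) : ℝ × E')) (φ x)
      (hdiff (1, 0)).hasFDerivAt hc
    have h2 : b =ᶠ[nhds x] (fun u => (OneForm.pullback (I := 𝓘(ℝ, ℝ × E')) G θ (t, u) :
        ℝ × E' →L[ℝ] ℝ) (1, 0)) ∘ φ := by
      filter_upwards [hso.mem_nhds hxs] with y hy
      rw [Function.comp_apply, hbα _ (φ.map_source hy), φ.left_inv hy]
    have h3 : MDifferentiableAt I 𝓘(ℝ, E') φ x :=
      (hφs.contMDiffAt (hso.mem_nhds hxs)).mdifferentiableAt (by simp)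
    rw [h2.mfderiv_eq]
    have h4 := mfderiv_comp x (g := fun u => (OneForm.pullback (I := 𝓘(ℝ, ℝ × E')) G θ (t, u) :
        ℝ × E' →L[ℝ] ℝ) (1, 0)) h1.differentiableAt.mdifferentiableAt h3
    rw [mfderiv_eq_fderiv, hφ, mfderiv_extChartAt_self] at h4
    refine (congrArg (fun T : E' →L[ℝ] ℝ => T w) h4).trans ?_
    exact congrArg (fun T : E' →L[ℝ] ℝ => T w) h1.fderiv
  have hc : HasDerivAt (fun τ : ℝ => ((τ, φ x) : ℝ × E')) (1, 0) t :=
    (hasDerivAt_id t).prodMk (hasDerivAt_const t (φ x))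
  have h1 := (hdiff (0, w)).hasFDerivAt.comp_hasDerivAt t hc
  have h2 : (fun τ => (OneForm.pullback (I := I) (ψ τ) θ x : E' →L[ℝ] ℝ) w)
      = (fun q => (OneForm.pullback (I := 𝓘(ℝ, ℝ × E')) G θ q : ℝ × E' →L[ℝ] ℝ) (0, w))
        ∘ fun τ : ℝ => ((τ, φ x) : ℝ × E') := by
    funext τ
    rw [Function.comp_apply, hval, hspace]
    exact (hθ _ hleft τ _).symm
  rw [h2]
  refine h1.congr_deriv ?_
  have h5 : θ.d (G (t, φ x)) (mfderiv 𝓘(ℝ, ℝ × E') J G (t, φ x) (1, 0))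
      (mfderiv 𝓘(ℝ, ℝ × E') J G (t, φ x) (0, w))
      = θ.d (ψ t x) (velocity J (fun τ => ψ τ x) t) (mfderiv I J (ψ t) x w) := by
    have k : ∀ z : N, z = x → (velocity J (fun τ => ψ τ z) t : E) = velocity J (fun τ => ψ τ x) t := by
      rintro z rfl
      rfl
    refine (hθd _ hleft _ _).trans ?_
    have k1 := (htime (t, φ x) hut).trans (k _ hleft)
    have k2 := hspace t
    exact congrArg₂ (fun a b : E => θ.d (ψ t x) a b) k1 k2
  rw [← h5, ← hform']
  change _ = _ + (mfderiv I 𝓘(ℝ, ℝ) b x : E' →L[ℝ] ℝ) w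
  rw [hbd]
  exact (sub_add_cancel (G := ℝ) _ _).symm

/-- The function is the pullback of `θ` under the total map `ℝ × N → M`, evaluated on the vector
field `∂_t = (1, 0)`. Smoothness of conformal factors, rates and Hamiltonians all reduces to this.
-/
theorem contMDiff_form_velocity [IsManifold J 1 M] [IsManifold I 1 N] {θ : OneForm J M}
    (h : θ.IsSmooth) {ψ : ℝ → N → M}
    (hψ : ContMDiff (𝓘(ℝ, ℝ).prod I) J ∞ (fun z : ℝ × N => ψ z.1 z.2)) :
    ContMDiff (𝓘(ℝ, ℝ).prod I) 𝓘(ℝ, ℝ) ∞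
      (fun z : ℝ × N => θ (ψ z.1 z.2) (velocity J (fun τ => ψ τ z.2) z.1)) := by
  have h1 : ContMDiff 𝓘(ℝ, ℝ) 𝓘(ℝ, ℝ).tangent ∞
      (fun y : ℝ => (⟨y, 1⟩ : TangentBundle 𝓘(ℝ, ℝ) ℝ)) :=
    contMDiff_vectorSpace_iff_contDiff.2 contDiff_const
  have h2 : ContMDiff I I.tangent ∞ (fun y : N => (⟨y, 0⟩ : TangentBundle I N)) :=
    Bundle.contMDiff_zeroSection ℝ (TangentSpace I : N → Type _)
  have h3 := (contMDiff_equivTangentBundleProd_symm (n := ∞) (I := 𝓘(ℝ, ℝ)) (M := ℝ) (I' := I)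
    (M' := N)).comp (h1.prodMap h2)
  have h4 := ContMDiff.comp (OneForm.IsSmooth.pullback h hψ) h3
  refine h4.congr ?_
  rintro ⟨t, x⟩
  have h5 : MDifferentiableAt 𝓘(ℝ, ℝ) (𝓘(ℝ, ℝ).prod I) (fun τ : ℝ => (τ, x)) t :=
    mdifferentiableAt_id.prodMk mdifferentiableAt_const
  have h6 := mfderiv_comp t (hψ.mdifferentiableAt (by simp) (x := (t, x))) h5
  rw [mfderiv_prod_left] at h6
  have h7 : velocity J (fun τ => ψ τ x) t
      = (mfderiv (𝓘(ℝ, ℝ).prod I) J (fun z : ℝ × N => ψ z.1 z.2) (t, x) : ℝ × E' →L[ℝ] E) (1, 0) :=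
    congrArg (fun T : ℝ →L[ℝ] E => T 1) h6
  rw [h7]
  rfl

/-- A smooth isotopy preserving the primitive `θ` is a Hamiltonian isotopy. -/
theorem isHamiltonianFlow_of_preserves [FiniteDimensional ℝ E] [J.Boundaryless]
    [IsManifold J ∞ M] {θ : OneForm J M} (h : θ.IsSmooth) {ψ ψ' : ℝ → M → M}
    (hψ : ContMDiff (𝓘(ℝ, ℝ).prod J) J ∞ (fun z : ℝ × M => ψ z.1 z.2))
    (hψ' : ContMDiff (𝓘(ℝ, ℝ).prod J) J ∞ (fun z : ℝ × M => ψ' z.1 z.2))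
    (hinv : ∀ t x, ψ t (ψ' t x) = x) (hinv' : ∀ t x, ψ' t (ψ t x) = x) (h0 : ∀ x, ψ 0 x = x)
    (hθ : ∀ t x, OneForm.pullback (I := J) (ψ t) θ x = θ x) :
    IsHamiltonianFlow θ
      (fun t x => θ (ψ t (ψ' t x)) (velocity J (fun τ => ψ τ (ψ' t x)) t)) ψ := by
  have hb := contMDiff_form_velocity h hψ
  have hF : ContMDiff (𝓘(ℝ, ℝ).prod J) 𝓘(ℝ, ℝ) ∞ (fun z : ℝ × M =>
      θ (ψ z.1 (ψ' z.1 z.2)) (velocity J (fun τ => ψ τ (ψ' z.1 z.2)) z.1)) :=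
    hb.comp (contMDiff_fst.prodMk hψ')
  refine ⟨hF, hψ, h0, fun t x w => ?_⟩
  set F : M → ℝ := fun x => θ (ψ t (ψ' t x)) (velocity J (fun τ => ψ τ (ψ' t x)) t) with hFdef
  have hFd : MDifferentiableAt J 𝓘(ℝ, ℝ) F (ψ t x) :=
    (hF.comp (contMDiff_const.prodMk contMDiff_id)).mdifferentiableAt (by simp)
  have hd : ∀ y, MDifferentiableAt J J (ψ t) y := fun y =>
    (hψ.comp (contMDiff_const.prodMk contMDiff_id)).mdifferentiableAt (by simp)
  have hd' : ∀ y, MDifferentiableAt J J (ψ' t) y := fun y =>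
    (hψ'.comp (contMDiff_const.prodMk contMDiff_id)).mdifferentiableAt (by simp)
  -- surjectivity of the derivative of `ψ t`
  obtain ⟨v, hv⟩ : ∃ v : E, (mfderiv J J (ψ t) x : E →L[ℝ] E) v = w := by
    have k : ∀ z, z = x → ∀ v : E, (mfderiv J J (ψ t) z : E →L[ℝ] E) v
        = (mfderiv J J (ψ t) x : E →L[ℝ] E) v := by
      rintro z rfl v
      rfl
    have h1 := mfderiv_comp (ψ t x) (hd (ψ' t (ψ t x))) (hd' (ψ t x))
    have h2 : (ψ t ∘ ψ' t) = id := funext (hinv t)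
    rw [h2, mfderiv_id] at h1
    refine ⟨(mfderiv J J (ψ' t) (ψ t x) : E →L[ℝ] E) w, ?_⟩
    exact (k _ (hinv' t x) _).symm.trans (congrArg (fun T : E →L[ℝ] E => T w) h1).symm
  -- The left side of Cartan's formula vanishes because `ψ_t^* θ = θ`; what remains is Hamilton's
  -- equation tested on `w = Dψ_t v`.
  have h1 := OneForm.hasDerivAt_pullback h hψ t x v
  have h2 : (fun τ => (OneForm.pullback (I := J) (ψ τ) θ x : E →L[ℝ] ℝ) v)
      = fun _ => (θ x : E →L[ℝ] ℝ) v := by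
    funext τ
    rw [hθ]
  rw [h2] at h1
  have h3 := h1.unique (hasDerivAt_const t _)
  have h4 : (fun y => θ (ψ t y) (velocity J (fun τ => ψ τ y) t)) = F ∘ ψ t := by
    funext y
    have k : ∀ z, z = y → θ (ψ t y) (velocity J (fun τ => ψ τ y) t)
        = θ (ψ t z) (velocity J (fun τ => ψ τ z) t) := by
      rintro z rfl
      rfl
    exact k _ (hinv' t y)
  have h5 := mfderiv_comp x hFd (hd x)
  rw [h4] at h3
  have h6 := congrArg (fun T : E →L[ℝ] ℝ => T v) h5
  have h7 : (mfderiv J 𝓘(ℝ, ℝ) (F ∘ ψ t) x : E →L[ℝ] ℝ) v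
    = (mfderiv J 𝓘(ℝ, ℝ) F (ψ t x) : E →L[ℝ] ℝ) w := by
    rw [← hv]
    exact h6
  have h8 : θ.d (ψ t x) (velocity J (fun τ => ψ τ x) t) (mfderiv J J (ψ t) x v)
      = θ.d (ψ t x) (velocity J (fun τ => ψ τ x) t) w :=
    congrArg (fun a : E => θ.d (ψ t x) (velocity J (fun τ => ψ τ x) t) a) hv
  exact eq_neg_of_add_eq_zero_left (G := ℝ)
    ((congrArg₂ (fun a b : ℝ => a + b) h8.symm h7.symm).trans h3)

end FormCalculus

/-! ### Conformal factors and rates of contact isotopies -/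

section Rate

variable {d : ℕ} {V : Type*} [TopologicalSpace V] [ChartedSpace (EuclideanSpace ℝ (Fin d)) V]
  [IsManifold (𝓡 d) ∞ V] {lam : ContactForm d V} {e : ReebCircleAction lam}
  {P : Type*} [NormedAddCommGroup P] [NormedSpace ℝ P]
  {Q : Type*} [NormedAddCommGroup Q] [NormedSpace ℝ Q]
  {E' : Type*} [NormedAddCommGroup E'] [NormedSpace ℝ E']
  {H' : Type*} [TopologicalSpace H'] {I : ModelWithCorners ℝ E' H'}
  {N : Type*} [TopologicalSpace N] [ChartedSpace H' N]

variable (lam) in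
/-- A smooth family of co-orientation preserving contactomorphisms. -/
structure IsContactFamily (f : P → Equiv.Perm V) : Prop where
  smooth : ContMDiff (𝓘(ℝ, P).prod (𝓡 d)) (𝓡 d) ∞ (fun z : P × V => f z.1 z.2)
  smooth_inv : ContMDiff (𝓘(ℝ, P).prod (𝓡 d)) (𝓡 d) ∞ (fun z : P × V => (f z.1)⁻¹ z.2)
  contact : ∀ p x, ∃ ρ : ℝ, 0 < ρ ∧
    OneForm.pullback (I := 𝓡 d) (f p) lam.form x = ρ • lam.form x

theorem IsSmoothFamily.isContactFamily {f : P → Equiv.Perm V} (hf : IsSmoothFamily e f) :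
    IsContactFamily lam f := ⟨hf.smooth, hf.smooth_inv, hf.contact⟩

theorem IsContactFamily.comp {f : P → Equiv.Perm V} (hf : IsContactFamily lam f) {u : Q → P}
    (hu : ContDiff ℝ ∞ u) : IsContactFamily lam (fun q => f (u q)) where
  smooth := hf.smooth.comp ((hu.contMDiff.comp contMDiff_fst).prodMk contMDiff_snd)
  smooth_inv := hf.smooth_inv.comp ((hu.contMDiff.comp contMDiff_fst).prodMk contMDiff_snd)
  contact q x := hf.contact (u q) x

theorem IsContactFamily.slice {f : P → Equiv.Perm V} (hf : IsContactFamily lam f) (p : P) :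
    ContMDiff (𝓡 d) (𝓡 d) ∞ (f p) :=
  hf.smooth.comp (contMDiff_const.prodMk contMDiff_id)

variable (e) in
/-- The factor `ρ` in `g^* λ = ρ λ`. -/
def conformalFactor (g : V → V) (x : V) : ℝ :=
  lam.form (g (e.flow 0 x)) (velocity (𝓡 d) (fun τ => g (e.flow τ x)) 0)

variable (lam) in
/-- The contact Hamiltonian `λ(∂_t f_t)` of a path, as a function of the starting point. -/
def rate (f : ℝ → Equiv.Perm V) (t : ℝ) (x : V) : ℝ :=
  lam.form (f t x) (velocity (𝓡 d) (fun τ => f τ x) t)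

theorem ReebCircleAction.contMDiff_orbit (x : V) :
    ContMDiff 𝓘(ℝ, ℝ) (𝓡 d) ∞ (fun τ => e.flow τ x) :=
  e.smooth.comp (contMDiff_id.prodMk contMDiff_const)

/-- Both sides of `g^* λ = ρ λ` are evaluated on the Reeb vector, where `λ = 1`. The base point
`e.flow 0 x` equals `x` only propositionally, hence the transport. -/
theorem conformalFactor_eq {g : V → V} {x : V} (hg : MDifferentiableAt (𝓡 d) (𝓡 d) g x) {ρ : ℝ}
    (h : OneForm.pullback (I := 𝓡 d) g lam.form x = ρ • lam.form x) :
    conformalFactor e g x = ρ := by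
  have h0 : e.flow 0 x = x := by rw [e.flow_zero]; rfl
  have k1 : MDifferentiableAt (𝓡 d) (𝓡 d) g (e.flow 0 x) := by rwa [h0]
  have k2 : MDifferentiableAt 𝓘(ℝ, ℝ) (𝓡 d) (fun τ => e.flow τ x) 0 :=
    (e.contMDiff_orbit x).mdifferentiableAt (by simp)
  have k3 := mfderiv_comp (0 : ℝ) k1 k2
  have k4 : ∀ z, z = x → OneForm.pullback (I := 𝓡 d) g lam.form z = ρ • lam.form z := by
    rintro z rfl
    exact h
  have k5 := congrArg (fun T : EuclideanSpace ℝ (Fin d) →L[ℝ] ℝ =>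
    T (velocity (𝓡 d) (fun τ => e.flow τ x) 0)) (k4 _ h0)
  have k6 : (ρ • lam.form (e.flow 0 x)) (velocity (𝓡 d) (fun τ => e.flow τ x) 0) = ρ := by
    change ρ * lam.form (e.flow 0 x) (velocity (𝓡 d) (fun τ => e.flow τ x) 0) = ρ
    rw [e.form_velocity, mul_one]
  refine Eq.trans ?_ (k5.trans k6)
  exact congrArg (fun T : ℝ →L[ℝ] EuclideanSpace ℝ (Fin d) =>
    (lam.form (g (e.flow 0 x)) : EuclideanSpace ℝ (Fin d) →L[ℝ] ℝ) (T 1)) k3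

theorem IsContactFamily.pullback_eq {f : P → Equiv.Perm V} (hf : IsContactFamily lam f) (p : P)
    (x : V) : OneForm.pullback (I := 𝓡 d) (f p) lam.form x
      = conformalFactor e (f p) x • lam.form x := by
  obtain ⟨ρ, -, h⟩ := hf.contact p x
  rw [conformalFactor_eq ((hf.slice p).mdifferentiableAt (by simp)) h, h]

theorem IsContactFamily.conformalFactor_pos {f : P → Equiv.Perm V} (hf : IsContactFamily lam f)
    (p : P) (x : V) : 0 < conformalFactor e (f p) x := by
  obtain ⟨ρ, hρ, h⟩ := hf.contact p x
  rwa [conformalFactor_eq ((hf.slice p).mdifferentiableAt (by simp)) h]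

/-- Writing the factor as `λ` of a velocity, namely of `τ ↦ f_p(e_τ x)` at `τ = 0`, puts it in the
scope of `contMDiff_form_velocity`, with `(p, x)` as parameter. -/
theorem IsContactFamily.contMDiff_conformalFactor {f : P → Equiv.Perm V}
    (hf : IsContactFamily lam f) :
    ContMDiff (𝓘(ℝ, P).prod (𝓡 d)) 𝓘(ℝ, ℝ) ∞
      (fun z : P × V => conformalFactor e (f z.1) z.2) := by
  have h1 : ContMDiff (𝓘(ℝ, ℝ).prod (𝓘(ℝ, P).prod (𝓡 d))) (𝓡 d) ∞
      (fun z : ℝ × (P × V) => f z.2.1 (e.flow z.1 z.2.2)) :=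
    hf.smooth.comp ((contMDiff_fst.comp contMDiff_snd).prodMk
      (e.smooth.comp (contMDiff_fst.prodMk (contMDiff_snd.comp contMDiff_snd))))
  exact (contMDiff_form_velocity (I := 𝓘(ℝ, P).prod (𝓡 d)) lam.smooth
    (ψ := fun τ (z : P × V) => f z.1 (e.flow τ z.2)) h1).comp (contMDiff_const.prodMk contMDiff_id)

theorem contMDiff_rate_param {f : P → ℝ → Equiv.Perm V}
    (hf : ContMDiff (𝓘(ℝ, P × ℝ).prod (𝓡 d)) (𝓡 d) ∞ (fun z : (P × ℝ) × V => f z.1.1 z.1.2 z.2)) :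
    ContMDiff (𝓘(ℝ, P × ℝ).prod (𝓡 d)) 𝓘(ℝ, ℝ) ∞
      (fun z : (P × ℝ) × V => rate lam (f z.1.1) z.1.2 z.2) := by
  have h1 : ContMDiff (𝓘(ℝ, ℝ).prod (𝓘(ℝ, P).prod (𝓡 d))) (𝓡 d) ∞
      (fun z : ℝ × (P × V) => f z.2.1 z.1 z.2.2) :=
    hf.comp (ContMDiff.prodMk (ContMDiff.prodMk_space (contMDiff_fst.comp contMDiff_snd)
      contMDiff_fst) (contMDiff_snd.comp contMDiff_snd))
  have h2 := contMDiff_form_velocity (I := 𝓘(ℝ, P).prod (𝓡 d)) lam.smooth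
    (ψ := fun τ (z : P × V) => f z.1 τ z.2) h1
  have a1 : ContMDiff (𝓘(ℝ, P × ℝ).prod (𝓡 d)) 𝓘(ℝ, ℝ) ∞ (fun z : (P × ℝ) × V => z.1.2) :=
    contDiff_snd.contMDiff.comp contMDiff_fst
  have a2 : ContMDiff (𝓘(ℝ, P × ℝ).prod (𝓡 d)) 𝓘(ℝ, P) ∞ (fun z : (P × ℝ) × V => z.1.1) :=
    contDiff_fst.contMDiff.comp contMDiff_fst
  exact h2.comp (a1.prodMk (a2.prodMk contMDiff_snd))

theorem IsContactFamily.contMDiff_rate {f : ℝ → Equiv.Perm V} (hf : IsContactFamily lam f) :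
    ContMDiff (𝓘(ℝ, ℝ).prod (𝓡 d)) 𝓘(ℝ, ℝ) ∞ (fun z : ℝ × V => rate lam f z.1 z.2) :=
  contMDiff_form_velocity lam.smooth (ψ := fun t x => f t x) hf.smooth

variable (I) in
/-- The differential of a real function on a manifold. -/
def scalarDeriv (τ : N → ℝ) (y : N) : E' →L[ℝ] ℝ := mfderiv I 𝓘(ℝ, ℝ) τ y

theorem clm_apply_real {F : Type*} [NormedAddCommGroup F] [NormedSpace ℝ F] (T : ℝ →L[ℝ] F)
    (a : ℝ) : T a = a • T 1 := by
  rw [← map_smul, smul_eq_mul, mul_one]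

/-- The pullback of `λ` along `y ↦ f_{τ(y)}(g(y))`. -/
theorem IsContactFamily.pullback_prodMk {f : ℝ → Equiv.Perm V} (hf : IsContactFamily lam f)
    {τ : N → ℝ} {g : N → V} {y : N} (hτ : MDifferentiableAt I 𝓘(ℝ, ℝ) τ y)
    (hg : MDifferentiableAt I (𝓡 d) g y) (w : TangentSpace I y) :
    (OneForm.pullback (I := I) (fun y => f (τ y) (g y)) lam.form y : E' →L[ℝ] ℝ) w
      = rate lam f (τ y) (g y) * scalarDeriv I τ y w
        + conformalFactor e (f (τ y)) (g y) *
          (OneForm.pullback (I := I) g lam.form y : E' →L[ℝ] ℝ) w := by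
  have hF : MDifferentiableAt (𝓘(ℝ, ℝ).prod (𝓡 d)) (𝓡 d) (fun z : ℝ × V => f z.1 z.2)
    (τ y, g y) := hf.smooth.mdifferentiableAt (by simp)
  have h1 := mfderiv_comp y hF (hτ.prodMk hg)
  rw [mfderiv_prodMk hτ hg] at h1
  have h2 := congrArg (fun T : E' →L[ℝ] EuclideanSpace ℝ (Fin d) => T w) h1
  have h3 := mfderiv_prod_eq_add_apply (v := (((mfderiv I 𝓘(ℝ, ℝ) τ y : E' →L[ℝ] ℝ) w,
    (mfderiv I (𝓡 d) g y : E' →L[ℝ] EuclideanSpace ℝ (Fin d)) w) :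
      ℝ × EuclideanSpace ℝ (Fin d))) hF
  have h4 := congrArg (fun T : EuclideanSpace ℝ (Fin d) →L[ℝ] ℝ =>
    T ((mfderiv I (𝓡 d) g y : E' →L[ℝ] EuclideanSpace ℝ (Fin d)) w))
    (hf.pullback_eq (e := e) (τ y) (g y))
  have h5 : (lam.form (f (τ y) (g y)) : EuclideanSpace ℝ (Fin d) →L[ℝ] ℝ)
      ((mfderiv 𝓘(ℝ, ℝ) (𝓡 d) (fun z => f z (g y)) (τ y) : ℝ →L[ℝ] EuclideanSpace ℝ (Fin d))
        (scalarDeriv I τ y w))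
      = rate lam f (τ y) (g y) * scalarDeriv I τ y w := by
    refine (congrArg (lam.form (f (τ y) (g y)) : EuclideanSpace ℝ (Fin d) →L[ℝ] ℝ)
      (clm_apply_real (F := EuclideanSpace ℝ (Fin d)) _ (scalarDeriv I τ y w))).trans ?_
    refine (map_smul (lam.form (f (τ y) (g y)) : EuclideanSpace ℝ (Fin d) →L[ℝ] ℝ) _ _).trans ?_
    exact mul_comm _ _
  refine (congrArg (lam.form (f (τ y) (g y)) : EuclideanSpace ℝ (Fin d) →L[ℝ] ℝ)
    (h2.trans h3)).trans ?_
  refine (map_add (lam.form (f (τ y) (g y)) : EuclideanSpace ℝ (Fin d) →L[ℝ] ℝ) _ _).trans ?_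
  exact congrArg₂ (fun a b : ℝ => a + b) h5 h4

theorem IsContactFamily.mdifferentiableAt_time {f : ℝ → Equiv.Perm V} (hf : IsContactFamily lam f)
    (t : ℝ) (x : V) : MDifferentiableAt 𝓘(ℝ, ℝ) (𝓡 d) (fun τ => f τ x) t :=
  (hf.smooth.comp (contMDiff_id.prodMk contMDiff_const)).mdifferentiableAt (by simp)

/-- The chain rule for `t ↦ f_t(g_t x)`: the motion of `f` contributes its rate, and the velocity of
`g` is carried by `Df_t`, which multiplies `λ` by the conformal factor. -/
theorem rate_mul {f g : ℝ → Equiv.Perm V} (hf : IsContactFamily lam f)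
    (hg : IsContactFamily lam g) (t : ℝ) (x : V) :
    rate lam (f * g) t x
      = rate lam f t (g t x) + conformalFactor e (f t) (g t x) * rate lam g t x := by
  have h := hf.pullback_prodMk (e := e) (I := 𝓘(ℝ, ℝ)) (τ := fun t => t) (g := fun t => g t x)
    (y := t) mdifferentiableAt_id (hg.mdifferentiableAt_time t x) (1 : ℝ)
  have h1 : scalarDeriv 𝓘(ℝ, ℝ) (fun t : ℝ => t) t = ContinuousLinearMap.id ℝ ℝ := mfderiv_id
  rw [h1] at h
  refine h.trans ?_
  change _ * 1 + _ = _
  rw [mul_one]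
  rfl

variable (lam) in
theorem rate_one (t : ℝ) (x : V) : rate lam (1 : ℝ → Equiv.Perm V) t x = 0 := by
  have h : mfderiv 𝓘(ℝ, ℝ) (𝓡 d) (fun _ : ℝ => x) t = 0 := mfderiv_const
  have h2 := congrArg (fun T : ℝ →L[ℝ] EuclideanSpace ℝ (Fin d) =>
    (lam.form x : EuclideanSpace ℝ (Fin d) →L[ℝ] ℝ) (T 1)) h
  exact h2.trans (map_zero (lam.form x : EuclideanSpace ℝ (Fin d) →L[ℝ] ℝ))

theorem conformalFactor_one (x : V) : conformalFactor e (1 : Equiv.Perm V) x = 1 :=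
  conformalFactor_eq mdifferentiableAt_id ((pullback_id _ x).trans (one_smul ℝ _).symm)

theorem conformalFactor_flow (t : ℝ) (x : V) : conformalFactor e (e.flow t) x = 1 :=
  conformalFactor_eq (e.isSmoothFamily.slice t x) ((e.contact t x).trans (one_smul ℝ _).symm)

theorem rate_comp {f : ℝ → Equiv.Perm V} (hf : IsContactFamily lam f) {u : ℝ → ℝ} {t : ℝ}
    (hu : DifferentiableAt ℝ u t) (x : V) :
    rate lam (fun t => f (u t)) t x = deriv u t * rate lam f (u t) x := by
  have k := mfderiv_comp_fderiv (G := fun τ => f τ x) (c := u) (q := t)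
    (hf.mdifferentiableAt_time (u t) x) hu 1
  rw [fderiv_apply_one_eq_deriv] at k
  have k2 := clm_apply_real (F := EuclideanSpace ℝ (Fin d))
    (mfderiv 𝓘(ℝ, ℝ) (𝓡 d) (fun τ => f τ x) (u t)) (deriv u t)
  refine (congrArg (lam.form (f (u t) x) : EuclideanSpace ℝ (Fin d) →L[ℝ] ℝ)
    (k.trans k2)).trans ?_
  exact map_smul (lam.form (f (u t) x) : EuclideanSpace ℝ (Fin d) →L[ℝ] ℝ) _ _

theorem rate_flow (t : ℝ) (x : V) : rate lam e.flow t x = 1 := e.form_velocity t x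

theorem rate_flow_comp {u : ℝ → ℝ} {t : ℝ} (hu : DifferentiableAt ℝ u t) (x : V) :
    rate lam (fun t => e.flow (u t)) t x = deriv u t := by
  rw [rate_comp e.isSmoothFamily.isContactFamily hu, rate_flow, mul_one]

theorem rate_inv {f : ℝ → Equiv.Perm V} (hf : IsSmoothFamily e f) (t : ℝ) (x : V) :
    rate lam f⁻¹ t (f t x) = - conformalFactor e (f⁻¹ t) (f t x) * rate lam f t x := by
  have h := rate_mul (e := e) hf.inv.isContactFamily hf.isContactFamily t x
  rw [inv_mul_cancel, rate_one] at h
  linarith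

theorem rate_congr {f g : ℝ → Equiv.Perm V} {t : ℝ} {x : V}
    (h : (fun τ => f τ x) =ᶠ[nhds t] fun τ => g τ x) : rate lam f t x = rate lam g t x :=
  congrArg (fun T : ℝ →L[ℝ] ℝ => T 1) (OneForm.pullback_congr lam.form h)

end Rate

/-! ### Linear operations on smooth 1-forms -/

section SmoothForms

variable {E : Type*} [NormedAddCommGroup E] [NormedSpace ℝ E]
  {H : Type*} [TopologicalSpace H] {J : ModelWithCorners ℝ E H}
  {M : Type*} [TopologicalSpace M] [ChartedSpace H M] [IsManifold J 1 M]

theorem OneForm.IsSmooth.smul {θ : OneForm J M} (h : θ.IsSmooth) {a : M → ℝ}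
    (ha : ContMDiff J 𝓘(ℝ, ℝ) ∞ a) : OneForm.IsSmooth (I := J) (M := M) (fun x => a x • θ x) :=
  ContMDiff.mul (ha.comp (Bundle.contMDiff_proj (TangentSpace J : M → Type _))) h

theorem OneForm.IsSmooth.add {θ θ' : OneForm J M} (h : θ.IsSmooth) (h' : θ'.IsSmooth) :
    OneForm.IsSmooth (I := J) (M := M) (fun x => θ x + θ' x) :=
  ContMDiff.add h h'

end SmoothForms

/-! ### Lifts to the symplectization and the contact Hamiltonian -/

section Symplectization

variable {d : ℕ} {V : Type*} [TopologicalSpace V] [ChartedSpace (EuclideanSpace ℝ (Fin d)) V]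
  [IsManifold (𝓡 d) ∞ V] {lam : ContactForm d V} {e : ReebCircleAction lam}
  {P : Type*} [NormedAddCommGroup P] [NormedSpace ℝ P]

theorem contMDiff_ray : ContMDiff (sympModel d) 𝓘(ℝ, ℝ) ∞
    (fun z : Symplectization V => z.2.1) :=
  contMDiff_subtype_val.comp contMDiff_snd

variable (lam) in
theorem liouvilleForm_isSmooth : (liouvilleForm lam).IsSmooth :=
  (OneForm.IsSmooth.pullback lam.smooth contMDiff_fst).smul contMDiff_ray

theorem liouvilleForm_pullback {E' : Type*} [NormedAddCommGroup E'] [NormedSpace ℝ E']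
    {H' : Type*} [TopologicalSpace H'] {I : ModelWithCorners ℝ E' H'}
    {N : Type*} [TopologicalSpace N] [ChartedSpace H' N] {c : N → Symplectization V} {y : N}
    (hc : MDifferentiableAt I (sympModel d) c y) :
    OneForm.pullback (I := I) c (liouvilleForm lam) y
      = (c y).2.1 • OneForm.pullback (I := I) (fun y => (c y).1) lam.form y := by
  have h := OneForm.pullback_comp lam.form (g := (Prod.fst : Symplectization V → V)) (f := c)
    (x := y) (I₁ := I) (I₂ := sympModel d) mdifferentiableAt_fst hc
  change (((c y).2.1 • OneForm.pullback (I := sympModel d) Prod.fst lam.form (c y)).comp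
    (mfderiv I (sympModel d) c y)) = _
  rw [ContinuousLinearMap.smul_comp]
  exact congrArg ((c y).2.1 • ·) h.symm

variable (e) in
/-- The map `(x, s) ↦ (g x, s / ρ(x))` of the symplectization, where `g^* λ = ρ λ`. -/
def sympLift (g : V → V) (hg : ∀ x, 0 < conformalFactor e g x) (z : Symplectization V) :
    Symplectization V :=
  (g z.1, ⟨z.2.1 / conformalFactor e g z.1, div_pos z.2.2 (hg z.1)⟩)

variable (e) in
/-- The lift of a family of contactomorphisms to the symplectization. -/
def IsContactFamily.lift {f : P → Equiv.Perm V} (hf : IsContactFamily lam f) (p : P) :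
    Symplectization V → Symplectization V :=
  sympLift e (f p) (hf.conformalFactor_pos p)

theorem IsContactFamily.contMDiff_lift {f : P → Equiv.Perm V} (hf : IsContactFamily lam f) :
    ContMDiff (𝓘(ℝ, P).prod (sympModel d)) (sympModel d) ∞
      (fun z : P × Symplectization V => hf.lift e z.1 z.2) := by
  have h1 : ContMDiff (𝓘(ℝ, P).prod (sympModel d)) (𝓘(ℝ, P).prod (𝓡 d)) ∞
      (fun z : P × Symplectization V => (z.1, z.2.1)) :=
    contMDiff_fst.prodMk (contMDiff_fst.comp contMDiff_snd)
  refine (hf.smooth.comp h1).prodMk ((ContMDiff.subtypeVal_comp_iff posRay _).1 ?_)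
  exact (contMDiff_ray.comp contMDiff_snd).div₀ ((hf.contMDiff_conformalFactor (e := e)).comp h1)
    (fun z => (hf.conformalFactor_pos z.1 z.2.1).ne')

theorem IsContactFamily.isSymplecticLift {f : P → Equiv.Perm V} (hf : IsContactFamily lam f)
    (p : P) : IsSymplecticLift lam (f p) (hf.lift e p) := by
  refine fun z => ⟨rfl, ?_⟩
  have h := (hf.conformalFactor_pos (e := e) p z.1).ne'
  rw [hf.pullback_eq (e := e), smul_smul]
  change (z.2.1 / _ * _) • _ = _
  rw [div_mul_cancel₀ _ h]

/-- Since `λ` vanishes nowhere, preservation of `s λ` determines the new ray coordinate. -/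
theorem IsContactFamily.eq_lift {f : P → Equiv.Perm V} (hf : IsContactFamily lam f) {p : P}
    {g : Symplectization V → Symplectization V} (hg : IsSymplecticLift lam (f p) g) :
    g = hf.lift e p := by
  funext z
  obtain ⟨h1, h2⟩ := hg z
  have h := (hf.conformalFactor_pos (e := e) p z.1).ne'
  rw [hf.pullback_eq (e := e), smul_smul] at h2
  refine Prod.ext h1 (Subtype.ext ?_)
  change (g z).2.1 = z.2.1 / _
  rw [eq_div_iff h]
  exact smul_left_injective ℝ (lam.ne_zero z.1) h2

theorem conformalFactor_mul_inv {f : P → Equiv.Perm V} (hf : IsContactFamily lam f)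
    (hf' : IsContactFamily lam f⁻¹) (p : P) (x : V) :
    conformalFactor e (f⁻¹ p) (f p x) * conformalFactor e (f p) x = 1 := by
  have h1 := OneForm.pullback_comp (I₁ := 𝓡 d) (I₂ := 𝓡 d) lam.form (g := f⁻¹ p)
    (f := f p) (x := x) ((hf'.slice p).mdifferentiableAt (by simp))
    ((hf.slice p).mdifferentiableAt (by simp))
  have h2 : ((f⁻¹ p : Equiv.Perm V) : V → V) ∘ f p = fun y => y := by
    funext y
    simp
  rw [hf'.pullback_eq (e := e), h2, pullback_id, ContinuousLinearMap.smul_comp] at h1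
  have h3 := hf.pullback_eq (e := e) p x
  have h4 : lam.form x = conformalFactor e (f⁻¹ p) (f p x) •
      conformalFactor e (f p) x • lam.form x := by
    rw [← h3]
    exact h1
  rw [smul_smul] at h4
  refine (smul_left_injective ℝ (lam.ne_zero x) ?_).symm
  change (1 : ℝ) • lam.form x = _
  rw [one_smul]
  exact h4

theorem IsContactFamily.inv {f : P → Equiv.Perm V} (hf : IsContactFamily lam f) :
    IsContactFamily lam f⁻¹ where
  smooth := hf.smooth_inv
  smooth_inv := by simpa using hf.smooth
  contact p x := by
    obtain ⟨ρ, hρ, h⟩ := hf.contact p ((f p)⁻¹ x)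
    refine ⟨ρ⁻¹, inv_pos.2 hρ, ?_⟩
    have k : ContMDiff (𝓡 d) (𝓡 d) ∞ ((f p)⁻¹ : Equiv.Perm V) :=
      hf.smooth_inv.comp (contMDiff_const.prodMk contMDiff_id)
    have h1 := OneForm.pullback_comp (I₁ := 𝓡 d) (I₂ := 𝓡 d) lam.form (g := f p)
      (f := ((f p)⁻¹ : Equiv.Perm V)) (x := x) ((hf.slice p).mdifferentiableAt (by simp))
      (k.mdifferentiableAt (by simp))
    have h2 : ((f p : V → V) ∘ ((f p)⁻¹ : Equiv.Perm V)) = fun y => y := by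
      funext y
      simp
    rw [h, ContinuousLinearMap.smul_comp, h2, pullback_id] at h1
    rw [h1, smul_smul, inv_mul_cancel₀ hρ.ne', one_smul]
    rfl

theorem IsContactFamily.lift_inv_lift {f : P → Equiv.Perm V} (hf : IsContactFamily lam f) (p : P)
    (z : Symplectization V) : hf.inv.lift e p (hf.lift e p z) = z := by
  refine Prod.ext (by change (f p)⁻¹ (f p z.1) = z.1; simp) (Subtype.ext ?_)
  change z.2.1 / conformalFactor e (f p) z.1 / conformalFactor e (f⁻¹ p) (f p z.1) = z.2.1
  rw [div_div, mul_comm, conformalFactor_mul_inv hf hf.inv, div_one]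

theorem IsContactFamily.lift_lift_inv {f : P → Equiv.Perm V} (hf : IsContactFamily lam f) (p : P)
    (z : Symplectization V) : hf.lift e p (hf.inv.lift e p z) = z := by
  have h := hf.inv.lift_inv_lift (e := e) p z
  simp only [inv_inv] at h
  exact h

/-- The lift divides `s` by the factor by which `f_t^*` multiplies `λ`, so it preserves `s λ`. The
Hamiltonian supplied by `isHamiltonianFlow_of_preserves` is `s λ` of the velocity, i.e. `s` times
the rate at the starting point. -/
theorem isContactHamiltonianOf_rate {f : ℝ → Equiv.Perm V} (hf : IsContactFamily lam f)
    (h0 : f 0 = 1) (e : ReebCircleAction lam) :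
    IsContactHamiltonianOf lam (fun t z => z.2.1 * rate lam f t ((f t)⁻¹ z.1)) f := by
  refine ⟨fun t σ z => mul_assoc _ _ _, hf.lift e, hf.isSymplecticLift, ?_⟩
  have hs := hf.contMDiff_lift (e := e)
  have h := isHamiltonianFlow_of_preserves (liouvilleForm_isSmooth lam)
    (ψ := hf.lift e) (ψ' := hf.inv.lift e) hs hf.inv.contMDiff_lift hf.lift_lift_inv
    hf.lift_inv_lift (fun z => by
      refine Prod.ext (by change f 0 z.1 = z.1; rw [h0]; rfl) (Subtype.ext ?_)
      change z.2.1 / conformalFactor e (f 0) z.1 = _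
      rw [h0, conformalFactor_one, div_one])
    (fun t z => by
      have hd : MDifferentiableAt (sympModel d) (sympModel d) (hf.lift e t) z :=
        (hs.comp (contMDiff_const.prodMk contMDiff_id)).mdifferentiableAt (by simp)
      rw [liouvilleForm_pullback hd]
      have h2 := OneForm.pullback_comp lam.form (g := f t)
        (f := (Prod.fst : Symplectization V → V)) (x := z) (I₁ := sympModel d) (I₂ := 𝓡 d)
        ((hf.slice t).mdifferentiableAt (by simp)) mdifferentiableAt_fst
      rw [hf.pullback_eq (e := e), ContinuousLinearMap.smul_comp] at h2
      have h3 := (hf.conformalFactor_pos (e := e) t z.1).ne'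
      refine (congrArg (fun T => (z.2.1 / conformalFactor e (f t) z.1) • T) h2).trans ?_
      rw [smul_smul, div_mul_cancel₀ _ h3]
      rfl)
  convert h using 3 with t z
  have h1 : MDifferentiableAt 𝓘(ℝ, ℝ) (sympModel d)
      (fun τ => hf.lift e τ (hf.inv.lift e t z)) t :=
    (hs.comp (contMDiff_id.prodMk contMDiff_const)).mdifferentiableAt (by simp)
  have h2 := congrArg (fun T : ℝ →L[ℝ] ℝ => T 1) (liouvilleForm_pullback (lam := lam) h1)
  refine Eq.trans ?_ h2.symm
  change _ = (hf.lift e t (hf.inv.lift e t z)).2.1 * rate lam f t ((f t)⁻¹ z.1)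
  rw [hf.lift_lift_inv]

/-- A contact isotopy determines its contact Hamiltonian. -/
theorem IsContactHamiltonianOf.eq_rate {f : ℝ → Equiv.Perm V} (hf : IsContactFamily lam f)
    (h0 : f 0 = 1) (e : ReebCircleAction lam) {F : ℝ → Symplectization V → ℝ}
    (hF : IsContactHamiltonianOf lam F f) (t : ℝ) (z : Symplectization V) :
    F t z = z.2.1 * rate lam f t ((f t)⁻¹ z.1) := by
  -- The velocity of the orbit `e^τ · z` at `τ = 0` is the Euler vector, and `dF(Euler) = F` for `F`
  -- homogeneous of degree one; so `F` is recovered from its differential.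
  set c : ℝ → Symplectization V := fun τ => sympScale ⟨Real.exp τ, Real.exp_pos τ⟩ z with hc
  have hcs : ContMDiff 𝓘(ℝ, ℝ) (sympModel d) ∞ c := by
    refine contMDiff_const.prodMk ((ContMDiff.subtypeVal_comp_iff posRay _).1 ?_)
    exact (Real.contDiff_exp.mul contDiff_const).contMDiff
  have hcd : MDifferentiableAt 𝓘(ℝ, ℝ) (sympModel d) c 0 := hcs.mdifferentiableAt (by simp)
  have key : ∀ {F : ℝ → Symplectization V → ℝ}, IsContactHamiltonianOf lam F f →
      F t z = scalarDeriv (sympModel d) (F t) (c 0) (velocity (sympModel d) c 0) := by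
    intro F hF
    obtain ⟨hhom, fbar, -, hfb⟩ := hF
    have h1 : MDifferentiableAt (sympModel d) 𝓘(ℝ, ℝ) (F t) (c 0) :=
      (hfb.smooth_hamiltonian.comp (contMDiff_const.prodMk contMDiff_id)).mdifferentiableAt
        (by simp)
    have h2 := mfderiv_comp (0 : ℝ) h1 hcd
    have h3 : F t ∘ c = fun τ => Real.exp τ * F t z := by
      funext τ
      exact hhom t _ z
    have h4 : HasDerivAt (fun τ => Real.exp τ * F t z) (F t z) 0 := by
      have := (Real.hasDerivAt_exp 0).mul_const (F t z)
      rwa [Real.exp_zero, one_mul] at this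
    rw [h3, mfderiv_eq_fderiv] at h2
    have h5 := congrArg (fun T : ℝ →L[ℝ] ℝ => T 1) h2
    refine Eq.trans ?_ h5
    exact (h4.deriv.symm.trans fderiv_apply_one_eq_deriv.symm)
  have hF0 := isContactHamiltonianOf_rate hf h0 e
  have key2 : ∀ {F : ℝ → Symplectization V → ℝ}, IsContactHamiltonianOf lam F f →
      IsHamiltonianFlow (liouvilleForm lam) F (hf.lift e) := by
    rintro F ⟨-, fbar, hl, hfl⟩
    have : fbar = hf.lift e := funext fun τ => hf.eq_lift (hl τ)
    rwa [← this]
  -- Both Hamiltonians have the same flow, by uniqueness of the lift. Hamilton's equation then gives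
  -- them equal differentials at every point in the image of the time `t` map, which is all of `SV`.
  have key3 : ∀ y : Symplectization V, scalarDeriv (sympModel d) (F t) y
      = scalarDeriv (sympModel d) (fun z => z.2.1 * rate lam f t ((f t)⁻¹ z.1)) y := by
    intro y
    have h1 : ∀ w, scalarDeriv (sympModel d) (F t) (hf.lift e t (hf.inv.lift e t y)) w
        = scalarDeriv (sympModel d) (fun z => z.2.1 * rate lam f t ((f t)⁻¹ z.1))
          (hf.lift e t (hf.inv.lift e t y)) w := by
      intro w
      have a := (key2 hF).hamilton t (hf.inv.lift e t y) w
      have b := (key2 hF0).hamilton t (hf.inv.lift e t y) w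
      exact neg_injective (a.symm.trans b)
    rw [hf.lift_lift_inv] at h1
    exact ContinuousLinearMap.ext h1
  rw [key hF, key3, ← key hF0]

theorem nonnegElt_iff {f : TildeGe e} : NonnegElt f ↔ ∃ p : contactPath e, cls p = f ∧
    ∀ t ∈ Set.Icc (0 : ℝ) 1, ∀ x, 0 ≤ rate lam p.1 t x := by
  constructor
  · rintro ⟨p, hp, F, hF, hpos⟩
    refine ⟨p, hp, fun t ht x => ?_⟩
    have h := hpos t ht (p.1 t x, ⟨1, show (0 : ℝ) < 1 from one_pos⟩)
    rw [hF.eq_rate p.2.1.isContactFamily p.2.2 e] at h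
    simpa using h
  · rintro ⟨p, hp, hpos⟩
    exact ⟨p, hp, _, isContactHamiltonianOf_rate p.2.1.isContactFamily p.2.2 e,
      fun t ht z => mul_nonneg z.2.2.le (hpos t ht _)⟩

end Symplectization

/-! ### Lower bounds on classes and the basic estimates for `ν` -/

section Norm

variable {d : ℕ} {V : Type*} [TopologicalSpace V] [ChartedSpace (EuclideanSpace ℝ (Fin d)) V]
  [IsManifold (𝓡 d) ∞ V] {lam : ContactForm d V} {e : ReebCircleAction lam}

/-- The path `t ↦ p_{u(t)}`. -/
def timeChange (p : contactPath e) (u : ℝ → ℝ) (hu : ContDiff ℝ ∞ u) (h0 : u 0 = 0) :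
    contactPath e :=
  ⟨fun t => p.1 (u t), p.2.1.comp hu, by
    change p.1 (u 0) = 1
    rw [h0, p.2.2]⟩

/-- The homotopy runs `p` along the straight-line interpolation of the two time changes. -/
theorem cls_timeChange_eq (p : contactPath e) {u v : ℝ → ℝ} (hu : ContDiff ℝ ∞ u) (hu0 : u 0 = 0)
    (hv : ContDiff ℝ ∞ v) (hv0 : v 0 = 0) (h1 : u 1 = v 1) :
    cls (timeChange p u hu hu0) = cls (timeChange p v hv hv0) := by
  rw [cls_eq_iff]
  refine ⟨fun z => p.1 ((1 - z.1) * u z.2 + z.1 * v z.2), p.2.1.comp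
    (((contDiff_const.sub contDiff_fst).mul (hu.comp contDiff_snd)).add
      (contDiff_fst.mul (hv.comp contDiff_snd))), fun t _ => ⟨?_, ?_⟩, fun s _ => ⟨?_, ?_⟩⟩
  · simp [timeChange]
  · simp [timeChange]
  · simp [hu0, hv0, p.2.2]
  · change p.1 ((1 - s) * u 1 + s * v 1) = p.1 (u 1)
    exact congrArg p.1 (by rw [h1]; ring)

theorem cls_timeChange (p : contactPath e) {u : ℝ → ℝ} (hu : ContDiff ℝ ∞ u) (h0 : u 0 = 0)
    (h1 : u 1 = 1) : cls (timeChange p u hu h0) = cls p :=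
  cls_timeChange_eq p hu h0 (v := id) contDiff_id rfl h1

theorem cls_timeChange_reebPath {u : ℝ → ℝ} (hu : ContDiff ℝ ∞ u) (h0 : u 0 = 0) :
    cls (timeChange (reebPath e) u hu h0) = reebElt e (u 1) :=
  cls_timeChange_eq (reebPath e) hu h0 (v := fun t => u 1 * t) (contDiff_const.mul contDiff_id)
    (mul_zero _) (mul_one _).symm

theorem reebElt_add (a b : ℝ) : reebElt e (a + b) = reebElt e a * reebElt e b := by
  refine congrArg QuotientGroup.mk (Subtype.ext (funext fun t => ?_))
  change e.flow ((a + b) * t) = e.flow (a * t) * e.flow (b * t)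
  rw [add_mul, e.flow_add]

variable (e) in
theorem reebElt_zero : reebElt e 0 = 1 := by
  have h := reebElt_add (e := e) 0 0
  rw [add_zero] at h
  exact mul_eq_left.mp h.symm

theorem reebElt_neg (a : ℝ) : reebElt e (-a) = (reebElt e a)⁻¹ := by
  refine eq_inv_of_mul_eq_one_left ?_
  rw [← reebElt_add, neg_add_cancel, reebElt_zero]

variable (e) in
theorem ReebCircleAction.flow_int (m : ℤ) : e.flow m = 1 := by
  let φ : Multiplicative ℝ →* Equiv.Perm V :=
    { toFun := fun t => e.flow t.toAdd, map_one' := e.flow_zero,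
      map_mul' := fun s t => e.flow_add _ _ }
  have h := map_zpow φ (Multiplicative.ofAdd 1) m
  have h1 : φ (Multiplicative.ofAdd 1) = 1 := e.flow_one
  rw [h1, one_zpow, ← ofAdd_zsmul, zsmul_one] at h
  exact h

/-- The classes `e^m`, `m ∈ ℤ`, are central. -/
theorem reebElt_int_comm (m : ℤ) (f : TildeGe e) : reebElt e m * f = f * reebElt e m := by
  induction f using QuotientGroup.induction_on with
  | H p =>
    symm
    have hu : ContDiff ℝ ∞ (fun z : ℝ × ℝ => (1 - z.1) * z.2) :=
      (contDiff_const.sub contDiff_fst).mul contDiff_snd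
    have hv : ContDiff ℝ ∞ (fun z : ℝ × ℝ => (m : ℝ) * z.2) := contDiff_const.mul contDiff_snd
    change cls (p * rescale (reebPath e) m) = cls (rescale (reebPath e) m * p)
    rw [cls_eq_iff]
    -- The homotopy conjugates `e_{mt}` by the shrinking path `p_{(1-s)t}` and multiplies by `p_t`:
    -- it goes from `p_t e_{mt}` to `e_{mt} p_t`. Its end point stays at `p_1` because `e_m = id`
    -- for integral `m`.
    refine ⟨(fun z => p.1 ((1 - z.1) * z.2)) * (fun z => e.flow (m * z.2)) *
      (fun z => p.1 ((1 - z.1) * z.2))⁻¹ * fun z => p.1 z.2,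
      (((p.2.1.comp hu).mul (e.isSmoothFamily.comp hv)).mul (p.2.1.comp hu).inv).mul
        (p.2.1.comp contDiff_snd), fun t _ => ⟨?_, ?_⟩, fun s _ => ⟨?_, ?_⟩⟩
    · simp [rescale, reebPath]
    · simp [rescale, reebPath, p.2.2]
    · simp [p.2.2, e.flow_zero]
    · simp [rescale, reebPath, e.flow_int]

theorem rate_timeChange (p : contactPath e) {u : ℝ → ℝ} (hu : ContDiff ℝ ∞ u) (h0 : u 0 = 0)
    (t : ℝ) (x : V) : rate lam (timeChange p u hu h0).1 t x = deriv u t * rate lam p.1 (u t) x :=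
  rate_comp p.2.1.isContactFamily (hu.differentiable (by simp) t) x

theorem rate_rescale (p : contactPath e) (c t : ℝ) (x : V) :
    rate lam (rescale p c).1 t x = c * rate lam p.1 (c * t) x := by
  have hu : ContDiff ℝ ∞ (fun t : ℝ => c * t) := contDiff_const.mul contDiff_id
  have h := rate_timeChange p hu (mul_zero c) t x
  have h1 : deriv (fun t : ℝ => c * t) t = c := by simp
  rw [h1] at h
  exact h

theorem rate_rescale_reebPath (c t : ℝ) (x : V) :
    rate lam (rescale (reebPath e) c).1 t x = c := by
  rw [rate_rescale]
  exact (congrArg (c * ·) (rate_flow (e := e) _ _)).trans (mul_one c)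

theorem rate_path_mul (p q : contactPath e) (t : ℝ) (x : V) :
    rate lam (p * q).1 t x = rate lam p.1 t (q.1 t x)
      + conformalFactor e (p.1 t) (q.1 t x) * rate lam q.1 t x :=
  rate_mul p.2.1.isContactFamily q.2.1.isContactFamily t x

/-- `f` is represented by a path whose contact Hamiltonian on the subset `B` of `V` is bounded below
by a function of time with integral `c`. -/
def HasLowerBound (B : Set V) (f : TildeGe e) (c : ℝ) : Prop :=
  ∃ (p : contactPath e) (β : ℝ → ℝ), cls p = f ∧ ContDiff ℝ ∞ β ∧ β 0 = 0 ∧ β 1 = c ∧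
    ∀ t ∈ Set.Icc (0 : ℝ) 1, ∀ x, p.1 t x ∈ B → deriv β t ≤ rate lam p.1 t x

theorem hasLowerBound_of_le {B : Set V} (p : contactPath e) {c : ℝ}
    (h : ∀ t ∈ Set.Icc (0 : ℝ) 1, ∀ x, p.1 t x ∈ B → c ≤ rate lam p.1 t x) :
    HasLowerBound B (cls p) c :=
  ⟨p, fun t => c * t, rfl, contDiff_const.mul contDiff_id, mul_zero c, mul_one c, by simpa using h⟩

theorem hasLowerBound_reebElt (B : Set V) (c : ℝ) : HasLowerBound B (reebElt e c) c :=
  hasLowerBound_of_le _ fun t _ x _ => (rate_rescale_reebPath c t x).ge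

/-- A pointwise product of paths would distort the bound on `g` by the conformal factor of `f`, and
would need `g_t x` to lie in `B`. Concatenation avoids both: `g` is run while `f` still rests at the
identity, then `f` is run while `g` stands still. -/
theorem HasLowerBound.mul {B : Set V} {f g : TildeGe e} {a b : ℝ} (hf : HasLowerBound B f a)
    (hg : HasLowerBound B g b) : HasLowerBound B (f * g) (a + b) := by
  obtain ⟨p, β, rfl, hβ, hβ0, hβ1, hp⟩ := hf
  obtain ⟨q, γ, rfl, hγ, hγ0, hγ1, hq⟩ := hg
  have hT : ContDiff ℝ ∞ Real.smoothTransition := Real.smoothTransition.contDiff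
  -- `u` vanishes for `t ≤ 1/2` and `v` equals `1` for `t ≥ 1/2`, so the two halves of the
  -- concatenation meet smoothly.
  set u : ℝ → ℝ := fun t => Real.smoothTransition (2 * t - 1) with hu
  set v : ℝ → ℝ := fun t => Real.smoothTransition (2 * t) with hv
  have hus : ContDiff ℝ ∞ u := hT.comp ((contDiff_const.mul contDiff_id).sub contDiff_const)
  have hvs : ContDiff ℝ ∞ v := hT.comp (contDiff_const.mul contDiff_id)
  have hu0 : u 0 = 0 := Real.smoothTransition.zero_of_nonpos (by norm_num)
  have hv0 : v 0 = 0 := Real.smoothTransition.zero_of_nonpos (by norm_num)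
  have hu1 : u 1 = 1 := Real.smoothTransition.one_of_one_le (by norm_num)
  have hv1 : v 1 = 1 := Real.smoothTransition.one_of_one_le (by norm_num)
  have hud : ∀ t, 0 ≤ deriv u t := fun t => Monotone.deriv_nonneg
    (Real.smoothTransition.monotone.comp fun a b h => by linarith)
  have hvd : ∀ t, 0 ≤ deriv v t := fun t => Monotone.deriv_nonneg
    (Real.smoothTransition.monotone.comp fun a b h => by linarith)
  have hI : ∀ t, Real.smoothTransition t ∈ Set.Icc (0 : ℝ) 1 := fun t =>
    ⟨Real.smoothTransition.nonneg t, Real.smoothTransition.le_one t⟩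
  refine ⟨timeChange p u hus hu0 * timeChange q v hvs hv0, fun t => β (u t) + γ (v t), ?_,
    (hβ.comp hus).add (hγ.comp hvs), by simp [hu0, hv0, hβ0, hγ0], by simp [hu1, hv1, hβ1, hγ1],
    fun t _ x hx => ?_⟩
  · exact congrArg₂ (· * ·) (cls_timeChange p hus hu0 hu1) (cls_timeChange q hvs hv0 hv1)
  have hud' := hus.differentiable (by simp) t
  have hvd' := hvs.differentiable (by simp) t
  have h1 : HasDerivAt (fun t => β (u t) + γ (v t))
      (deriv β (u t) * deriv u t + deriv γ (v t) * deriv v t) t :=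
    ((hβ.differentiable (by simp) _).hasDerivAt.comp t hud'.hasDerivAt).add
      ((hγ.differentiable (by simp) _).hasDerivAt.comp t hvd'.hasDerivAt)
  rw [h1.deriv, rate_path_mul, rate_timeChange, rate_timeChange]
  have hx' : p.1 (u t) (q.1 (v t) x) ∈ B := hx
  refine add_le_add ?_ ?_
  · rw [mul_comm]
    exact mul_le_mul_of_nonneg_left (hp _ (hI _) _ hx') (hud t)
  · rcases le_total t (1 / 2) with ht | ht
    · have hut : u t = 0 := Real.smoothTransition.zero_of_nonpos (by linarith)
      rw [hut, p.2.2] at hx'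
      have hc : conformalFactor e ((timeChange p u hus hu0).1 t)
          ((timeChange q v hvs hv0).1 t x) = 1 := by
        have : (timeChange p u hus hu0).1 t = 1 := by
          change p.1 (u t) = 1
          rw [hut, p.2.2]
        rw [this, conformalFactor_one]
      rw [hc, one_mul, mul_comm]
      exact mul_le_mul_of_nonneg_left (hq _ (hI _) _ hx') (hvd t)
    · have hvt : deriv v t = 0 := by
        have hmax : IsLocalMax v t := by
          have : v t = 1 := Real.smoothTransition.one_of_one_le (by linarith)
          exact Filter.Eventually.of_forall fun s => by
            rw [this]
            exact Real.smoothTransition.le_one _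
        exact hmax.deriv_eq_zero
      simp [hvt]

theorem HasLowerBound.pow {B : Set V} {f : TildeGe e} {a : ℝ} (hf : HasLowerBound B f a) (k : ℕ) :
    HasLowerBound B (f ^ k) (k * a) := by
  induction k with
  | zero =>
    have h := hasLowerBound_reebElt (e := e) B 0
    rw [reebElt_zero] at h
    simpa using h
  | succ k ih =>
    have h := ih.mul hf
    rw [← pow_succ] at h
    convert h using 1
    push_cast
    ring

/-- There is no contractible loop in `G_e` whose contact Hamiltonian is positive on `B`. -/
def NoPositiveLoop (e : ReebCircleAction lam) (B : Set V) : Prop :=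
  ∀ (p : contactPath e) (δ : ℝ), cls p = 1 → 0 < δ →
    ¬ ∀ t ∈ Set.Icc (0 : ℝ) 1, ∀ x, p.1 t x ∈ B → δ ≤ rate lam p.1 t x

/-- Let `p` represent `f` and let `q`, with non-negative rate, represent `f⁻¹`. If `c > 0`, then `p
q`, corrected by a contractible Reeb loop, is a contractible loop with rate at least `c` over `B`.
-/
theorem HasLowerBound.nonpos {B : Set V} (hB : ∀ t, ∀ x ∈ B, e.flow t x ∈ B)
    (hL : NoPositiveLoop e B) {f : TildeGe e} {c : ℝ} (hf : HasLowerBound B f c)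
    (hn : NonnegElt f⁻¹) : c ≤ 0 := by
  by_contra hc
  obtain ⟨p, β, rfl, hβ, hβ0, hβ1, hp⟩ := hf
  obtain ⟨q, hq, hq0⟩ := nonnegElt_iff.1 hn
  -- The Reeb exponent `c t - β(t)` is `0` at both ends, since `β(1) = c`. Its speed `c - β'`
  -- replaces the variable bound `β'` by the constant `c`.
  have hα : ContDiff ℝ ∞ (fun t => c * t - β t) := (contDiff_const.mul contDiff_id).sub hβ
  have hα0 : c * 0 - β 0 = 0 := by simp [hβ0]
  have hr : cls (timeChange (reebPath e) _ hα hα0) = 1 := by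
    rw [cls_timeChange_reebPath, hβ1, mul_one, sub_self, reebElt_zero]
  set r := timeChange (reebPath e) _ hα hα0
  refine hL (r * (p * q)) c ?_ (not_le.1 hc) fun t ht x hx => ?_
  · change cls r * (cls p * cls q) = 1
    rw [hr, hq, one_mul, mul_inv_cancel]
  · rw [rate_path_mul, rate_path_mul]
    have h1 : rate lam r.1 t ((p * q).1 t x) = c - deriv β t := by
      refine (rate_timeChange _ hα hα0 t _).trans ?_
      have h2 : HasDerivAt (fun t => c * t - β t) (c - deriv β t) t := by
        have h3 : HasDerivAt (fun t => c * t) c t := by simpa using (hasDerivAt_id t).const_mul c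
        exact h3.fun_sub (hβ.differentiable (by simp) t).hasDerivAt
      rw [h2.deriv]
      exact (congrArg ((c - deriv β t) * ·) (rate_flow (e := e) _ _)).trans (mul_one _)
    have h2 : conformalFactor e (r.1 t) ((p * q).1 t x) = 1 := conformalFactor_flow _ _
    -- The bound on `p` is available only when its end point lies in `B`; invariance of `B` under
    -- the Reeb flow permits undoing the outer factor `e_{ct - β(t)}`.
    have h3 : p.1 t (q.1 t x) ∈ B := by
      have := hB (-(c * t - β t)) _ hx
      rw [e.flow_neg] at this
      have h4 : (r * (p * q)).1 t x = e.flow (c * t - β t) (p.1 t (q.1 t x)) := rfl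
      have h5 : (e.flow (c * t - β t))⁻¹ (e.flow (c * t - β t) (p.1 t (q.1 t x)))
          = p.1 t (q.1 t x) := Equiv.symm_apply_apply _ _
      rwa [h4, h5] at this
    rw [h1, h2, one_mul]
    have h5 := hp t ht _ h3
    have h6 := mul_nonneg (p.2.1.isContactFamily.conformalFactor_pos (e := e) t (q.1 t x)).le
      (hq0 t ht x)
    linarith

theorem HasLowerBound.le_of_dominates {B : Set V} (hB : ∀ t, ∀ x ∈ B, e.flow t x ∈ B)
    (hL : NoPositiveLoop e B) {f : TildeGe e} {c : ℝ} (hf : HasLowerBound B f c) {m : ℤ}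
    (hm : Dominates (reebElt e m) f) : c ≤ m := by
  have h1 := hf.mul (hasLowerBound_reebElt B (-(m : ℝ)))
  have h2 : (f * reebElt e (-(m : ℝ)))⁻¹ = reebElt e m * f⁻¹ := by
    rw [reebElt_neg, mul_inv_rev, inv_inv]
  have h3 := h1.nonpos hB hL (by rw [h2]; exact hm)
  linarith

/-- The contact Hamiltonian of a path is bounded. -/
theorem exists_rate_bound (p : contactPath e) :
    ∃ D : ℝ, ∀ t ∈ Set.Icc (0 : ℝ) 1, ∀ x, |rate lam p.1 t x| ≤ D := by
  obtain ⟨a, K, ha, hK, h⟩ := p.2.1.reeb_at_infinity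
  have h1 := p.2.1.isContactFamily.contMDiff_rate.continuous
  obtain ⟨D₁, hD₁⟩ := (isCompact_Icc.prod hK).exists_bound_of_continuousOn
    (f := fun z : ℝ × V => rate lam p.1 z.1 z.2) (s := Set.Icc (0 : ℝ) 1 ×ˢ K) h1.continuousOn
  obtain ⟨D₂, hD₂⟩ := isCompact_Icc.exists_bound_of_continuousOn (s := Set.Icc (0 : ℝ) 1)
    (f := deriv a) (ha.continuous_deriv (by simp)).continuousOn
  refine ⟨max D₁ D₂, fun t ht x => ?_⟩
  by_cases hx : x ∈ K
  · exact (hD₁ (t, x) ⟨ht, hx⟩).trans (le_max_left _ _)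
  · have h2 : rate lam p.1 t x = deriv a t := by
      rw [← rate_flow_comp (e := e) (ha.differentiable (by simp) t) x]
      exact rate_congr (Filter.Eventually.of_forall fun τ => h τ x hx)
    rw [h2]
    exact (hD₂ t ht).trans (le_max_right _ _)

/-- Centrality of `e^m` allows `p⁻¹ e^m` to represent `e^m f⁻¹`. By the cocycle rule its rate is `ρ
· (m - rate p)`, with `ρ > 0` the conformal factor of `p_t⁻¹`, and so is non-negative. -/
theorem dominates_of_rate_le (p : contactPath e) (m : ℤ)
    (h : ∀ t ∈ Set.Icc (0 : ℝ) 1, ∀ x, rate lam p.1 t x ≤ m) :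
    Dominates (reebElt e m) (cls p) := by
  unfold Dominates
  rw [reebElt_int_comm, nonnegElt_iff]
  refine ⟨p⁻¹ * rescale (reebPath e) m, rfl, fun t ht x => ?_⟩
  rw [rate_path_mul, rate_rescale_reebPath]
  obtain ⟨y, hy⟩ := (p.1 t).surjective ((rescale (reebPath e) (m : ℝ)).1 t x)
  rw [← hy]
  have h1 := rate_inv p.2.1 t y
  have h2 := p.2.1.isContactFamily.inv.conformalFactor_pos (e := e) t (p.1 t y)
  change 0 ≤ rate lam p.1⁻¹ t (p.1 t y) + conformalFactor e (p.1⁻¹ t) (p.1 t y) * m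
  rw [h1]
  nlinarith [h t ht y]

/-- A bound `D` on the absolute rate does both jobs: `⌈D⌉` belongs to the set, and `-D`, being a
lower bound in the sense of `HasLowerBound`, bounds the set from below. A nonempty set of integers
bounded below has a minimum. -/
theorem isLeast_nuPlus {B : Set V} (hB : ∀ t, ∀ x ∈ B, e.flow t x ∈ B)
    (hL : NoPositiveLoop e B) (f : TildeGe e) :
    IsLeast {m : ℤ | Dominates (reebElt e m) f} (nuPlus f) := by
  induction f using QuotientGroup.induction_on with
  | H p =>
    obtain ⟨D, hD⟩ := exists_rate_bound p
    have hne : {m : ℤ | Dominates (reebElt e m) (cls p)}.Nonempty :=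
      ⟨⌈D⌉, dominates_of_rate_le p _ fun t ht x =>
        ((le_abs_self _).trans (hD t ht x)).trans (Int.le_ceil D)⟩
    have hbdd : BddBelow {m : ℤ | Dominates (reebElt e m) (cls p)} := by
      refine ⟨⌈-D⌉, fun m hm => Int.ceil_le.2 ?_⟩
      exact (hasLowerBound_of_le (B := B) p fun t ht x _ =>
        (abs_le.1 (hD t ht x)).1).le_of_dominates hB hL hm
    exact ⟨Int.csInf_mem hne hbdd, fun m hm => csInf_le hbdd hm⟩

/-- Again by centrality of `e^m`. This reduces `ν_-` to `ν_+` through `ν_-(f) = -ν_+(f⁻¹)` and makes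
`ν` symmetric under inversion. -/
theorem dominates_reebElt_iff (f : TildeGe e) (m : ℤ) :
    Dominates f (reebElt e m) ↔ Dominates (reebElt e ((-m : ℤ) : ℝ)) f⁻¹ := by
  unfold Dominates
  rw [inv_inv, reebElt_int_comm, Int.cast_neg, reebElt_neg]

theorem isGreatest_neg_nuPlus {B : Set V} (hB : ∀ t, ∀ x ∈ B, e.flow t x ∈ B)
    (hL : NoPositiveLoop e B) (f : TildeGe e) :
    IsGreatest {m : ℤ | Dominates f (reebElt e m)} (-nuPlus f⁻¹) := by
  have h := isLeast_nuPlus hB hL f⁻¹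
  refine ⟨?_, fun m hm => ?_⟩
  · rw [Set.mem_ofPred_eq, dominates_reebElt_iff, neg_neg]
    exact h.1
  · have := h.2 ((dominates_reebElt_iff f m).1 hm)
    linarith

theorem nuMinus_eq {B : Set V} (hB : ∀ t, ∀ x ∈ B, e.flow t x ∈ B)
    (hL : NoPositiveLoop e B) (f : TildeGe e) : nuMinus f = -nuPlus f⁻¹ :=
  (isGreatest_neg_nuPlus hB hL f).csSup_eq

theorem isGreatest_nuMinus {B : Set V} (hB : ∀ t, ∀ x ∈ B, e.flow t x ∈ B)
    (hL : NoPositiveLoop e B) (f : TildeGe e) :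
    IsGreatest {m : ℤ | Dominates f (reebElt e m)} (nuMinus f) := by
  rw [nuMinus_eq hB hL]
  exact isGreatest_neg_nuPlus hB hL f

theorem nu_inv {B : Set V} (hB : ∀ t, ∀ x ∈ B, e.flow t x ∈ B)
    (hL : NoPositiveLoop e B) (f : TildeGe e) : nu f⁻¹ = nu f := by
  unfold nu
  rw [nuMinus_eq hB hL, nuMinus_eq hB hL, inv_inv, abs_neg, abs_neg, max_comm]

theorem HasLowerBound.le_nuPlus {B : Set V} (hB : ∀ t, ∀ x ∈ B, e.flow t x ∈ B)
    (hL : NoPositiveLoop e B) {f : TildeGe e} {c : ℝ} (hf : HasLowerBound B f c) :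
    c ≤ nuPlus f :=
  hf.le_of_dominates hB hL (isLeast_nuPlus hB hL f).1

theorem nuPlus_le_nu (f : TildeGe e) : nuPlus f ≤ nu f := (le_abs_self _).trans (le_max_left _ _)

theorem abs_nuPlus_le {B : Set V} (hB : ∀ t, ∀ x ∈ B, e.flow t x ∈ B)
    (hL : NoPositiveLoop e B) (p : contactPath e) {D : ℝ}
    (h : ∀ t ∈ Set.Icc (0 : ℝ) 1, ∀ x, |rate lam p.1 t x| ≤ D) :
    |(nuPlus (cls p) : ℝ)| ≤ D + 1 := by
  rw [abs_le]
  constructor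
  · have := (hasLowerBound_of_le (B := B) p fun t ht x _ =>
        (abs_le.1 (h t ht x)).1).le_nuPlus hB hL
    linarith
  · have h1 := (isLeast_nuPlus hB hL (cls p)).2 (dominates_of_rate_le p ⌈D⌉ fun t ht x =>
        ((le_abs_self _).trans (h t ht x)).trans (Int.le_ceil D))
    have h2 : (nuPlus (cls p) : ℝ) ≤ ⌈D⌉ := by exact_mod_cast h1
    linarith [Int.ceil_lt_add_one D]

end Norm

/-! ### The angle function and `dt` on the unit circle -/

section CircleCalculus

instance : Fact (Module.finrank ℝ ℂ = 1 + 1) := ⟨Complex.finrank_real_complex⟩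

theorem contMDiff_circle_coe : ContMDiff (𝓡 1) 𝓘(ℝ, ℂ) ∞ (fun v : Circle => (v : ℂ)) :=
  contMDiff_coe_sphere

theorem circleForm_isSmooth : circleForm.IsSmooth := by
  have h1 : ContMDiff (𝓡 1).tangent 𝓘(ℝ, ℂ).tangent ∞
      (tangentMap (𝓡 1) 𝓘(ℝ, ℂ) (fun v : Circle => (v : ℂ))) :=
    contMDiff_circle_coe.contMDiff_tangentMap (by simp)
  have h2 : ContMDiff (𝓡 1).tangent 𝓘(ℝ, ℂ) ∞ (fun v : TangentBundle (𝓡 1) Circle =>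
      (tangentMap (𝓡 1) 𝓘(ℝ, ℂ) (fun v : Circle => (v : ℂ)) v).2) :=
    (contMDiff_snd_tangentBundle_modelSpace ℂ 𝓘(ℝ, ℂ)).comp h1
  have h3 : ContMDiff (𝓡 1).tangent 𝓘(ℝ, ℂ) ∞
      (fun v : TangentBundle (𝓡 1) Circle => ((v.1 : Circle) : ℂ)) :=
    contMDiff_circle_coe.comp (Bundle.contMDiff_proj (TangentSpace (𝓡 1) : Circle → Type _))
  have h4 : ContDiff ℝ ∞ (fun z : ℂ × ℂ =>
      (2 * Real.pi)⁻¹ * ((starRingEnd ℂ) z.1 * z.2).im) := by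
    exact contDiff_const.mul (Complex.imCLM.contDiff.comp
      ((Complex.conjCLE.contDiff.comp contDiff_fst).mul contDiff_snd))
  exact h4.contMDiff.comp (h3.prodMk_space h2)

/-- The angle of a point of the unit circle, as a multiple of a full turn. -/
def circleAngle (u : Circle) : ℝ := Complex.arg (u : ℂ) / (2 * Real.pi)

/-- The branch of the angle that is smooth near `u₀`. -/
def circleBranch (u₀ u : Circle) : ℝ :=
  circleAngle u₀ + (2 * Real.pi)⁻¹ * (Complex.log (((starRingEnd ℂ) (u₀ : ℂ)) * (u : ℂ))).im

theorem conj_mul_self_circle (u : Circle) : (starRingEnd ℂ) (u : ℂ) * (u : ℂ) = 1 := by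
  rw [← Circle.coe_inv_eq_conj, ← Circle.coe_mul, inv_mul_cancel, Circle.coe_one]

theorem circleBranch_self (u : Circle) : circleBranch u u = circleAngle u := by
  simp [circleBranch, conj_mul_self_circle]

/-- The global angle jumps where `arg` does, but it differs from a branch smooth near `u₀` by an
integer; in a 1-periodic expression it may be replaced by that branch. -/
theorem circleAngle_eq_circleBranch (u₀ u : Circle) :
    ∃ n : ℤ, circleAngle u = circleBranch u₀ u + n := by
  have h2π : (2 * Real.pi) ≠ 0 := by positivity
  have h1 : Circle.exp (Complex.arg (u : ℂ)) = Circle.exp (Complex.arg (u₀ : ℂ)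
      + Complex.arg ((u₀⁻¹ * u : Circle) : ℂ)) := by
    rw [Circle.exp_add, Circle.exp_arg, Circle.exp_arg, Circle.exp_arg, mul_inv_cancel_left]
  obtain ⟨n, hn⟩ := Circle.exp_eq_exp.1 h1
  refine ⟨n, ?_⟩
  unfold circleBranch circleAngle
  rw [Complex.log_im, ← Circle.coe_inv_eq_conj, ← Circle.coe_mul, hn]
  field_simp

theorem contDiffAt_branch (u₀ : Circle) : ContDiffAt ℝ ∞ (fun z : ℂ =>
    circleAngle u₀ + (2 * Real.pi)⁻¹ * (Complex.log (((starRingEnd ℂ) (u₀ : ℂ)) * z)).im)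
    (u₀ : ℂ) := by
  have h0 : ContDiffAt ℝ ∞ Complex.log ((starRingEnd ℂ) (u₀ : ℂ) * (u₀ : ℂ)) := by
    rw [conj_mul_self_circle]
    exact (Complex.contDiffAt_log (n := ∞) (Complex.one_mem_slitPlane)).restrict_scalars ℝ
  have h1 := h0.comp (u₀ : ℂ) (f := fun z : ℂ => (starRingEnd ℂ) (u₀ : ℂ) * z)
    (contDiff_const.mul contDiff_id).contDiffAt
  exact contDiffAt_const.add (contDiffAt_const.mul (Complex.imCLM.contDiff.contDiffAt.comp _ h1))

theorem contMDiffAt_circleBranch (u₀ : Circle) :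
    ContMDiffAt (𝓡 1) 𝓘(ℝ, ℝ) ∞ (circleBranch u₀) u₀ :=
  (contDiffAt_branch u₀).contMDiffAt.comp u₀ contMDiff_circle_coe.contMDiffAt

/-- The branch at `u` is the imaginary part of `log(ū z) / 2π` up to a constant, and at `z = u` the
argument of `log` is `1`, where the derivative of `log` is the identity. -/
theorem scalarDeriv_circleBranch (u : Circle) :
    scalarDeriv (𝓡 1) (circleBranch u) u = circleForm u := by
  have h1 : HasFDerivAt (fun z : ℂ => circleAngle u + (2 * Real.pi)⁻¹ *
      (Complex.log (((starRingEnd ℂ) (u : ℂ)) * z)).im)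
      ((2 * Real.pi)⁻¹ • Complex.imCLM.comp (ContinuousLinearMap.mul ℝ ℂ ((starRingEnd ℂ) (u : ℂ))))
      (u : ℂ) := by
    have h0 : HasFDerivAt Complex.log (ContinuousLinearMap.id ℝ ℂ)
        ((starRingEnd ℂ) (u : ℂ) * (u : ℂ)) := by
      rw [conj_mul_self_circle]
      have := (Complex.hasStrictDerivAt_log Complex.one_mem_slitPlane).hasDerivAt.hasFDerivAt.restrictScalars ℝ
      refine this.congr_fderiv ?_
      ext
      simp
    have h2 := h0.comp (u : ℂ) (ContinuousLinearMap.mul ℝ ℂ ((starRingEnd ℂ) (u : ℂ))).hasFDerivAt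
    have h3 := ((Complex.imCLM.hasFDerivAt.comp (u : ℂ) h2).const_mul (2 * Real.pi)⁻¹).const_add
      (circleAngle u)
    exact h3
  have h2 := mfderiv_comp u (I := 𝓡 1) (I' := 𝓘(ℝ, ℂ)) (I'' := 𝓘(ℝ, ℝ))
    (f := fun v : Circle => (v : ℂ)) h1.differentiableAt.mdifferentiableAt
    (contMDiff_circle_coe.mdifferentiableAt (by simp))
  rw [mfderiv_eq_fderiv, h1.fderiv] at h2
  exact h2

/-- A smooth 1-periodic function descends to a smooth function on the circle. -/
theorem contMDiff_comp_circleAngle {E : Type*} [NormedAddCommGroup E] [NormedSpace ℝ E]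
    {H : Type*} [TopologicalSpace H] {J : ModelWithCorners ℝ E H}
    {M : Type*} [TopologicalSpace M] [ChartedSpace H M]
    {E' : Type*} [NormedAddCommGroup E'] [NormedSpace ℝ E']
    {H' : Type*} [TopologicalSpace H'] {I : ModelWithCorners ℝ E' H'}
    {N : Type*} [TopologicalSpace N] [ChartedSpace H' N] {g : ℝ → N → M}
    (hg : ContMDiff (𝓘(ℝ, ℝ).prod I) J ∞ (fun z : ℝ × N => g z.1 z.2))
    (hper : ∀ (t : ℝ) (n : ℤ) x, g (t + n) x = g t x) :
    ContMDiff ((𝓡 1).prod I) J ∞ (fun z : Circle × N => g (circleAngle z.1) z.2) := by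
  rintro ⟨u, x⟩
  have h1 : (fun z : Circle × N => g (circleAngle z.1) z.2)
      = fun z : Circle × N => g (circleBranch u z.1) z.2 := by
    funext z
    obtain ⟨n, hn⟩ := circleAngle_eq_circleBranch u z.1
    rw [hn, hper]
  rw [h1]
  exact (hg.contMDiffAt (x := (circleBranch u u, x))).comp (u, x)
    (((contMDiffAt_circleBranch u).comp (u, x) contMDiffAt_fst).prodMk contMDiffAt_snd)

end CircleCalculus

/-! ### The primitive `s λ + r dt` on the stabilization -/

section Stabilization

variable {d : ℕ} {V : Type*} [TopologicalSpace V] [ChartedSpace (EuclideanSpace ℝ (Fin d)) V]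
  [IsManifold (𝓡 d) ∞ V] {lam : ContactForm d V} {e : ReebCircleAction lam}

variable (lam) in
theorem stabForm_isSmooth : (stabForm lam).IsSmooth := by
  have h1 : ContMDiff (stabModel d) 𝓘(ℝ, ℝ) ∞ (fun y : Stabilization V => y.2.1) :=
    contMDiff_fst.comp contMDiff_snd
  have h2 : ContMDiff (stabModel d) (𝓡 1) ∞ (fun y : Stabilization V => y.2.2) :=
    contMDiff_snd.comp contMDiff_snd
  exact ((liouvilleForm_isSmooth lam).pullback contMDiff_fst).add
    ((circleForm_isSmooth.pullback h2).smul h1)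

theorem stabForm_pullback {E' : Type*} [NormedAddCommGroup E'] [NormedSpace ℝ E']
    {H' : Type*} [TopologicalSpace H'] {I : ModelWithCorners ℝ E' H'}
    {N : Type*} [TopologicalSpace N] [ChartedSpace H' N] {c : N → Stabilization V} {y : N}
    (hc : MDifferentiableAt I (stabModel d) c y) :
    OneForm.pullback (I := I) c (stabForm lam) y
      = OneForm.pullback (I := I) (fun y => (c y).1) (liouvilleForm lam) y
        + (c y).2.1 • OneForm.pullback (I := I) (fun y => (c y).2.2) circleForm y := by
  have h1 := OneForm.pullback_comp (liouvilleForm lam)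
    (g := (Prod.fst : Stabilization V → Symplectization V)) (f := c)
    (x := y) (I₁ := I) (I₂ := stabModel d) mdifferentiableAt_fst hc
  have h2 := OneForm.pullback_comp circleForm
    (g := (fun y => y.2.2 : Stabilization V → Circle)) (f := c)
    (x := y) (I₁ := I) (I₂ := stabModel d)
    (mdifferentiableAt_snd.comp _ mdifferentiableAt_snd) hc
  refine (ContinuousLinearMap.add_comp _ _ _).trans ?_
  refine congrArg₂ (· + ·) h1.symm ?_
  refine (ContinuousLinearMap.smul_comp _ _ _).trans ?_
  exact congrArg ((c y).2.1 • ·) h2.symm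

end Stabilization

/-! ### Suspension of a periodic family of contactomorphisms -/

section Suspension

variable {d : ℕ} {V : Type*} [TopologicalSpace V] [ChartedSpace (EuclideanSpace ℝ (Fin d)) V]
  [IsManifold (𝓡 d) ∞ V] {lam : ContactForm d V} {e : ReebCircleAction lam}
  {P : Type*} [NormedAddCommGroup P] [NormedSpace ℝ P]

theorem IsContactFamily.lift_congr {f : P → Equiv.Perm V} (hf : IsContactFamily lam f) {p q : P}
    (h : f p = f q) : hf.lift e p = hf.lift e q := by
  funext z
  refine Prod.ext (congrArg (fun g : Equiv.Perm V => g z.1) h) (Subtype.ext ?_)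
  change z.2.1 / conformalFactor e (f p) z.1 = z.2.1 / conformalFactor e (f q) z.1
  rw [h]

variable (e) in
/-- The suspension `(x, s, r, t) ↦ (f_t(x, s), r - F_t(f_t(x, s)), t)` of a loop of
contactomorphisms. -/
def IsContactFamily.suspension {f : ℝ × ℝ → Equiv.Perm V} (hf : IsContactFamily lam f) (s : ℝ)
    (y : Stabilization V) : Stabilization V :=
  (hf.lift e (s, circleAngle y.2.2) y.1,
    (y.2.1 - (hf.lift e (s, circleAngle y.2.2) y.1).2.1 *
      rate lam (fun τ => f (s, τ)) (circleAngle y.2.2) y.1.1, y.2.2))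

variable (e) in
/-- The inverse of the suspension. -/
def IsContactFamily.suspensionInv {f : ℝ × ℝ → Equiv.Perm V} (hf : IsContactFamily lam f) (s : ℝ)
    (y : Stabilization V) : Stabilization V :=
  (hf.inv.lift e (s, circleAngle y.2.2) y.1,
    (y.2.1 + y.1.2.1 * rate lam (fun τ => f (s, τ)) (circleAngle y.2.2)
      ((f (s, circleAngle y.2.2))⁻¹ y.1.1), y.2.2))

variable {f : ℝ × ℝ → Equiv.Perm V}

theorem IsContactFamily.suspensionInv_suspension (hf : IsContactFamily lam f) (s : ℝ)
    (y : Stabilization V) : hf.suspensionInv e s (hf.suspension e s y) = y := by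
  refine Prod.ext (hf.lift_inv_lift _ _) (Prod.ext ?_ rfl)
  change y.2.1 - (hf.lift e (s, circleAngle y.2.2) y.1).2.1 *
      rate lam (fun τ => f (s, τ)) (circleAngle y.2.2) y.1.1
      + (hf.lift e (s, circleAngle y.2.2) y.1).2.1 *
      rate lam (fun τ => f (s, τ)) (circleAngle y.2.2)
        ((f (s, circleAngle y.2.2))⁻¹ (f (s, circleAngle y.2.2) y.1.1)) = y.2.1
  rw [show (f (s, circleAngle y.2.2))⁻¹ (f (s, circleAngle y.2.2) y.1.1) = y.1.1 from
    Equiv.symm_apply_apply _ _, sub_add_cancel]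

theorem IsContactFamily.suspension_suspensionInv (hf : IsContactFamily lam f) (s : ℝ)
    (y : Stabilization V) : hf.suspension e s (hf.suspensionInv e s y) = y := by
  have h := hf.lift_lift_inv (e := e) (s, circleAngle y.2.2) y.1
  refine Prod.ext h (Prod.ext ?_ rfl)
  change y.2.1 + y.1.2.1 * rate lam (fun τ => f (s, τ)) (circleAngle y.2.2)
      ((f (s, circleAngle y.2.2))⁻¹ y.1.1)
      - (hf.lift e (s, circleAngle y.2.2) (hf.inv.lift e (s, circleAngle y.2.2) y.1)).2.1 *
      rate lam (fun τ => f (s, τ)) (circleAngle y.2.2) ((f (s, circleAngle y.2.2))⁻¹ y.1.1) = y.2.1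
  rw [h, add_sub_cancel_right]

theorem IsContactFamily.suspension_scale (hf : IsContactFamily lam f) (s : ℝ) (σ : posRay)
    (y : Stabilization V) :
    hf.suspension e s (stabScale σ y) = stabScale σ (hf.suspension e s y) := by
  refine Prod.ext (Prod.ext rfl (Subtype.ext (mul_div_assoc _ _ _))) (Prod.ext ?_ rfl)
  change σ.1 * y.2.1 - (σ.1 * y.1.2.1) / _ * _ = σ.1 * (y.2.1 - y.1.2.1 / _ * _)
  rw [mul_sub, mul_div_assoc, mul_assoc]
  rfl

theorem rate_add_int (hper : ∀ (s t : ℝ) (n : ℤ), f (s, t + n) = f (s, t))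
    (hf : IsContactFamily lam f) (s t : ℝ) (n : ℤ) (x : V) :
    rate lam (fun τ => f (s, τ)) (t + n) x = rate lam (fun τ => f (s, τ)) t x := by
  have hs : IsContactFamily lam (fun τ : ℝ => f (s, τ)) :=
    hf.comp (contDiff_const.prodMk contDiff_id)
  have h := rate_comp hs (u := fun t => t + n) (t := t) (by fun_prop) x
  simp only [hper] at h
  rw [h]
  simp

/-- The discontinuous `circleAngle` is harmless, since both components are smooth and 1-periodic in
time and descend to the circle. Taking `g` to be the rate at the starting point, or at its preimage,
serves the suspension and its inverse respectively. -/
theorem IsContactFamily.contMDiff_suspension_aux {g : ℝ × ℝ → V → ℝ}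
    (hg : ContMDiff (𝓘(ℝ, ℝ × ℝ).prod (𝓡 d)) 𝓘(ℝ, ℝ) ∞ (fun z : (ℝ × ℝ) × V => g z.1 z.2))
    (hgper : ∀ (s t : ℝ) (n : ℤ) x, g (s, t + n) x = g (s, t) x)
    (hf : IsContactFamily lam f) (hper : ∀ (s t : ℝ) (n : ℤ), f (s, t + n) = f (s, t)) :
    ContMDiff (𝓘(ℝ, ℝ).prod (stabModel d)) ((sympModel d).prod 𝓘(ℝ, ℝ)) ∞
      (fun z : ℝ × Stabilization V => (hf.lift e (z.1, circleAngle z.2.2.2) z.2.1,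
        g (z.1, circleAngle z.2.2.2) z.2.1.1)) := by
  have h1 : ContMDiff (𝓘(ℝ, ℝ).prod (𝓘(ℝ, ℝ).prod (sympModel d))) 𝓘(ℝ, ℝ × ℝ) ∞
      (fun z : ℝ × (ℝ × Symplectization V) => (z.2.1, z.1)) :=
    (contMDiff_fst.comp contMDiff_snd).prodMk_space contMDiff_fst
  have h2 : ContMDiff (𝓘(ℝ, ℝ).prod (𝓘(ℝ, ℝ).prod (sympModel d))) ((sympModel d).prod 𝓘(ℝ, ℝ)) ∞
      (fun z : ℝ × (ℝ × Symplectization V) => (hf.lift e (z.2.1, z.1) z.2.2,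
        g (z.2.1, z.1) z.2.2.1)) :=
    (hf.contMDiff_lift.comp (h1.prodMk (contMDiff_snd.comp contMDiff_snd))).prodMk
      (hg.comp (h1.prodMk (contMDiff_fst.comp (contMDiff_snd.comp contMDiff_snd))))
  have h3 := contMDiff_comp_circleAngle (g := fun t (z : ℝ × Symplectization V) =>
    (hf.lift e (z.1, t) z.2, g (z.1, t) z.2.1)) h2 (fun t n z => by
      rw [hgper, hf.lift_congr (hper z.1 t n)])
  exact h3.comp ((contMDiff_snd.comp (contMDiff_snd.comp contMDiff_snd)).prodMk
    (contMDiff_fst.prodMk (contMDiff_fst.comp contMDiff_snd)))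

theorem IsContactFamily.contMDiff_rate_snd (hf : IsContactFamily lam f) :
    ContMDiff (𝓘(ℝ, ℝ × ℝ).prod (𝓡 d)) 𝓘(ℝ, ℝ) ∞
      (fun z : (ℝ × ℝ) × V => rate lam (fun τ => f (z.1.1, τ)) z.1.2 z.2) :=
  contMDiff_rate_param (f := fun s t => f (s, t)) hf.smooth

theorem IsContactFamily.contMDiff_suspension (hf : IsContactFamily lam f)
    (hper : ∀ (s t : ℝ) (n : ℤ), f (s, t + n) = f (s, t)) :
    ContMDiff (𝓘(ℝ, ℝ).prod (stabModel d)) (stabModel d) ∞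
      (fun z : ℝ × Stabilization V => hf.suspension e z.1 z.2) := by
  have h := IsContactFamily.contMDiff_suspension_aux (e := e)
    (g := fun p x => rate lam (fun τ => f (p.1, τ)) p.2 x) hf.contMDiff_rate_snd
    (fun s t n x => rate_add_int hper hf s t n x) hf hper
  have h1 := contMDiff_fst.comp h
  have h2 := contMDiff_snd.comp h
  have h3 : ContMDiff (𝓘(ℝ, ℝ).prod (stabModel d)) 𝓘(ℝ, ℝ) ∞
    (fun z : ℝ × Stabilization V => z.2.2.1) :=
    contMDiff_fst.comp (contMDiff_snd.comp contMDiff_snd)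
  exact h1.prodMk ((h3.sub ((contMDiff_ray.comp h1).mul h2)).prodMk
    (contMDiff_snd.comp (contMDiff_snd.comp contMDiff_snd)))

theorem IsContactFamily.contMDiff_suspensionInv (hf : IsContactFamily lam f)
    (hper : ∀ (s t : ℝ) (n : ℤ), f (s, t + n) = f (s, t)) :
    ContMDiff (𝓘(ℝ, ℝ).prod (stabModel d)) (stabModel d) ∞
      (fun z : ℝ × Stabilization V => hf.suspensionInv e z.1 z.2) := by
  have hg : ContMDiff (𝓘(ℝ, ℝ × ℝ).prod (𝓡 d)) 𝓘(ℝ, ℝ) ∞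
      (fun z : (ℝ × ℝ) × V => rate lam (fun τ => f (z.1.1, τ)) z.1.2 ((f z.1)⁻¹ z.2)) :=
    hf.contMDiff_rate_snd.comp (contMDiff_fst.prodMk hf.smooth_inv)
  have h := IsContactFamily.contMDiff_suspension_aux (e := e)
    (g := fun p x => rate lam (fun τ => f (p.1, τ)) p.2 ((f p)⁻¹ x)) hg
    (fun s t n x => by rw [hper]; exact rate_add_int hper hf s t n _) hf.inv
    (fun s t n => by rw [Pi.inv_apply, hper]; rfl)
  have h1 := contMDiff_fst.comp h
  have h2 := contMDiff_snd.comp h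
  have h3 : ContMDiff (𝓘(ℝ, ℝ).prod (stabModel d)) 𝓘(ℝ, ℝ) ∞
    (fun z : ℝ × Stabilization V => z.2.2.1) :=
    contMDiff_fst.comp (contMDiff_snd.comp contMDiff_snd)
  exact h1.prodMk ((h3.add ((contMDiff_ray.comp (contMDiff_fst.comp contMDiff_snd)).mul h2)).prodMk
    (contMDiff_snd.comp (contMDiff_snd.comp contMDiff_snd)))

/-- On the suspension `t` varies, so pulling back `λ` gives `rate · dt + ρ λ`. Multiplied by the new
ray coordinate `s / ρ`, this yields `s λ + (s / ρ) rate · dt`, and the shift of `r` by `-(s / ρ)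
rate` cancels the excess. -/
theorem IsContactFamily.pullback_suspension (hf : IsContactFamily lam f)
    (hper : ∀ (s t : ℝ) (n : ℤ), f (s, t + n) = f (s, t)) (s : ℝ) (y : Stabilization V) :
    OneForm.pullback (I := stabModel d) (hf.suspension e s) (stabForm lam) y = stabForm lam y := by
  have hs : IsContactFamily lam (fun τ : ℝ => f (s, τ)) :=
    hf.comp (contDiff_const.prodMk contDiff_id)
  have hd : MDifferentiableAt (stabModel d) (stabModel d) (hf.suspension e s) y :=
    ((hf.contMDiff_suspension hper).comp
      (contMDiff_const.prodMk contMDiff_id)).mdifferentiableAt (by simp)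
  have hd1 : MDifferentiableAt (stabModel d) (sympModel d) (fun y => (hf.suspension e s y).1) y :=
    mdifferentiableAt_fst.comp y hd
  set z' := hf.lift e (s, circleAngle y.2.2) y.1 with hz'
  -- Near the given point the angle is replaced by a smooth branch, which periodicity of `f`
  -- permits; its differential there is `dt`.
  set b := circleBranch y.2.2 with hb
  have hu : MDifferentiableAt (stabModel d) (𝓡 1) (fun y : Stabilization V => y.2.2) y :=
    mdifferentiableAt_snd.comp _ mdifferentiableAt_snd
  have hb1 : MDifferentiableAt (𝓡 1) 𝓘(ℝ, ℝ) b y.2.2 :=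
    (contMDiffAt_circleBranch y.2.2).mdifferentiableAt (by simp)
  have hx : MDifferentiableAt (stabModel d) (𝓡 d) (fun y : Stabilization V => y.1.1) y :=
    mdifferentiableAt_fst.comp _ mdifferentiableAt_fst
  have hloc : (fun y : Stabilization V => (hf.suspension e s y).1.1)
      = fun y => f (s, b y.2.2) y.1.1 := by
    funext y'
    obtain ⟨n, hn⟩ := circleAngle_eq_circleBranch y.2.2 y'.2.2
    change f (s, circleAngle y'.2.2) y'.1.1 = _
    rw [hn, hper]
  have hderiv : scalarDeriv (stabModel d) (fun y : Stabilization V => b y.2.2) y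
      = OneForm.pullback (I := stabModel d) (fun y : Stabilization V => y.2.2) circleForm y := by
    have h1 := mfderiv_comp y (g := b) hb1 hu
    have h2 := scalarDeriv_circleBranch y.2.2
    refine h1.trans ?_
    exact congrArg (fun T => ContinuousLinearMap.comp T
      (mfderiv (stabModel d) (𝓡 1) (fun y : Stabilization V => y.2.2) y)) h2
  have e1 : OneForm.pullback (I := stabModel d) (fun y => (hf.suspension e s y).1)
      (liouvilleForm lam) y = z'.2.1 • OneForm.pullback (I := stabModel d)
        (fun y => f (s, b y.2.2) y.1.1) lam.form y := by
    rw [liouvilleForm_pullback hd1, hloc]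
    rfl
  have e2 : OneForm.pullback (I := stabModel d) Prod.fst (liouvilleForm lam) y
      = y.1.2.1 • OneForm.pullback (I := stabModel d) (fun y : Stabilization V => y.1.1)
        lam.form y := liouvilleForm_pullback mdifferentiableAt_fst
  have hconf := (hf.conformalFactor_pos (e := e) (s, circleAngle y.2.2) y.1.1).ne'
  rw [stabForm_pullback hd, e1]
  refine ContinuousLinearMap.ext fun w => ?_
  have e3 := hs.pullback_prodMk (e := e) (I := stabModel d)
    (τ := fun y : Stabilization V => b y.2.2)
    (g := fun y : Stabilization V => y.1.1) (y := y)
    (MDifferentiableAt.comp (g := b) (f := fun y : Stabilization V => y.2.2) y hb1 hu) hx w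
  rw [hderiv, show b y.2.2 = circleAngle y.2.2 from circleBranch_self _] at e3
  generalize hα : OneForm.pullback (I := stabModel d) (fun y : Stabilization V => y.2.2)
    circleForm y w = α at e3
  generalize hβ : OneForm.pullback (I := stabModel d) (fun y : Stabilization V => y.1.1)
    lam.form y w = β at e3
  have hz2 : z'.2.1 = y.1.2.1 / conformalFactor e (f (s, circleAngle y.2.2)) y.1.1 := rfl
  have lhs : (z'.2.1 • OneForm.pullback (I := stabModel d) (fun y => f (s, b y.2.2) y.1.1)
        lam.form y + (hf.suspension e s y).2.1 •
        OneForm.pullback (I := stabModel d) (fun y => (hf.suspension e s y).2.2) circleForm y) w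
      = z'.2.1 * (rate lam (fun τ => f (s, τ)) (circleAngle y.2.2) y.1.1 * α
          + conformalFactor e (f (s, circleAngle y.2.2)) y.1.1 * β)
        + (y.2.1 - z'.2.1 * rate lam (fun τ => f (s, τ)) (circleAngle y.2.2) y.1.1) * α := by
    refine congrArg₂ (fun a b : ℝ => a + b) (congrArg (z'.2.1 * ·) e3) ?_
    rw [← hα]
    rfl
  have rhs : stabForm lam y w = y.1.2.1 * β + y.2.1 * α := by
    refine congrArg₂ (fun a b : ℝ => a + b)
      (Eq.trans (congrArg (fun T => T w) e2) ?_) (congrArg (y.2.1 * ·) hα)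
    rw [← hβ]
    rfl
  refine lhs.trans (Eq.trans ?_ rhs.symm)
  rw [hz2]
  field_simp
  ring

end Suspension

/-! ### Stable intersection excludes positive contractible loops -/

section PositiveLoop

variable {d : ℕ} {V : Type*} [TopologicalSpace V] [ChartedSpace (EuclideanSpace ℝ (Fin d)) V]
  [IsManifold (𝓡 d) ∞ V] {lam : ContactForm d V} {e : ReebCircleAction lam}

/-- A contractible loop has a zero of its contact Hamiltonian on `B`. -/
theorem HasStableIntersection.exists_rate_eq_zero {A B : Set (Symplectization V)}
    (hAB : HasStableIntersection lam A B) (e : ReebCircleAction lam) {f : ℝ × ℝ → Equiv.Perm V}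
    (hf : IsContactFamily lam f) (hper : ∀ (s t : ℝ) (n : ℤ), f (s, t + n) = f (s, t))
    (h0 : ∀ t, f (0, t) = 1) :
    ∃ t x, f (1, t) x ∈ Prod.fst '' B ∧ rate lam (fun τ => f (1, τ)) t x = 0 := by
  have hs := hf.contMDiff_suspension (e := e) hper
  have hs' := hf.contMDiff_suspensionInv (e := e) hper
  have hstart : ∀ y, hf.suspension e 0 y = y := by
    intro y
    have hr : rate lam (fun τ => f (0, τ)) (circleAngle y.2.2) y.1.1 = 0 := by
      have : (fun τ => f (0, τ)) = (1 : ℝ → Equiv.Perm V) := funext h0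
      rw [this, rate_one]
    refine Prod.ext (Prod.ext ?_ (Subtype.ext ?_)) (Prod.ext ?_ rfl)
    · change f (0, circleAngle y.2.2) y.1.1 = y.1.1
      rw [h0]
      rfl
    · change y.1.2.1 / conformalFactor e (f (0, circleAngle y.2.2)) y.1.1 = y.1.2.1
      rw [h0, conformalFactor_one, div_one]
    · change y.2.1 - _ * rate lam (fun τ => f (0, τ)) (circleAngle y.2.2) y.1.1 = y.2.1
      rw [hr, mul_zero, sub_zero]
  let ψ : ℝ → Diffeomorph (stabModel d) (stabModel d) (Stabilization V) (Stabilization V) ∞ :=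
    fun s =>
      { toFun := hf.suspension e s
        invFun := hf.suspensionInv e s
        left_inv := hf.suspensionInv_suspension s
        right_inv := hf.suspension_suspensionInv s
        contMDiff_toFun := hs.comp (contMDiff_const.prodMk contMDiff_id)
        contMDiff_invFun := hs'.comp (contMDiff_const.prodMk contMDiff_id) }
  obtain ⟨y', ⟨y, hyA, rfl⟩, hyB⟩ := hAB.inter (ψ 1) ⟨_, ψ, isHamiltonianFlow_of_preserves
    (stabForm_isSmooth lam) hs hs' hf.suspension_suspensionInv hf.suspensionInv_suspension hstart
    (hf.pullback_suspension hper), fun t σ y => hf.suspension_scale t σ y, rfl⟩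
  refine ⟨circleAngle y.2.2, y.1.1, ⟨_, hyB.1, rfl⟩, ?_⟩
  -- The image lies in `Stab(B)`, so its `r`-coordinate is zero; `r` vanished at the start in
  -- `Stab(A)`. The shift, a positive ray coordinate times the rate, is therefore zero.
  have h1 : y.2.1 - (hf.lift e (1, circleAngle y.2.2) y.1).2.1 *
      rate lam (fun τ => f (1, τ)) (circleAngle y.2.2) y.1.1 = 0 := hyB.2
  rw [hyA.2, zero_sub, neg_eq_zero] at h1
  exact (mul_eq_zero.1 h1).resolve_left (hf.lift e (1, circleAngle y.2.2) y.1).2.2.ne'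

/-- A family that agrees locally with shifts of a contact family is a contact family. -/
theorem IsContactFamily.of_locally_shift {k f : ℝ × ℝ → Equiv.Perm V} (hk : IsContactFamily lam k)
    (h : ∀ t₀, ∃ a : ℝ, ∀ᶠ t in nhds t₀, ∀ s, f (s, t) = k (s, t - a)) :
    IsContactFamily lam f := by
  have hshift : ∀ a : ℝ, IsContactFamily lam (fun q : ℝ × ℝ => k (q.1, q.2 - a)) := fun a =>
    hk.comp (contDiff_fst.prodMk (contDiff_snd.sub contDiff_const))
  have hev : ∀ z : (ℝ × ℝ) × V, ∃ a : ℝ, ∀ᶠ z' in nhds z, f z'.1 = k (z'.1.1, z'.1.2 - a) := by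
    rintro ⟨⟨s, t⟩, x⟩
    obtain ⟨a, ha⟩ := h t
    have hc : Filter.Tendsto (fun z : (ℝ × ℝ) × V => z.1.2) (nhds ((s, t), x)) (nhds t) :=
      (continuous_snd.comp continuous_fst).tendsto ((s, t), x)
    exact ⟨a, (hc.eventually ha).mono fun z hz => hz z.1.1⟩
  refine ⟨fun z => ?_, fun z => ?_, ?_⟩
  · obtain ⟨a, ha⟩ := hev z
    exact ((hshift a).smooth z).congr_of_eventuallyEq (ha.mono fun z' hz' =>
      congrArg (fun g : Equiv.Perm V => g z'.2) hz')
  · obtain ⟨a, ha⟩ := hev z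
    exact ((hshift a).smooth_inv z).congr_of_eventuallyEq (ha.mono fun z' hz' =>
      congrArg (fun g : Equiv.Perm V => g⁻¹ z'.2) hz')
  · rintro ⟨s, t⟩ x
    obtain ⟨a, ha⟩ := h t
    rw [ha.self_of_nhds s]
    exact hk.contact _ x

/-- The contraction of the loop must be made smooth and 1-periodic in `t` without losing positivity.
Slowing the loop to rest near `t = 0, 1` would make the rate vanish there, so the idle time is spent
moving along the Reeb flow, which keeps the projection of `B` invariant. -/
theorem noPositiveLoop {A B : Set (Symplectization V)} (hAB : HasStableIntersection lam A B)
    (hB : ∀ t, ∀ x ∈ Prod.fst '' B, e.flow t x ∈ Prod.fst '' B) :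
    NoPositiveLoop e (Prod.fst '' B) := by
  intro p δ hp hδ hrate
  obtain ⟨h, hh⟩ := (QuotientGroup.eq_one_iff p).1 hp
  have hT : ContDiff ℝ ∞ Real.smoothTransition := Real.smoothTransition.contDiff
  have hI : ∀ t, Real.smoothTransition t ∈ Set.Icc (0 : ℝ) 1 := fun t =>
    ⟨Real.smoothTransition.nonneg t, Real.smoothTransition.le_one t⟩
  -- The loop moves only for `1/3 ≤ t ≤ 2/3`. Near the ends only the Reeb factor moves, which lets
  -- the periodic extension be smooth.
  set u : ℝ → ℝ := fun t => Real.smoothTransition (3 * t - 1) with hu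
  have hus : ContDiff ℝ ∞ u := hT.comp ((contDiff_const.mul contDiff_id).sub contDiff_const)
  have hu0 : ∀ t, t ≤ 1 / 3 → u t = 0 := fun t ht =>
    Real.smoothTransition.zero_of_nonpos (by linarith)
  have hu1 : ∀ t, 2 / 3 ≤ t → u t = 1 := fun t ht =>
    Real.smoothTransition.one_of_one_le (by linarith)
  have hud : ∀ t, 0 ≤ deriv u t := fun t => Monotone.deriv_nonneg
    (Real.smoothTransition.monotone.comp fun a b h => by linarith)
  -- The homotopy is controlled only for parameters in `[0, 1]`, while the suspension isotopy needs
  -- all real `s`; `σ` clamps the parameter smoothly. It enters as `1 - σ` because the contraction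
  -- ends, rather than begins, at the constant loop.
  set σ : ℝ → ℝ := Real.smoothTransition
  have hσ : ∀ s, 1 - σ s ∈ Set.Icc (0 : ℝ) 1 := fun s =>
    ⟨by linarith [(hI s).2], by linarith [(hI s).1]⟩
  -- The exponent `δ (t - u(t))` vanishes at both ends and has speed `δ (1 - u')`. At `s = 1` the
  -- total rate over `B` is therefore at least `δ (1 - u') + u' δ = δ`.
  set k : ℝ × ℝ → Equiv.Perm V :=
    (fun z => e.flow (σ z.1 * (δ * (z.2 - u z.2)))) * fun z => h (1 - σ z.1, u z.2) with hk
  have hks : IsContactFamily lam k := by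
    have h1 : ContDiff ℝ ∞ (fun z : ℝ × ℝ => σ z.1 * (δ * (z.2 - u z.2))) :=
      (hT.comp contDiff_fst).mul (contDiff_const.mul (contDiff_snd.sub (hus.comp contDiff_snd)))
    have h2 : ContDiff ℝ ∞ (fun z : ℝ × ℝ => (1 - σ z.1, u z.2)) :=
      (contDiff_const.sub (hT.comp contDiff_fst)).prodMk (hus.comp contDiff_snd)
    exact ((e.isSmoothFamily.comp h1).mul (hh.family.comp h2)).isContactFamily
  have hkl : ∀ s t, t ≤ 1 / 3 → k (s, t) = e.flow (σ s * (δ * t)) := by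
    intro s t ht
    change e.flow (σ s * (δ * (t - u t))) * h (1 - σ s, u t) = _
    rw [hu0 t ht, (hh.ends _ (hσ s)).1, sub_zero, mul_one]
  have hkr : ∀ s t, 2 / 3 ≤ t → k (s, t) = e.flow (σ s * (δ * (t - 1))) := by
    intro s t ht
    change e.flow (σ s * (δ * (t - u t))) * h (1 - σ s, u t) = _
    rw [hu1 t ht, (hh.ends _ (hσ s)).2, mul_one]
  set f : ℝ × ℝ → Equiv.Perm V := fun z => k (z.1, Int.fract z.2) with hf
  have hloc : ∀ t₀ : ℝ, ∀ᶠ t in nhds t₀, ∀ s, f (s, t) = k (s, t - ⌊t₀⌋) := by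
    intro t₀
    rcases (Int.floor_le t₀).eq_or_lt with h0 | h0
    -- At an integer `t₀` the two periods must match: just before it `fract t - 1 = t - t₀`, so the
    -- formula for `k` near `1` agrees with its formula at the non-positive time `t - t₀`.
    · have h1 : ∀ᶠ t in nhds t₀, t ∈ Set.Ioo (t₀ - 1 / 3) (t₀ + 1 / 3) :=
        Ioo_mem_nhds (by linarith) (by linarith)
      filter_upwards [h1] with t ht s
      change k (s, Int.fract t) = _
      rcases le_or_gt t₀ t with h2 | h2
      · have h3 : ⌊t⌋ = ⌊t₀⌋ := Int.floor_eq_iff.2 ⟨by linarith, by linarith [ht.2]⟩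
        rw [Int.fract, h3]
      · have h3 : ⌊t⌋ = ⌊t₀⌋ - 1 := Int.floor_eq_iff.2
          ⟨by push_cast; linarith [ht.1], by push_cast; linarith⟩
        rw [Int.fract, h3, hkr _ _ (by push_cast; linarith [ht.1]), hkl _ _ (by linarith)]
        push_cast
        congr 3
        ring
    · have h1 : ∀ᶠ t in nhds t₀, t ∈ Set.Ioo (⌊t₀⌋ : ℝ) (⌊t₀⌋ + 1) :=
        Ioo_mem_nhds h0 (Int.lt_floor_add_one t₀)
      filter_upwards [h1] with t ht s
      change k (s, Int.fract t) = _
      have h3 : ⌊t⌋ = ⌊t₀⌋ := Int.floor_eq_iff.2 ⟨ht.1.le, ht.2⟩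
      rw [Int.fract, h3]
  have hfs : IsContactFamily lam f := hks.of_locally_shift fun t₀ => ⟨_, hloc t₀⟩
  obtain ⟨t, x, hx, hr⟩ := hAB.exists_rate_eq_zero e hfs
    (fun s t n => by
      change k (s, Int.fract (t + n)) = k (s, Int.fract t)
      rw [Int.fract_add_intCast])
    (fun t => by
      change e.flow (σ 0 * (δ * (Int.fract t - u (Int.fract t)))) *
        h (1 - σ 0, u (Int.fract t)) = 1
      rw [show σ 0 = 0 from Real.smoothTransition.zero, zero_mul, e.flow_zero, sub_zero,
        hh.right _ (hI _), one_mul])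
  set t' := Int.fract t with ht'
  have hσ1 : σ 1 = 1 := Real.smoothTransition.one
  have hk1 : ∀ τ, k (1, τ) = e.flow (δ * (τ - u τ)) * p.1 (u τ) := by
    intro τ
    change e.flow (σ 1 * (δ * (τ - u τ))) * h (1 - σ 1, u τ) = _
    rw [hσ1, sub_self, one_mul, hh.left _ (hI _)]
  have hud' := hus.differentiable (by simp) t'
  have hw : HasDerivAt (fun τ => δ * (τ - u τ)) (δ * (1 - deriv u t')) t' :=
    ((hasDerivAt_id t').fun_sub hud'.hasDerivAt).const_mul δ
  have hrate1 : rate lam (fun τ => f (1, τ)) t x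
      = δ * (1 - deriv u t') + deriv u t' * rate lam p.1 (u t') x := by
    have h1 : rate lam (fun τ => f (1, τ)) t x = rate lam (fun τ => k (1, τ - ⌊t⌋)) t x :=
      rate_congr ((hloc t).mono fun τ hτ => congrArg (fun g : Equiv.Perm V => g x) (hτ 1))
    have h2 : IsContactFamily lam (fun τ => k (1, τ)) :=
      hks.comp (contDiff_const.prodMk contDiff_id)
    have h3 := rate_comp h2 (u := fun t' => t' - ⌊t⌋) (t := t) (by fun_prop) x
    have h6 : deriv (fun t' : ℝ => t' - ⌊t⌋) t = 1 := by simp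
    rw [h1, h3, h6, one_mul, show t - ⌊t⌋ = t' from rfl]
    have h4 : (fun τ => k (1, τ)) = (fun τ => e.flow (δ * (τ - u τ))) * fun τ => p.1 (u τ) :=
      funext hk1
    have h5 : IsSmoothFamily e (fun τ => e.flow (δ * (τ - u τ))) :=
      e.isSmoothFamily.comp (contDiff_const.mul (contDiff_id.sub hus))
    rw [h4, rate_mul (e := e) h5.isContactFamily (p.2.1.comp hus).isContactFamily,
      conformalFactor_flow, rate_comp p.2.1.isContactFamily hud',
      rate_flow_comp hw.differentiableAt, hw.deriv, one_mul]
  have hxB : p.1 (u t') x ∈ Prod.fst '' B := by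
    have h1 : f (1, t) x = e.flow (δ * (t' - u t')) (p.1 (u t') x) := by
      change k (1, t') x = _
      rw [hk1]
      rfl
    have h2 := hB (-(δ * (t' - u t'))) _ hx
    rw [h1, e.flow_neg] at h2
    have h3 : (e.flow (δ * (t' - u t')))⁻¹ (e.flow (δ * (t' - u t')) (p.1 (u t') x))
        = p.1 (u t') x := Equiv.symm_apply_apply _ _
    rwa [h3] at h2
  -- This gives `u' δ ≤ u' rate`, so the rate of the closed-up loop is at least `δ > 0` at the point
  -- where it should vanish.
  have h1 := mul_le_mul_of_nonneg_left (hrate (u t') (hI _) x hxB) (hud t')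
  rw [hrate1] at hr
  nlinarith

end PositiveLoop

/-! ### Smoothness of composition on spaces of continuous curves -/

section Superposition

universe u
variable {K : Type*} [TopologicalSpace K] [CompactSpace K]
  {E F : Type u} [NormedAddCommGroup E] [NormedSpace ℝ E] [NormedAddCommGroup F] [NormedSpace ℝ F]

/-- Pointwise application of a continuous family of continuous linear maps. -/
def pointwiseApply : C(K, E →L[ℝ] F) →L[ℝ] C(K, E) →L[ℝ] C(K, F) :=
  LinearMap.mkContinuous₂
    (LinearMap.mk₂ ℝ (fun (A : C(K, E →L[ℝ] F)) (η : C(K, E)) =>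
        (⟨fun k => A k (η k), A.continuous.clm_apply η.continuous⟩ : C(K, F)))
      (fun _ _ _ => by ext; rfl) (fun _ _ _ => by ext; rfl)
      (fun A _ _ => by ext k; exact (A k).map_add _ _)
      (fun c A _ => by ext k; exact (A k).map_smul c _))
    1 (fun A η => by
      rw [one_mul]
      refine (ContinuousMap.norm_le _ (by positivity)).2 fun k => ?_
      exact ((A k).le_opNorm _).trans
        (mul_le_mul (A.norm_coe_le_norm k) (η.norm_coe_le_norm k) (norm_nonneg _)
          ((norm_nonneg _).trans (A.norm_coe_le_norm k))))

/-- The mean value inequality is applied at each `k` on the segment from `γ k` to `γ k + h k`. The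
estimate is uniform in `k` because `η ↦ X' ∘ η` is continuous in the sup norm on the compact `K`. -/
theorem hasFDerivAt_superposition (X : C(E, F)) (X' : C(E, E →L[ℝ] F))
    (hX : ∀ x, HasFDerivAt X (X' x) x) (γ : C(K, E)) :
    HasFDerivAt (fun η : C(K, E) => X.comp η) (pointwiseApply (X'.comp γ)) γ := by
  rw [hasFDerivAt_iff_isLittleO_nhds_zero, Asymptotics.isLittleO_iff]
  intro ε hε
  have hc0 : ContDiff ℝ 0 (fun η : C(K, E) => X'.comp η) :=
    contDiff_zero.2 (ContinuousMap.continuous_postcomp X')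
  have hc := hc0.continuous.continuousAt (x := γ)
  obtain ⟨δ, hδ, hball⟩ := Metric.continuousAt_iff.1 hc ε hε
  filter_upwards [Metric.ball_mem_nhds (0 : C(K, E)) hδ] with h hh
  rw [mem_ball_zero_iff] at hh
  refine (ContinuousMap.norm_le _ (by positivity)).2 fun k => ?_
  have hseg : ∀ y ∈ segment ℝ (γ k) (γ k + h k), ‖X' y - X' (γ k)‖ ≤ ε := by
    intro y hy
    rw [segment_eq_image'] at hy
    obtain ⟨s, hs, rfl⟩ := hy
    have h1 : dist (γ + s • h) γ < δ := by
      rw [dist_eq_norm, add_sub_cancel_left, norm_smul, Real.norm_of_nonneg hs.1]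
      exact (mul_le_of_le_one_left (norm_nonneg _) hs.2).trans_lt hh
    have h2 := (ContinuousMap.dist_apply_le_dist (f := X'.comp (γ + s • h)) (g := X'.comp γ)
      k).trans (hball h1).le
    rw [dist_eq_norm] at h2
    simpa using h2
  have := (convex_segment (γ k) (γ k + h k)).norm_image_sub_le_of_norm_hasFDerivWithin_le'
    (f := X) (f' := X') (φ := X' (γ k)) (fun y _ => (hX y).hasFDerivWithinAt) hseg
    (left_mem_segment ℝ _ _) (right_mem_segment ℝ _ _)
  rw [add_sub_cancel_left] at this
  exact this.trans (mul_le_mul_of_nonneg_left (h.norm_coe_le_norm k) hε.le)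

/-- The derivative of `η ↦ X ∘ η` is built linearly from `η ↦ X' ∘ η`, so smoothness gains one order
at a time. The target is quantified inside the induction since it changes from `F` to `E →L[ℝ] F`.
-/
theorem contDiff_superposition (n : ℕ) : ∀ {F : Type u} [NormedAddCommGroup F] [NormedSpace ℝ F]
    (X : C(E, F)), ContDiff ℝ n X → ContDiff ℝ n (fun η : C(K, E) => X.comp η) := by
  induction n with
  | zero =>
    intro F _ _ X _
    exact contDiff_zero.2 (ContinuousMap.continuous_postcomp X)
  | succ n ih =>
    intro F _ _ X hX
    push_cast at hX ⊢
    rw [contDiff_succ_iff_hasFDerivAt] at hX ⊢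
    obtain ⟨X', hX', hd⟩ := hX
    exact ⟨fun γ => pointwiseApply ((⟨X', hX'.continuous⟩ : C(E, E →L[ℝ] F)).comp γ),
      (ih (⟨X', hX'.continuous⟩ : C(E, E →L[ℝ] F)) hX').continuousLinearMap_comp pointwiseApply,
      hasFDerivAt_superposition X ⟨X', hX'.continuous⟩ hd⟩

end Superposition

/-! ### Local flows from the inverse function theorem on curve space -/

section LocalFlow

variable {E : Type*} [NormedAddCommGroup E]

/-- The time interval `[-1, 1]`. -/
abbrev TimeInterval : Type := Set.Icc (-1 : ℝ) 1

/-- A curve on `[-1, 1]` extended to `ℝ` by constants. -/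
def extendCurve (η : C(TimeInterval, E)) : ℝ → E := Set.IccExtend (by norm_num : (-1 : ℝ) ≤ 1) η

theorem continuous_extendCurve (η : C(TimeInterval, E)) : Continuous (extendCurve η) :=
  η.continuous.Icc_extend'

theorem extendCurve_of_mem (η : C(TimeInterval, E)) {s : ℝ} (hs : s ∈ Set.Icc (-1 : ℝ) 1) :
    extendCurve η s = η ⟨s, hs⟩ := Set.IccExtend_of_mem _ _ hs

theorem norm_extendCurve_le (η : C(TimeInterval, E)) (s : ℝ) : ‖extendCurve η s‖ ≤ ‖η‖ :=
  η.norm_coe_le_norm _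

variable [NormedSpace ℝ E]

/-- The primitive vanishing at `0`. -/
def primitive : C(TimeInterval, E) →L[ℝ] C(TimeInterval, E) :=
  LinearMap.mkContinuous
    { toFun := fun η => ⟨fun t => ∫ s in (0 : ℝ)..t, extendCurve η s,
        (intervalIntegral.continuous_primitive
          (fun a b => (continuous_extendCurve η).intervalIntegrable a b) 0).comp
          continuous_subtype_val⟩
      map_add' := fun η ζ => by
        ext t
        exact intervalIntegral.integral_add ((continuous_extendCurve η).intervalIntegrable _ _)
          ((continuous_extendCurve ζ).intervalIntegrable _ _)
      map_smul' := fun c η => by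
        ext t
        exact intervalIntegral.integral_smul c (extendCurve η) }
    1 (fun η => by
      rw [one_mul]
      refine (ContinuousMap.norm_le _ (norm_nonneg _)).2 fun t => ?_
      refine (intervalIntegral.norm_integral_le_of_norm_le_const
        (fun s _ => norm_extendCurve_le η s)).trans ?_
      refine mul_le_of_le_one_right (norm_nonneg _) ?_
      rw [sub_zero]
      exact abs_le.2 t.2)

/-- Solutions of `γ' = τ X(γ)`, `γ(0) = x` on `(-1, 1)`, depending smoothly on `(τ, x)`. -/
theorem exists_local_flow {E : Type*} [NormedAddCommGroup E] [NormedSpace ℝ E] [CompleteSpace E]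
    {X : E → E} (hX : ContDiff ℝ ∞ X) (n : ℕ) (x₀ : E) {U : Set E} (hU : U ∈ nhds x₀) :
    ∃ γ : ℝ × E → ℝ → E, ContDiffAt ℝ n (fun p => γ p (1 / 2)) (0, x₀) ∧
      ∀ᶠ p in nhds ((0 : ℝ), x₀), γ p 0 = p.2 ∧ ∀ s ∈ Set.Ioo (-1 : ℝ) 1,
        γ p s ∈ U ∧ HasDerivAt (γ p) (p.1 • X (γ p s)) s := by
  let Xc : C(E, E) := ⟨X, hX.continuous⟩
  let cst : E →L[ℝ] C(TimeInterval, E) := ContinuousLinearMap.const ℝ TimeInterval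
  let N : C(TimeInterval, E) → C(TimeInterval, E) := fun η => primitive (Xc.comp η)
  have hN : ContDiff ℝ (n + 1 : ℕ) N :=
    primitive.contDiff.comp (contDiff_superposition (n + 1) Xc (hX.of_le (by exact_mod_cast le_top)))
  -- The last component is the defect `η - x - τ ∫ X(η)` of the integral equation, with the
  -- parameters `(τ, x)` kept alongside; solutions are the preimages of points with defect zero.
  let Θ : (ℝ × E) × C(TimeInterval, E) → (ℝ × E) × C(TimeInterval, E) :=
    fun q => (q.1, q.2 - cst q.1.2 - q.1.1 • N q.2)
  have hΘ : ContDiff ℝ (n + 1 : ℕ) Θ := by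
    refine contDiff_fst.prodMk ((contDiff_snd.sub (cst.contDiff.comp (contDiff_snd.comp
      contDiff_fst))).sub ((contDiff_fst.comp contDiff_fst).smul (hN.comp contDiff_snd)))
  let a : (ℝ × E) × C(TimeInterval, E) := ((0, x₀), cst x₀)
  let S : ℝ × E →L[ℝ] C(TimeInterval, E) :=
    cst.comp (ContinuousLinearMap.snd ℝ ℝ E)
      + (ContinuousLinearMap.fst ℝ ℝ E).smulRight (N (cst x₀))
  -- At `τ = 0` the term `τ ∫ X(η)` has no derivative in `η`, so the derivative of `Θ` is a shear,
  -- invertible with no smallness condition on `X`. A small parameter `τ` replaces a small time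
  -- interval.
  let Θ' : ((ℝ × E) × C(TimeInterval, E)) ≃L[ℝ] (ℝ × E) × C(TimeInterval, E) :=
    ContinuousLinearEquiv.equivOfInverse
      ((ContinuousLinearMap.fst ℝ _ _).prod
        (ContinuousLinearMap.snd ℝ _ _ - S.comp (ContinuousLinearMap.fst ℝ _ _)))
      ((ContinuousLinearMap.fst ℝ _ _).prod
        (ContinuousLinearMap.snd ℝ _ _ + S.comp (ContinuousLinearMap.fst ℝ _ _)))
      (fun q => by simp) (fun q => by simp)
  have hderiv : HasFDerivAt Θ (Θ' : _ →L[ℝ] _) a := by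
    have h1 : HasFDerivAt N (fderiv ℝ N (cst x₀)) (cst x₀) :=
      (hN.differentiable (by simp) _).hasFDerivAt
    have h2 : HasFDerivAt (fun q : (ℝ × E) × C(TimeInterval, E) => N q.2) _ a :=
      HasFDerivAt.comp a (g := N) h1 hasFDerivAt_snd
    have h3 : HasFDerivAt (fun q : (ℝ × E) × C(TimeInterval, E) => q.1.1) _ a :=
      ((ContinuousLinearMap.fst ℝ ℝ E).comp
        (ContinuousLinearMap.fst ℝ (ℝ × E) C(TimeInterval, E))).hasFDerivAt
    have h4 : HasFDerivAt (fun q : (ℝ × E) × C(TimeInterval, E) => cst q.1.2) _ a :=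
      (cst.comp ((ContinuousLinearMap.snd ℝ ℝ E).comp
        (ContinuousLinearMap.fst ℝ (ℝ × E) C(TimeInterval, E)))).hasFDerivAt
    have h5 : HasFDerivAt (fun q : (ℝ × E) × C(TimeInterval, E) => q.2)
        (ContinuousLinearMap.snd ℝ (ℝ × E) C(TimeInterval, E)) a := hasFDerivAt_snd
    have h6 : HasFDerivAt (fun q : (ℝ × E) × C(TimeInterval, E) => q.1)
        (ContinuousLinearMap.fst ℝ (ℝ × E) C(TimeInterval, E)) a := hasFDerivAt_fst
    refine (h6.prodMk ((h5.fun_sub h4).fun_sub (h3.fun_smul h2))).congr_fderiv ?_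
    ext q <;> simp [Θ', S, a]
  have hat : ContDiffAt ℝ (n + 1 : ℕ) Θ a := hΘ.contDiffAt
  -- The inverse function theorem needs at least one derivative, which is why order `n + 1` is used
  -- to obtain order `n`.
  have hne : ((n + 1 : ℕ) : WithTop ℕ∞) ≠ 0 := by exact_mod_cast Nat.succ_ne_zero n
  let h := hat.toOpenPartialHomeomorph Θ hderiv hne
  have hcoe : ∀ q, h q = Θ q := fun q => rfl
  have hsrc : a ∈ h.source := hat.mem_toOpenPartialHomeomorph_source hderiv hne
  have hΘa : h a = ((0, x₀), 0) := by
    rw [hcoe]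
    simp [Θ, a]
  have htgt : (((0 : ℝ), x₀), (0 : C(TimeInterval, E))) ∈ h.target := hΘa ▸ h.map_source hsrc
  have hsymm : h.symm ((0, x₀), 0) = a := by rw [← hΘa, h.left_inv hsrc]
  have hsm : ContDiffAt ℝ (n + 1 : ℕ) h.symm ((0, x₀), 0) :=
    h.contDiffAt_symm htgt (f₀' := Θ') (by rw [hsymm]; exact hderiv) (by rw [hsymm]; exact hat)
  let Γ : ℝ × E → C(TimeInterval, E) := fun p => (h.symm (p, 0)).2
  have hΓ : ContDiffAt ℝ (n + 1 : ℕ) Γ (0, x₀) :=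
    (contDiff_snd.contDiffAt).comp _ (hsm.comp ((0 : ℝ), x₀)
      (contDiffAt_id.prodMk contDiffAt_const))
  have hΓ0 : Γ (0, x₀) = cst x₀ := by
    change (h.symm ((0, x₀), 0)).2 = _
    rw [hsymm]
  refine ⟨fun p => extendCurve (Γ p), ?_, ?_⟩
  · have hev : ContDiff ℝ n (fun η : C(TimeInterval, E) => η ⟨1 / 2, by norm_num, by norm_num⟩) :=
      (ContinuousMap.evalCLM (M := E) ℝ
        (⟨1 / 2, by norm_num, by norm_num⟩ : TimeInterval)).contDiff
    refine (hev.contDiffAt.comp _ (hΓ.of_le (by exact_mod_cast n.le_succ))).congr_of_eventuallyEq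
      (Filter.Eventually.of_forall fun p => ?_)
    exact extendCurve_of_mem _ _
  · obtain ⟨r, hr, hrU⟩ := Metric.mem_nhds_iff.1 hU
    have e1 : ∀ᶠ p in nhds ((0 : ℝ), x₀), Γ p ∈ Metric.ball (cst x₀) r :=
      hΓ.continuousAt.eventually (by rw [hΓ0]; exact Metric.ball_mem_nhds _ hr)
    have e2 : ∀ᶠ p in nhds ((0 : ℝ), x₀), (p, (0 : C(TimeInterval, E))) ∈ h.target := by
      have : Continuous (fun p : ℝ × E => (p, (0 : C(TimeInterval, E)))) := by fun_prop
      exact this.continuousAt.eventually (h.open_target.mem_nhds htgt)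
    filter_upwards [e1, e2] with p hp1 hp2
    have k1 : Θ (h.symm (p, 0)) = (p, 0) := by rw [← hcoe, h.right_inv hp2]
    have k2 : (h.symm (p, 0)).1 = p := congrArg Prod.fst k1
    have k3 : Γ p = cst p.2 + p.1 • N (Γ p) := by
      have k4 : Γ p - cst (h.symm (p, 0)).1.2 - (h.symm (p, 0)).1.1 • N (Γ p) = 0 :=
        congrArg Prod.snd k1
      rw [k2, sub_sub, sub_eq_zero] at k4
      exact k4
    have k5 : ∀ s ∈ Set.Icc (-1 : ℝ) 1, extendCurve (Γ p) s
        = p.2 + p.1 • ∫ τ in (0 : ℝ)..s, X (extendCurve (Γ p) τ) := by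
      intro s hs
      rw [extendCurve_of_mem _ hs]
      exact congrArg (fun η : C(TimeInterval, E) => η ⟨s, hs⟩) k3
    have hcont : Continuous (fun τ => X (extendCurve (Γ p) τ)) :=
      hX.continuous.comp (continuous_extendCurve _)
    refine ⟨?_, fun s hs => ⟨hrU ?_, ?_⟩⟩
    · rw [k5 0 (by norm_num)]
      simp
    · rw [extendCurve_of_mem _ (Set.Ioo_subset_Icc_self hs)]
      exact (ContinuousMap.dist_apply_le_dist (g := cst x₀) _).trans_lt hp1
    · have d1 : HasDerivAt (fun s => p.2 + p.1 • ∫ τ in (0 : ℝ)..s, X (extendCurve (Γ p) τ))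
          (p.1 • X (extendCurve (Γ p) s)) s :=
        ((intervalIntegral.integral_hasDerivAt_right (hcont.intervalIntegrable _ _)
          (hcont.stronglyMeasurableAtFilter _ _) hcont.continuousAt).const_smul p.1).const_add _
      refine d1.congr_of_eventuallyEq ?_
      filter_upwards [Ioo_mem_nhds hs.1 hs.2] with u hu
      exact k5 u (Set.Ioo_subset_Icc_self hu)

end LocalFlow

/-! ### Global smooth flow of a compactly supported vector field -/

section ManifoldFlow

variable {E : Type*} [NormedAddCommGroup E] [NormedSpace ℝ E] [FiniteDimensional ℝ E]
  {H : Type*} [TopologicalSpace H] {I : ModelWithCorners ℝ E H} [I.Boundaryless]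
  {M : Type*} [TopologicalSpace M] [ChartedSpace H M] [IsManifold I ∞ M]
  {Y : (x : M) → TangentSpace I x}

/-- A smooth vector field near a point, in a chart and extended to the model space. -/
theorem exists_chart_vectorField
    (hY : ContMDiff I I.tangent ∞ (fun x => (⟨x, Y x⟩ : TangentBundle I M))) (x₀ : M) :
    ∃ X : E → E, ContDiff ℝ ∞ X ∧ ∃ U ∈ nhds (extChartAt I x₀ x₀),
      U ⊆ (extChartAt I x₀).target ∧ ∀ u ∈ U,
        (mfderiv 𝓘(ℝ, E) I (extChartAt I x₀).symm u : E →L[ℝ] E) (X u)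
          = Y ((extChartAt I x₀).symm u) := by
  set φ := extChartAt I x₀ with hφ
  have hto : IsOpen φ.target := isOpen_extChartAt_target x₀
  have hso : IsOpen φ.source := isOpen_extChartAt_source x₀
  have hsymm : ContMDiffOn 𝓘(ℝ, E) I ∞ φ.symm φ.target := contMDiffOn_extChartAt_symm x₀
  have hφs : ContMDiffOn I 𝓘(ℝ, E) ∞ φ φ.source := by
    rw [hφ, extChartAt_source]
    exact contMDiffOn_extChartAt
  let X₀ : E → E := fun u => (mfderiv I 𝓘(ℝ, E) φ (φ.symm u) : E →L[ℝ] E) (Y (φ.symm u))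
  have hX₀ : ContDiffOn ℝ ∞ X₀ φ.target := by
    have h1 := hφs.contMDiffOn_tangentMapWithin (m := ∞) (by simp) hso.uniqueMDiffOn
    have h2 : ContMDiffOn 𝓘(ℝ, E) I.tangent ∞
        (fun u => (⟨φ.symm u, Y (φ.symm u)⟩ : TangentBundle I M)) φ.target := hY.comp_contMDiffOn hsymm
    have h3 := h1.comp h2 (fun u hu => φ.map_target hu)
    have h4 := (contMDiff_snd_tangentBundle_modelSpace E 𝓘(ℝ, E)).comp_contMDiffOn h3
    refine (contMDiffOn_iff_contDiffOn.1 h4).congr fun u hu => ?_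
    exact congrArg (fun T : E →L[ℝ] E => T (Y (φ.symm u)))
      (mfderivWithin_of_isOpen hso (φ.map_target hu)).symm
  obtain ⟨r, hr, hrt⟩ := Metric.isOpen_iff.1 hto (φ x₀) (mem_extChartAt_target x₀)
  -- The bump equals `1` on the ball of radius `r / 3` and is supported inside the chart, so the
  -- product extends by zero without changing the field near the base point.
  let f : ContDiffBump (φ x₀) := ⟨r / 3, r / 2, by positivity, by linarith⟩
  have hft : tsupport f ⊆ φ.target := by
    rw [f.tsupport_eq]
    exact (Metric.closedBall_subset_ball (by simp [f]; linarith)).trans hrt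
  refine ⟨fun u => f u • X₀ u, ?_, Metric.ball (φ x₀) (r / 3),
    Metric.ball_mem_nhds _ (by positivity),
    (Metric.ball_subset_ball (by linarith)).trans hrt, fun u hu => ?_⟩
  · refine contDiff_iff_contDiffAt.2 fun u => ?_
    by_cases hu : u ∈ φ.target
    · exact f.contDiffAt.smul (hX₀.contDiffAt (hto.mem_nhds hu))
    · have h0 := notMem_tsupport_iff_eventuallyEq.1 (fun h => hu (hft h))
      refine (contDiffAt_const (c := (0 : E))).congr_of_eventuallyEq ?_
      filter_upwards [h0] with v hv
      rw [hv]
      simp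
  · have hut : u ∈ φ.target := hrt (Metric.ball_subset_ball (by linarith) hu)
    have h1 : f u = 1 := f.one_of_mem_closedBall (Metric.ball_subset_closedBall hu)
    have h2 := mfderivWithin_extChartAt_symm_comp_mfderiv_extChartAt (I := I) (x := x₀) hut
    rw [I.range_eq_univ, mfderivWithin_univ] at h2
    have h3 : (f u • X₀ u : E) = X₀ u := by rw [h1, one_smul]
    change (mfderiv 𝓘(ℝ, E) I φ.symm u : E →L[ℝ] E) (f u • X₀ u) = _
    rw [h3]
    exact congrArg (fun T : E →L[ℝ] E => T (Y (φ.symm u))) h2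

/-- The local flow in a chart is pushed forward. The position at parameter `1/2` of the curve with
speed scale `τ` plays the role of the flow at time `τ / 2`; `1/2` is interior to `(-1, 1)`, where
uniqueness of integral curves applies. -/
theorem exists_local_manifold_flow
    (hY : ContMDiff I I.tangent ∞ (fun x => (⟨x, Y x⟩ : TangentBundle I M))) (x₀ : M) (n : ℕ) :
    ∃ Φ : ℝ × M → M, ContMDiffAt (𝓘(ℝ, ℝ).prod I) I n Φ (0, x₀) ∧
      ∀ᶠ p in nhds ((0 : ℝ), x₀), ∃ γ : ℝ → M, γ 0 = p.2 ∧ γ (1 / 2) = Φ p ∧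
        IsMIntegralCurveOn γ (p.1 • Y) (Set.Ioo (-1) 1) := by
  obtain ⟨X, hX, U, hU, hUt, hXY⟩ := exists_chart_vectorField hY x₀
  set φ := extChartAt I x₀ with hφ
  have hto : IsOpen φ.target := isOpen_extChartAt_target x₀
  have hso : IsOpen φ.source := isOpen_extChartAt_source x₀
  have hxs : x₀ ∈ φ.source := mem_extChartAt_source x₀
  have hsymm : ContMDiffOn 𝓘(ℝ, E) I ∞ φ.symm φ.target := contMDiffOn_extChartAt_symm x₀
  have hφx : ContMDiffAt I 𝓘(ℝ, E) ∞ φ x₀ := contMDiffAt_extChartAt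
  obtain ⟨γ, hγ, hev⟩ := exists_local_flow hX n (φ x₀) hU
  let q : ℝ × M → ℝ × E := fun p => (p.1, φ p.2)
  have hq : ContMDiffAt (𝓘(ℝ, ℝ).prod I) 𝓘(ℝ, ℝ × E) n q (0, x₀) := by
    rw [modelWithCornersSelf_prod, ← chartedSpaceSelf_prod]
    exact contMDiffAt_fst.prodMk ((hφx.of_le (by exact_mod_cast le_top)).comp (0, x₀)
      contMDiffAt_snd)
  refine ⟨fun p => φ.symm (γ (q p) (1 / 2)), ?_, ?_⟩
  · have h0 := (hev.self_of_nhds.2 (1 / 2) (by norm_num)).1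
    have h1 : ContMDiffAt 𝓘(ℝ, E) I n φ.symm (γ (q (0, x₀)) (1 / 2)) :=
      (hsymm.contMDiffAt (hto.mem_nhds (hUt h0))).of_le (by exact_mod_cast le_top)
    have h2 : ContMDiffAt 𝓘(ℝ, ℝ × E) 𝓘(ℝ, E) n (fun p => γ p (1 / 2)) (q (0, x₀)) :=
      hγ.contMDiffAt
    exact h1.comp (0, x₀) (h2.comp (0, x₀) hq)
  · have e1 : ∀ᶠ p in nhds ((0 : ℝ), x₀), p.2 ∈ φ.source :=
      continuousAt_snd.eventually (hso.mem_nhds hxs)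
    filter_upwards [hq.continuousAt.eventually hev, e1] with p hp hps
    refine ⟨fun s => φ.symm (γ (q p) s), ?_, rfl, fun s hs => ?_⟩
    · change φ.symm (γ (q p) 0) = p.2
      rw [hp.1]
      exact φ.left_inv hps
    · obtain ⟨hs1, hs2⟩ := hp.2 s hs
      have h1 : HasMFDerivAt 𝓘(ℝ, E) I φ.symm (γ (q p) s)
          (mfderiv 𝓘(ℝ, E) I φ.symm (γ (q p) s)) :=
        ((hsymm.contMDiffAt (hto.mem_nhds (hUt hs1))).mdifferentiableAt (by simp)).hasMFDerivAt
      have h2 := (HasMFDerivAt.comp s h1 hs2.hasFDerivAt.hasMFDerivAt).hasMFDerivWithinAt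
        (s := Set.Ioo (-1) 1)
      have h3 : (mfderiv 𝓘(ℝ, E) I φ.symm (γ (q p) s) : E →L[ℝ] E) (p.1 • X (γ (q p) s))
          = p.1 • Y (φ.symm (γ (q p) s)) :=
        (ContinuousLinearMap.map_smul (mfderiv 𝓘(ℝ, E) I φ.symm (γ (q p) s) : E →L[ℝ] E) p.1
          (X (γ (q p) s))).trans (congrArg (fun v : E => p.1 • v) (hXY _ hs1))
      refine HasMFDerivWithinAt.congr_mfderiv h2 ?_
      refine ContinuousLinearMap.ext_ring ?_
      refine Eq.trans ?_ (Eq.trans h3 ?_)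
      · change (mfderiv 𝓘(ℝ, E) I φ.symm (γ (q p) s) : E →L[ℝ] E)
          ((1 : ℝ) • (p.1 • X (γ (q p) s))) = _
        rw [one_smul]
      · exact (one_smul ℝ _).symm

variable [T2Space M] {K : Set M}

/-- Compactness of `K` gives one `ε` for which an integral curve exists on `(-ε, ε)` from every
point of `K`; off `K` the constant curve serves. A uniform lifespan implies global existence. -/
theorem exists_isMIntegralCurve
    (hY : ContMDiff I I.tangent ∞ (fun x => (⟨x, Y x⟩ : TangentBundle I M)))
    (hK : IsCompact K) (hYK : ∀ x ∉ K, Y x = 0) (x : M) :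
    ∃ γ : ℝ → M, γ 0 = x ∧ IsMIntegralCurve γ Y := by
  have huni : ∃ ε > (0 : ℝ), ∀ x ∈ K, ∃ γ : ℝ → M, γ 0 = x ∧
      IsMIntegralCurveOn γ Y (Set.Ioo (-ε) ε) := by
    refine hK.induction_on (p := fun S => ∃ ε > (0 : ℝ), ∀ x ∈ S, ∃ γ : ℝ → M, γ 0 = x ∧
      IsMIntegralCurveOn γ Y (Set.Ioo (-ε) ε)) ⟨1, one_pos, by simp⟩ ?_ ?_ ?_
    · rintro S T hST ⟨ε, hε, h⟩
      exact ⟨ε, hε, fun x hx => h x (hST hx)⟩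
    · rintro S T ⟨ε, hε, h⟩ ⟨δ, hδ, h'⟩
      refine ⟨min ε δ, lt_min hε hδ, ?_⟩
      rintro x (hx | hx)
      · obtain ⟨γ, h0, hγ⟩ := h x hx
        exact ⟨γ, h0, hγ.mono (Set.Ioo_subset_Ioo (neg_le_neg (min_le_left _ _)) (min_le_left _ _))⟩
      · obtain ⟨γ, h0, hγ⟩ := h' x hx
        exact ⟨γ, h0,
          hγ.mono (Set.Ioo_subset_Ioo (neg_le_neg (min_le_right _ _)) (min_le_right _ _))⟩
    · intro x₀ _
      obtain ⟨Φ, -, hev⟩ := exists_local_manifold_flow hY x₀ 0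
      rw [nhds_prod_eq, Filter.eventually_prod_iff] at hev
      obtain ⟨P, hP, Q, hQ, h⟩ := hev
      obtain ⟨ε, hε, hball⟩ := Metric.eventually_nhds_iff.1 hP
      refine ⟨{x | Q x}, nhdsWithin_le_nhds hQ, ε / 2, by positivity, fun x hx => ?_⟩
      obtain ⟨γ, h0, -, hγ⟩ := h (hball (y := ε / 2)
        (by rw [Real.dist_eq, sub_zero, abs_of_pos (by positivity)]; linarith)) hx
      -- The curve was obtained for the field scaled by `ε / 2`; dividing time by `ε / 2` turns it
      -- into a curve of `Y` itself on `(-ε / 2, ε / 2)`.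
      refine ⟨γ ∘ (· * (ε / 2)⁻¹), by simpa using h0, ?_⟩
      have h1 := hγ.comp_mul (ε / 2)⁻¹
      rw [smul_smul, inv_mul_cancel₀ (by positivity), one_smul] at h1
      refine h1.mono fun t ht => ?_
      rw [Set.mem_ofPred_eq, ← div_eq_mul_inv]
      exact ⟨by rw [lt_div_iff₀ (by positivity)]; linarith [ht.1],
        by rw [div_lt_iff₀ (by positivity)]; linarith [ht.2]⟩
  obtain ⟨ε, hε, h⟩ := huni
  refine exists_isMIntegralCurve_of_isMIntegralCurveOn (hY.of_le (by simp)) hε (fun y => ?_) x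
  by_cases hy : y ∈ K
  · exact h y hy
  · refine ⟨fun _ => y, rfl, IsMIntegralCurve.isMIntegralCurveOn ?_ _⟩
    exact isMIntegralCurve_const (hYK y hy)

/-- A compactly supported smooth vector field has a smooth global flow. -/
theorem exists_flow (hY : ContMDiff I I.tangent ∞ (fun x => (⟨x, Y x⟩ : TangentBundle I M)))
    (hK : IsCompact K) (hYK : ∀ x ∉ K, Y x = 0) :
    ∃ θ : ℝ → Equiv.Perm M, ContMDiff (𝓘(ℝ, ℝ).prod I) I ∞ (fun z : ℝ × M => θ z.1 z.2) ∧
      (∀ s t, θ (s + t) = θ s * θ t) ∧ (∀ x, IsMIntegralCurve (fun t => θ t x) Y) ∧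
      ∀ t, ∀ x ∉ K, θ t x = x := by
  have hY1 : ContMDiff I I.tangent 1 (fun x => (⟨x, Y x⟩ : TangentBundle I M)) :=
    hY.of_le (by simp)
  choose γ hγ0 hγ using exists_isMIntegralCurve hY hK hYK
  have hadd : ∀ s t x, γ x (s + t) = γ (γ x t) s := fun s t x =>
    congrFun (isMIntegralCurve_Ioo_eq_of_contMDiff_boundaryless (t₀ := 0) hY1 ((hγ x).comp_add t)
      (hγ (γ x t)) (by simp [hγ0])) s
  have hfix : ∀ t, ∀ x ∉ K, γ x t = x := fun t x hx =>
    congrFun (isMIntegralCurve_Ioo_eq_of_contMDiff_boundaryless (t₀ := 0) hY1 (hγ x)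
      (isMIntegralCurve_const (hYK x hx)) (hγ0 x)) t
  let θ : ℝ → Equiv.Perm M := fun t =>
    ⟨fun x => γ x t, fun x => γ x (-t), fun x => by
      simp only [← hadd, neg_add_cancel, hγ0],
      fun x => by simp only [← hadd, add_neg_cancel, hγ0]⟩
  refine ⟨θ, ?_, fun s t => Equiv.ext fun x => hadd s t x, hγ, hfix⟩
  refine contMDiff_infty.2 fun n => ?_
  -- Uniqueness for the field `2t · Y` identifies the global curve at time `t` with the local
  -- solution at parameter `1/2`, which depends smoothly on the data.
  have hlocal : ∀ x₀, ContMDiffAt (𝓘(ℝ, ℝ).prod I) I n (fun z : ℝ × M => γ z.2 z.1) (0, x₀) := by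
    intro x₀
    obtain ⟨Φ, hΦ, hev⟩ := exists_local_manifold_flow hY x₀ n
    have h2 : ContMDiff (𝓘(ℝ, ℝ).prod I) (𝓘(ℝ, ℝ).prod I) n
        (fun z : ℝ × M => ((2 * z.1, z.2) : ℝ × M)) :=
      ((contDiff_const.mul contDiff_id).contMDiff.comp contMDiff_fst).prodMk contMDiff_snd
    have h4 : ContMDiffAt (𝓘(ℝ, ℝ).prod I) I n (fun z : ℝ × M => Φ (2 * z.1, z.2)) (0, x₀) :=
      ContMDiffAt.comp (0, x₀) (g := Φ) (by simpa using hΦ) h2.contMDiffAt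
    refine h4.congr_of_eventuallyEq ?_
    have h5 : ∀ᶠ z in nhds ((0 : ℝ), x₀), _ :=
      (show Filter.Tendsto (fun z : ℝ × M => ((2 * z.1, z.2) : ℝ × M)) (nhds (0, x₀))
        (nhds (0, x₀)) by simpa using h2.continuous.tendsto ((0 : ℝ), x₀)).eventually hev
    filter_upwards [h5] with z hz
    obtain ⟨c, hc0, hc1, hc⟩ := hz
    have h6 : ContMDiff I I.tangent 1
        (fun x => (⟨x, ((2 * z.1) • Y) x⟩ : TangentBundle I M)) :=
      ContMDiff.const_smul_section hY1
    have h7 := isMIntegralCurveOn_Ioo_eqOn_of_contMDiff_boundaryless (t₀ := 0) (by norm_num) h6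
      (((hγ z.2).comp_mul (2 * z.1)).isMIntegralCurveOn (Set.Ioo (-1) 1)) hc
      (by simp [hγ0, hc0]) (show (1 / 2 : ℝ) ∈ Set.Ioo (-1 : ℝ) 1 by norm_num)
    rw [hc1] at h7
    rw [← h7, Function.comp_apply]
    congr 1
    ring
  have huni : ∃ ε > (0 : ℝ), ∀ x ∈ K, ∀ t : ℝ, |t| < ε →
      ContMDiffAt (𝓘(ℝ, ℝ).prod I) I n (fun z : ℝ × M => γ z.2 z.1) (t, x) := by
    refine hK.induction_on (p := fun S => ∃ ε > (0 : ℝ), ∀ x ∈ S, ∀ t : ℝ, |t| < ε →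
      ContMDiffAt (𝓘(ℝ, ℝ).prod I) I n (fun z : ℝ × M => γ z.2 z.1) (t, x))
      ⟨1, one_pos, by simp⟩ ?_ ?_ ?_
    · rintro S T hST ⟨ε, hε, h⟩
      exact ⟨ε, hε, fun x hx => h x (hST hx)⟩
    · rintro S T ⟨ε, hε, h⟩ ⟨δ, hδ, h'⟩
      refine ⟨min ε δ, lt_min hε hδ, ?_⟩
      rintro x (hx | hx) t ht
      · exact h x hx t (ht.trans_le (min_le_left _ _))
      · exact h' x hx t (ht.trans_le (min_le_right _ _))
    · intro x₀ _
      have hev := (contMDiffAt_iff_contMDiffAt_nhds (by simp)).1 (hlocal x₀)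
      rw [nhds_prod_eq, Filter.eventually_prod_iff] at hev
      obtain ⟨P, hP, Q, hQ, h⟩ := hev
      obtain ⟨ε, hε, hball⟩ := Metric.eventually_nhds_iff.1 hP
      exact ⟨{x | Q x}, nhdsWithin_le_nhds hQ, ε, hε, fun x hx t ht =>
        h (hball (by rwa [Real.dist_eq, sub_zero])) hx⟩
  obtain ⟨ε, hε, hsmall⟩ := huni
  have hsmall' : ∀ x, ∀ t : ℝ, |t| < ε →
      ContMDiffAt (𝓘(ℝ, ℝ).prod I) I n (fun z : ℝ × M => γ z.2 z.1) (t, x) := by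
    intro x t ht
    by_cases hx : x ∈ K
    · exact hsmall x hx t ht
    · refine contMDiffAt_snd.congr_of_eventuallyEq ?_
      filter_upwards [continuousAt_snd.eventually (hK.isClosed.isOpen_compl.mem_nhds hx)] with z hz
      exact hfix z.1 z.2 hz
  -- Smoothness propagates in time through `γ_x(t) = γ_{γ_x(r)}(t - r)`. With `r = t (m + 1) / (m +
  -- 2)` the remainder is `t / (m + 2)`, short enough for the uniform local statement.
  have hall : ∀ m : ℕ, ∀ x, ∀ t : ℝ, |t| < (m + 1) * ε →
      ContMDiffAt (𝓘(ℝ, ℝ).prod I) I n (fun z : ℝ × M => γ z.2 z.1) (t, x) := by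
    intro m
    induction m with
    | zero => intro x t ht; exact hsmall' x t (by simpa using ht)
    | succ m ih =>
      intro x t ht
      push_cast at ht
      set r : ℝ := t * ((m + 1) / (m + 2)) with hr
      have hm : (0 : ℝ) < m + 2 := by positivity
      have h1 : |r| < (m + 1) * ε := by
        rw [hr, abs_mul, abs_of_pos (by positivity : (0 : ℝ) < (m + 1) / (m + 2)), mul_div_assoc',
          div_lt_iff₀ hm]
        have hm1 : (0 : ℝ) < m + 1 := by positivity
        nlinarith [mul_lt_mul_of_pos_right ht hm1]
      have h2 : |t - r| < ε := by
        have : t - r = t / (m + 2) := by rw [hr]; field_simp; ring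
        rw [this, abs_div, abs_of_pos hm, div_lt_iff₀ hm]
        linarith
      have h3 : ContMDiffAt (𝓘(ℝ, ℝ).prod I) I n (fun z : ℝ × M => γ z.2 r) (t, x) :=
        (ih x r h1).comp (t, x) (f := fun z : ℝ × M => (r, z.2))
          (contMDiffAt_const.prodMk contMDiffAt_snd)
      have h4 : ContMDiffAt (𝓘(ℝ, ℝ).prod I) 𝓘(ℝ, ℝ) n (fun z : ℝ × M => z.1 - r) (t, x) :=
        ((contDiff_id.sub contDiff_const).contMDiff.contMDiffAt).comp (t, x) contMDiffAt_fst
      have h5 := (hsmall' (γ x r) (t - r) h2).comp (t, x)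
        (f := fun z : ℝ × M => (z.1 - r, γ z.2 r)) (h4.prodMk h3)
      refine h5.congr_of_eventuallyEq (Filter.Eventually.of_forall fun z => ?_)
      change γ z.2 z.1 = γ (γ z.2 r) (z.1 - r)
      rw [← hadd, sub_add_cancel]
  intro z
  obtain ⟨m, hm⟩ := exists_nat_gt (|z.1| / ε)
  refine hall m z.2 z.1 ?_
  rw [div_lt_iff₀ hε] at hm
  nlinarith

end ManifoldFlow

/-! ### The contact vector field of a function -/

section ContactField

variable {d : ℕ} {V : Type*} [TopologicalSpace V] [ChartedSpace (EuclideanSpace ℝ (Fin d)) V]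

local notation "𝔼" => EuclideanSpace ℝ (Fin d)

theorem OneForm.d_swap (θ : OneForm (𝓡 d) V) (x : V) (v w : 𝔼) :
    θ.d x v w = - θ.d x w v := (neg_sub _ _).symm

variable [IsManifold (𝓡 d) ∞ V] {lam : ContactForm d V} {e : ReebCircleAction lam}

variable (e) in
/-- The Reeb vector field. -/
def reebField (x : V) : 𝔼 := velocity (𝓡 d) (fun τ => e.flow τ x) 0

theorem form_reebField (x : V) : (lam.form x : 𝔼 →L[ℝ] ℝ) (reebField e x) = 1 := by
  have key : ∀ z, z = x → (lam.form z : 𝔼 →L[ℝ] ℝ) (reebField e x) = 1 →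
      (lam.form x : 𝔼 →L[ℝ] ℝ) (reebField e x) = 1 := by
    rintro z rfl h
    exact h
  exact key (e.flow 0 x) (by rw [e.flow_zero]; rfl) (e.form_velocity 0 x)

theorem d_reebField (x : V) (w : 𝔼) : lam.form.d x (reebField e x : 𝔼) w = 0 := by
  have key : ∀ z, z = x → lam.form.d z (reebField e x : 𝔼) w = 0 →
      lam.form.d x (reebField e x : 𝔼) w = 0 := by
    rintro z rfl h
    exact h
  exact key (e.flow 0 x) (by rw [e.flow_zero]; rfl) (e.d_velocity 0 x w)

/-- `v ↦ a(v) a + da(v, ·)`, in terms of the value and the derivative of the form `a`. -/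
def contactMapAux (a : 𝔼 →L[ℝ] ℝ) (D : 𝔼 →L[ℝ] 𝔼 →L[ℝ] ℝ) : 𝔼 →L[ℝ] 𝔼 →L[ℝ] ℝ :=
  a.smulRight a + D - D.flip

theorem contactMapAux_apply (a : 𝔼 →L[ℝ] ℝ) (D : 𝔼 →L[ℝ] 𝔼 →L[ℝ] ℝ) (v w : 𝔼) :
    contactMapAux a D v w = a v * a w + (D v w - D w v) := by
  simp [contactMapAux]
  ring

variable (lam) in
/-- The linear isomorphism `v ↦ λ(v) λ + dλ(v, ·)` from vectors to covectors. -/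
def contactMap (x : V) : 𝔼 →L[ℝ] 𝔼 →L[ℝ] ℝ :=
  contactMapAux (lam.form x) (fderiv ℝ (lam.form.inChart x) (extChartAt (𝓡 d) x x))

theorem contactMap_apply (x : V) (v w : 𝔼) : contactMap lam x v w
    = (lam.form x : 𝔼 →L[ℝ] ℝ) v * (lam.form x : 𝔼 →L[ℝ] ℝ) w + lam.form.d x v w :=
  contactMapAux_apply _ _ _ _

/-- Testing a kernel vector on the Reeb vector kills its `λ`-component, since `dλ(·, R) = 0`;
nondegeneracy of `dλ` on `ker λ` kills the rest. -/
theorem contactMap_injective (e : ReebCircleAction lam) (x : V) : Function.Injective (contactMap lam x) := by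
  refine (injective_iff_map_eq_zero _).2 fun v hv => ?_
  have h1 : ∀ w : 𝔼, (lam.form x : 𝔼 →L[ℝ] ℝ) v * (lam.form x : 𝔼 →L[ℝ] ℝ) w
      + lam.form.d x v w = 0 := fun w => by
    rw [← contactMap_apply, hv]
    rfl
  have h2 : (lam.form x : 𝔼 →L[ℝ] ℝ) v = 0 := by
    have h := h1 (reebField e x)
    rwa [form_reebField, OneForm.d_swap, d_reebField, mul_one, neg_zero, add_zero] at h
  refine lam.nondegenerate x v h2 fun w _ => ?_
  have h := h1 w
  rwa [h2, zero_mul, zero_add] at h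

theorem isInvertible_of_injective {T : 𝔼 →L[ℝ] 𝔼 →L[ℝ] ℝ} (h : Function.Injective T) :
    T.IsInvertible := by
  have hdim : Module.finrank ℝ 𝔼 = Module.finrank ℝ (𝔼 →L[ℝ] ℝ) :=
    ((InnerProductSpace.toDual ℝ 𝔼).toLinearEquiv.finrank_eq)
  refine ⟨(LinearEquiv.ofInjectiveOfFinrankEq (T : 𝔼 →ₗ[ℝ] 𝔼 →L[ℝ] ℝ) h hdim).toContinuousLinearEquiv,
    ?_⟩
  ext v w
  rfl

/-- The differential of a smooth function, as a 1-form. -/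
theorem scalarDeriv_isSmooth {h : V → ℝ} (hh : ContMDiff (𝓡 d) 𝓘(ℝ, ℝ) ∞ h) :
    OneForm.IsSmooth (I := 𝓡 d) (M := V) (fun x => scalarDeriv (𝓡 d) h x) :=
  (contMDiff_snd_tangentBundle_modelSpace ℝ 𝓘(ℝ, ℝ)).comp
    (hh.contMDiff_tangentMap (m := ∞) (by simp))

variable (e) in
/-- The derivative of `h` along the Reeb field. -/
def reebDeriv (h : V → ℝ) (x : V) : ℝ := scalarDeriv (𝓡 d) h x (reebField e x)

theorem contMDiff_reebDeriv {h : V → ℝ} (hh : ContMDiff (𝓡 d) 𝓘(ℝ, ℝ) ∞ h) :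
    ContMDiff (𝓡 d) 𝓘(ℝ, ℝ) ∞ (reebDeriv e h) := by
  have h1 := (contMDiff_form_velocity (scalarDeriv_isSmooth hh) (ψ := fun t x => e.flow t x)
    e.smooth).comp ((contMDiff_const (c := (0 : ℝ))).prodMk (contMDiff_id (I := 𝓡 d) (M := V)))
  refine h1.congr fun x => ?_
  have key : ∀ z, z = x → scalarDeriv (𝓡 d) h x (reebField e x)
      = scalarDeriv (𝓡 d) h z (reebField e x) := by
    rintro z rfl
    rfl
  exact key (e.flow 0 x) (by rw [e.flow_zero]; rfl)

variable (e) in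
/-- The covector `h λ + dh(R) λ - dh`. -/
def contactCovector (h : V → ℝ) (x : V) : 𝔼 →L[ℝ] ℝ :=
  let a : 𝔼 →L[ℝ] ℝ := lam.form x
  (h x + reebDeriv e h x) • a - scalarDeriv (𝓡 d) h x

theorem contactCovector_apply (h : V → ℝ) (x : V) (w : 𝔼) : contactCovector e h x w
    = (h x + reebDeriv e h x) * (lam.form x : 𝔼 →L[ℝ] ℝ) w - scalarDeriv (𝓡 d) h x w := rfl

variable (e) in
/-- The contact vector field of `h`: `λ(X) = h` and `dλ(X, ·) = dh(R) λ - dh`. -/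
def contactField (h : V → ℝ) (x : V) : 𝔼 := (contactMap lam x).inverse (contactCovector e h x)

theorem contactMap_contactField (h : V → ℝ) (x : V) :
    contactMap lam x (contactField e h x) = contactCovector e h x :=
  (isInvertible_of_injective (contactMap_injective e x)).self_apply_inverse _

theorem contactField_eq {h : V → ℝ} {x : V} {v : 𝔼}
    (hv : ∀ w, contactMap lam x v w = contactCovector e h x w) : contactField e h x = v :=
  contactMap_injective e x (by rw [contactMap_contactField]; exact (ContinuousLinearMap.ext hv).symm)

/-- The defining equation is evaluated on the Reeb vector: `dλ` drops out and the two terms in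
`dh(R)` cancel. -/
theorem form_contactField (h : V → ℝ) (x : V) :
    (lam.form x : 𝔼 →L[ℝ] ℝ) (contactField e h x) = h x := by
  have h1 := congrArg (fun T : 𝔼 →L[ℝ] ℝ => T (reebField e x)) (contactMap_contactField (e := e) h x)
  simp only [contactMap_apply, contactCovector_apply, form_reebField, mul_one] at h1
  rw [OneForm.d_swap, d_reebField, reebDeriv] at h1
  linarith

theorem d_contactField (h : V → ℝ) (x : V) (w : 𝔼) :
    lam.form.d x (contactField e h x : 𝔼) w
      = reebDeriv e h x * (lam.form x : 𝔼 →L[ℝ] ℝ) w - scalarDeriv (𝓡 d) h x w := by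
  have h1 := congrArg (fun T : 𝔼 →L[ℝ] ℝ => T w) (contactMap_contactField (e := e) h x)
  simp only [contactMap_apply, contactCovector_apply, form_contactField] at h1
  linarith

theorem contactField_eq_zero {h : V → ℝ} {x : V} (hx : x ∉ tsupport h) : contactField e h x = 0 := by
  have h0 := notMem_tsupport_iff_eventuallyEq.1 hx
  have h1 : scalarDeriv (𝓡 d) h x = 0 := by
    have : mfderiv (𝓡 d) 𝓘(ℝ, ℝ) h x = mfderiv (𝓡 d) 𝓘(ℝ, ℝ) (fun _ : V => (0 : ℝ)) x :=
      h0.mfderiv_eq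
    exact this.trans mfderiv_const
  refine contactField_eq fun w => ?_
  simp [contactCovector_apply, reebDeriv, h1, h0.eq_of_nhds]

/-- The pointwise definition of `dλ` uses a different chart at every point, so smoothness is not
visible from it. Naturality of `d` expresses the defining linear system near `x₀` in one fixed
chart, where its coefficients are smooth and inversion of linear maps preserves smoothness. -/
theorem contMDiff_contactField {h : V → ℝ} (hh : ContMDiff (𝓡 d) 𝓘(ℝ, ℝ) ∞ h) :
    ContMDiff (𝓡 d) (𝓡 d).tangent ∞
      (fun x => (⟨x, contactField e h x⟩ : TangentBundle (𝓡 d) V)) := by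
  intro x₀
  set φ := extChartAt (𝓡 d) x₀ with hφ
  have hto : IsOpen φ.target := isOpen_extChartAt_target x₀
  have hso : IsOpen φ.source := isOpen_extChartAt_source x₀
  have hxs : x₀ ∈ φ.source := mem_extChartAt_source x₀
  have hsymm : ContMDiffOn 𝓘(ℝ, 𝔼) (𝓡 d) ∞ φ.symm φ.target := contMDiffOn_extChartAt_symm x₀
  have hφx : ContMDiffAt (𝓡 d) 𝓘(ℝ, 𝔼) ∞ φ x₀ := contMDiffAt_extChartAt
  let A : 𝔼 → 𝔼 →L[ℝ] ℝ := lam.form.inChart x₀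
  have hA : ContDiffOn ℝ ∞ A φ.target := lam.smooth.contDiffOn_inChart x₀
  let C : 𝔼 → 𝔼 →L[ℝ] 𝔼 →L[ℝ] ℝ := fun u => contactMapAux (A u) (fderiv ℝ A u)
  have hC : ContDiffOn ℝ ∞ C φ.target := by
    have h1 : ContDiffOn ℝ ∞ (fderiv ℝ A) φ.target := hA.fderiv_of_isOpen hto (by simp)
    have h2 : ContDiffOn ℝ ∞ (fun u => (fderiv ℝ A u).flip) φ.target :=
      contDiffOn_clm_apply.2 fun w => contDiffOn_clm_apply.2 fun v =>
        (h1.clm_apply contDiffOn_const).clm_apply contDiffOn_const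
    exact ((hA.smulRight hA).add h1).sub h2
  let β : 𝔼 → 𝔼 →L[ℝ] ℝ := fun u =>
    (h (φ.symm u) + reebDeriv e h (φ.symm u)) • A u - fderiv ℝ (h ∘ φ.symm) u
  have hβ : ContDiffOn ℝ ∞ β φ.target := by
    have h1 : ContDiffOn ℝ ∞ (h ∘ φ.symm) φ.target :=
      contMDiffOn_iff_contDiffOn.1 (hh.comp_contMDiffOn hsymm)
    have h2 : ContDiffOn ℝ ∞ (fun u => reebDeriv e h (φ.symm u)) φ.target :=
      contMDiffOn_iff_contDiffOn.1 ((contMDiff_reebDeriv hh).comp_contMDiffOn hsymm)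
    exact ((h1.add h2).smul hA).sub (h1.fderiv_of_isOpen hto (by simp))
  have hd : ∀ u ∈ φ.target, MDifferentiableAt 𝓘(ℝ, 𝔼) (𝓡 d) φ.symm u := fun u hu =>
    (hsymm.contMDiffAt (hto.mem_nhds hu)).mdifferentiableAt (by simp)
  let P : 𝔼 → 𝔼 →L[ℝ] 𝔼 := fun u => mfderiv 𝓘(ℝ, 𝔼) (𝓡 d) φ.symm u
  have hP : ∀ u ∈ φ.target, (P u).IsInvertible := by
    intro u hu
    have := isInvertible_mfderivWithin_extChartAt_symm (I := 𝓡 d) (x := x₀) hu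
    rwa [ModelWithCorners.range_eq_univ, mfderivWithin_univ] at this
  -- The bilinear form `λ ⊗ λ + dλ` of the fixed chart is the pullback of the intrinsic one under
  -- the inverse chart, whose derivative is `P u`.
  have hCP : ∀ u ∈ φ.target, ∀ v w, C u v w = contactMap lam (φ.symm u) (P u v) (P u w) := by
    intro u hu v w
    have h1 := (OneForm.fderiv_pullback lam.smooth (G := φ.symm) (p := u)
      ((hsymm.contMDiffAt (hto.mem_nhds hu)).of_le (by norm_cast))).2 v w
    have h2 : ∀ a b : 𝔼, fderiv ℝ (fun q => A q a) u b = fderiv ℝ A u b a := by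
      intro a b
      have := ((hA.differentiableOn (by simp)).differentiableAt (hto.mem_nhds hu)).hasFDerivAt
      rw [(this.clm_apply (hasFDerivAt_const a u)).fderiv]
      simp
    have h3 : fderiv ℝ A u v w - fderiv ℝ A u w v
        = lam.form.d (φ.symm u) (P u v) (P u w) := by
      rw [← h2, ← h2]
      exact h1
    rw [contactMap_apply, ← h3]
    exact contactMapAux_apply _ _ _ _
  have hβP : ∀ u ∈ φ.target, ∀ w, β u w = contactCovector e h (φ.symm u) (P u w) := by
    intro u hu w
    have h1 : fderiv ℝ (h ∘ φ.symm) u w = scalarDeriv (𝓡 d) h (φ.symm u) (P u w) :=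
      congrArg (fun T : 𝔼 →L[ℝ] ℝ => T w) (mfderiv_eq_fderiv.symm.trans
        (mfderiv_comp u (hh.mdifferentiableAt (by simp)) (hd u hu)))
    simp only [β, sub_apply, h1]
    rfl
  have hCinv : ∀ u ∈ φ.target, (C u).IsInvertible := by
    intro u hu
    refine isInvertible_of_injective ((injective_iff_map_eq_zero _).2 fun v hv => ?_)
    have h1 : contactMap lam (φ.symm u) (P u v) = 0 := by
      ext w
      obtain ⟨w', rfl⟩ := (hP u hu).surjective w
      rw [← hCP u hu, hv]
      rfl
    have h2 := (injective_iff_map_eq_zero _).1 (contactMap_injective e (φ.symm u)) _ h1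
    exact (injective_iff_map_eq_zero _).1 (hP u hu).injective _ h2
  let X : 𝔼 → 𝔼 := fun u => (C u).inverse (β u)
  have hX : ContDiffOn ℝ ∞ X φ.target := by
    intro u hu
    have h1 : ContDiffAt ℝ ∞ (fun u => (C u).inverse) u :=
      ((hCinv u hu).contDiffAt_map_inverse).comp u (hC.contDiffAt (hto.mem_nhds hu))
    exact (h1.clm_apply (hβ.contDiffAt (hto.mem_nhds hu))).contDiffWithinAt
  have hPX : ∀ u ∈ φ.target, contactField e h (φ.symm u) = P u (X u) := by
    intro u hu
    refine contactField_eq fun w => ?_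
    obtain ⟨w', rfl⟩ := (hP u hu).surjective w
    rw [← hCP u hu, ← hβP u hu, (hCinv u hu).self_apply_inverse]
  have h1 := hsymm.contMDiffOn_tangentMapWithin (m := ∞) (by simp) hto.uniqueMDiffOn
  have h2 : ContMDiffOn 𝓘(ℝ, 𝔼) 𝓘(ℝ, 𝔼).tangent ∞
      (fun u => (⟨u, X u⟩ : TangentBundle 𝓘(ℝ, 𝔼) 𝔼)) φ.target :=
    contMDiffOn_vectorSpace_iff_contDiffOn.2 hX
  have h3 := (h1.comp h2 (fun u hu => hu)).contMDiffAt (hto.mem_nhds (φ.map_source hxs))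
  refine (h3.comp x₀ hφx).congr_of_eventuallyEq ?_
  filter_upwards [hso.mem_nhds hxs] with x hx
  have h4 := hPX (φ x) (φ.map_source hx)
  have key : ∀ y, y = x → ∀ v : 𝔼, contactField e h y = v →
      (⟨x, contactField e h x⟩ : TangentBundle (𝓡 d) V) = ⟨y, v⟩ := by
    rintro y rfl v rfl
    rfl
  refine (key _ (φ.left_inv hx) _ h4).trans ?_
  have h5 : mfderivWithin 𝓘(ℝ, 𝔼) (𝓡 d) φ.symm φ.target (φ x)
      = mfderiv 𝓘(ℝ, 𝔼) (𝓡 d) φ.symm (φ x) := mfderivWithin_of_isOpen hto (φ.map_source hx)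
  change _ = (⟨φ.symm (φ x), (mfderivWithin 𝓘(ℝ, 𝔼) (𝓡 d) φ.symm φ.target (φ x) : 𝔼 →L[ℝ] 𝔼)
    (X (φ x))⟩ : TangentBundle (𝓡 d) V)
  rw [h5]
  rfl

end ContactField

/-! ### Contact isotopies with a prescribed Hamiltonian -/

section ContactFlow

variable {d : ℕ} {V : Type*} [TopologicalSpace V] [ChartedSpace (EuclideanSpace ℝ (Fin d)) V]

local notation "𝔼" => EuclideanSpace ℝ (Fin d)

theorem velocity_eq_of_isMIntegralCurve {Y : (x : V) → TangentSpace (𝓡 d) x} {γ : ℝ → V}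
    (h : IsMIntegralCurve γ Y) (t : ℝ) : velocity (𝓡 d) γ t = Y (γ t) := by
  have h1 := congrArg (fun T : ℝ →L[ℝ] 𝔼 => T 1) (h t).mfderiv
  exact h1.trans (one_smul ℝ (Y (γ t) : 𝔼))

theorem isMIntegralCurve_of_velocity {Y : (x : V) → TangentSpace (𝓡 d) x} {γ : ℝ → V}
    (hγ : ∀ t, MDifferentiableAt 𝓘(ℝ, ℝ) (𝓡 d) γ t) (h : ∀ t, velocity (𝓡 d) γ t = Y (γ t)) :
    IsMIntegralCurve γ Y := by
  intro t
  refine (hγ t).hasMFDerivAt.congr_mfderiv (ContinuousLinearMap.ext_ring ?_)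
  exact (h t).trans (one_smul ℝ (Y (γ t) : 𝔼)).symm

variable [IsManifold (𝓡 d) ∞ V] {lam : ContactForm d V} {e : ReebCircleAction lam}

/-- A flow whose velocity is the contact field of `h` consists of contactomorphisms. -/
theorem exists_conformal_of_velocity {h : V → ℝ} (hh : ContMDiff (𝓡 d) 𝓘(ℝ, ℝ) ∞ h)
    {f : ℝ → V → V} (hf : ContMDiff (𝓘(ℝ, ℝ).prod (𝓡 d)) (𝓡 d) ∞ (fun z : ℝ × V => f z.1 z.2))
    (h0 : f 0 = id)
    (hv : ∀ t x, (velocity (𝓡 d) (fun τ => f τ x) t : 𝔼) = contactField e h (f t x))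
    (t : ℝ) (x : V) : ∃ ρ : ℝ, 0 < ρ ∧
      OneForm.pullback (I := 𝓡 d) (f t) lam.form x = ρ • lam.form x := by
  -- Cartan's formula gives `L_X λ = dh(R) λ`, the `dh` terms cancelling. Thus the pullback of `λ`
  -- along the flow satisfies a scalar linear equation with coefficient `a`, and the conformal
  -- factor is the exponential of its integral.
  let a : ℝ → ℝ := fun τ => reebDeriv e h (f τ x)
  have hfx : Continuous (fun τ => f τ x) :=
    (hf.comp (contMDiff_id.prodMk contMDiff_const)).continuous
  have ha : Continuous a := (contMDiff_reebDeriv hh).continuous.comp hfx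
  have hfs : ∀ τ, ContMDiff (𝓡 d) (𝓡 d) ∞ (f τ) := fun τ =>
    hf.comp (contMDiff_const.prodMk contMDiff_id)
  have hder : ∀ (w : 𝔼) (τ : ℝ), HasDerivAt
      (fun τ => (OneForm.pullback (I := 𝓡 d) (f τ) lam.form x : 𝔼 →L[ℝ] ℝ) w)
      (a τ * (OneForm.pullback (I := 𝓡 d) (f τ) lam.form x : 𝔼 →L[ℝ] ℝ) w) τ := by
    intro w τ
    refine (OneForm.hasDerivAt_pullback lam.smooth hf τ x w).congr_deriv ?_
    let P : 𝔼 →L[ℝ] 𝔼 := mfderiv (𝓡 d) (𝓡 d) (f τ) x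
    have h1 : lam.form.d (f τ x) (velocity (𝓡 d) (fun τ => f τ x) τ) (P w)
        = a τ * (lam.form (f τ x) : 𝔼 →L[ℝ] ℝ) (P w) - scalarDeriv (𝓡 d) h (f τ x) (P w) :=
      (congrArg (fun v : 𝔼 => lam.form.d (f τ x) v (P w)) (hv τ x)).trans (d_contactField _ _ _)
    have h2 : (fun y => lam.form (f τ y) (velocity (𝓡 d) (fun σ => f σ y) τ)) = h ∘ f τ := by
      funext y
      exact (congrArg (fun v : 𝔼 => (lam.form (f τ y) : 𝔼 →L[ℝ] ℝ) v) (hv τ y)).trans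
        (form_contactField _ _)
    have h3 : (mfderiv (𝓡 d) 𝓘(ℝ, ℝ) (h ∘ f τ) x : 𝔼 →L[ℝ] ℝ) w
        = scalarDeriv (𝓡 d) h (f τ x) (P w) :=
      congrArg (fun T : 𝔼 →L[ℝ] ℝ => T w) (mfderiv_comp x (hh.mdifferentiableAt (by simp))
        ((hfs τ).mdifferentiableAt (by simp)))
    have h4 : (mfderiv (𝓡 d) 𝓘(ℝ, ℝ)
        (fun y => lam.form (f τ y) (velocity (𝓡 d) (fun σ => f σ y) τ)) x : 𝔼 →L[ℝ] ℝ) w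
        = scalarDeriv (𝓡 d) h (f τ x) (P w) := by
      rw [← h3, ← h2]
    refine (congrArg₂ (fun b c : ℝ => b + c) h1 h4).trans ?_
    rw [sub_add_cancel]
    rfl
  let S : ℝ → ℝ := fun τ => ∫ σ in (0 : ℝ)..τ, a σ
  have hS : ∀ τ, HasDerivAt S (a τ) τ := fun τ =>
    intervalIntegral.integral_hasDerivAt_right (ha.intervalIntegrable _ _)
      (ha.stronglyMeasurableAtFilter _ _) ha.continuousAt
  have hpull0 : OneForm.pullback (I := 𝓡 d) (f 0) lam.form x = lam.form x := by
    rw [h0]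
    exact pullback_id _ x
  refine ⟨Real.exp (S t), Real.exp_pos _, ContinuousLinearMap.ext fun w => ?_⟩
  have hc : ∀ τ, HasDerivAt (fun τ => Real.exp (-S τ)
      * (OneForm.pullback (I := 𝓡 d) (f τ) lam.form x : 𝔼 →L[ℝ] ℝ) w) 0 τ := fun τ =>
    (((hS τ).neg.exp).mul (hder w τ)).congr_deriv (by simp; ring)
  have hconst := is_const_of_deriv_eq_zero (fun τ => (hc τ).differentiableAt)
    (fun τ => (hc τ).deriv) t 0
  have hS0 : S 0 = 0 := intervalIntegral.integral_same
  rw [hS0, neg_zero, Real.exp_zero, one_mul, Real.exp_neg] at hconst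
  have h5 : (OneForm.pullback (I := 𝓡 d) (f t) lam.form x : 𝔼 →L[ℝ] ℝ) w
      = Real.exp (S t) * (OneForm.pullback (I := 𝓡 d) (f 0) lam.form x : 𝔼 →L[ℝ] ℝ) w := by
    rw [← hconst, mul_inv_cancel_left₀ (Real.exp_pos _).ne']
  rw [hpull0] at h5
  exact h5

/-- A compactly supported function is the contact Hamiltonian of a compactly supported contact
isotopy. -/
theorem exists_contactPath [T2Space V] (e : ReebCircleAction lam) {h : V → ℝ}
    (hh : ContMDiff (𝓡 d) 𝓘(ℝ, ℝ) ∞ h) (hc : HasCompactSupport h) :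
    ∃ p : contactPath e, p ∈ compactPaths e ∧ ∀ t x, rate lam p.1 t x = h (p.1 t x) := by
  obtain ⟨θ, hθ, hadd, hcurve, hfix⟩ := exists_flow (I := 𝓡 d) (M := V)
    (Y := fun x => contactField e h x) (contMDiff_contactField hh) hc.isCompact
    (fun x hx => contactField_eq_zero hx)
  have h0 : θ 0 = 1 := by
    have := hadd 0 0
    rw [add_zero] at this
    exact mul_eq_left.mp this.symm
  have hneg : ∀ t, (θ t)⁻¹ = θ (-t) := fun t =>
    (eq_inv_of_mul_eq_one_left (by rw [← hadd, neg_add_cancel, h0])).symm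
  have hv : ∀ t x, (velocity (𝓡 d) (fun τ => θ τ x) t : 𝔼) = contactField e h (θ t x) :=
    fun t x => velocity_eq_of_isMIntegralCurve (hcurve x) t
  have hsmooth : IsSmoothFamily e θ :=
    { smooth := hθ
      smooth_inv := by
        simp only [hneg]
        exact hθ.comp ((contDiff_neg.contMDiff.comp contMDiff_fst).prodMk contMDiff_snd)
      contact := exists_conformal_of_velocity hh (f := fun t x => θ t x) hθ
        (by funext x; rw [h0]; rfl) hv
      reeb_at_infinity := ⟨fun _ => 0, tsupport h, contDiff_const, hc.isCompact, fun t x hx => by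
        rw [hfix t x hx, e.flow_zero]; rfl⟩ }
  refine ⟨⟨θ, hsmooth, h0⟩, ⟨tsupport h, hc.isCompact, hfix⟩, fun t x => ?_⟩
  exact (congrArg (fun v : 𝔼 => (lam.form (θ t x) : 𝔼 →L[ℝ] ℝ) v) (hv t x)).trans
    (form_contactField _ _)

/-- The velocity of a contact isotopy is the contact field of its contact Hamiltonian. -/
theorem IsContactFamily.velocity_eq (e : ReebCircleAction lam) {f : ℝ → Equiv.Perm V}
    (hf : IsContactFamily lam f) {h : V → ℝ} (hh : ContMDiff (𝓡 d) 𝓘(ℝ, ℝ) ∞ h) {t : ℝ}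
    (hr : ∀ x, rate lam f t x = h (f t x)) (x : V) :
    (velocity (𝓡 d) (fun τ => f τ x) t : 𝔼) = contactField e h (f t x) := by
  let P : 𝔼 →L[ℝ] 𝔼 := mfderiv (𝓡 d) (𝓡 d) (f t) x
  let v : 𝔼 := velocity (𝓡 d) (fun τ => f τ x) t
  let ρ : ℝ → ℝ := fun τ => conformalFactor e (f τ) x
  have hPsurj : Function.Surjective P := by
    intro u
    have hinv : MDifferentiableAt (𝓡 d) (𝓡 d) ((f t)⁻¹ : Equiv.Perm V) (f t x) :=
      (hf.smooth_inv.comp (contMDiff_const.prodMk contMDiff_id)).mdifferentiableAt (by simp)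
    have h1 : MDifferentiableAt (𝓡 d) (𝓡 d) (f t) ((f t)⁻¹ (f t x)) :=
      (hf.slice t).mdifferentiableAt (by simp)
    have h2 := mfderiv_comp (f t x) h1 hinv
    have h3 : (f t : V → V) ∘ ((f t)⁻¹ : Equiv.Perm V) = id := by
      funext y
      simp
    rw [h3, mfderiv_id] at h2
    let Q : 𝔼 →L[ℝ] 𝔼 := mfderiv (𝓡 d) (𝓡 d) ((f t)⁻¹ : Equiv.Perm V) (f t x)
    have key : ∀ z, z = x → (mfderiv (𝓡 d) (𝓡 d) (f t) z : 𝔼 →L[ℝ] 𝔼) (Q u) = u →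
        P (Q u) = u := by
      rintro z rfl h
      exact h
    exact ⟨Q u, key _ (Equiv.symm_apply_apply _ _)
      (congrArg (fun T : 𝔼 →L[ℝ] 𝔼 => T u) h2).symm⟩
  have hρ : 0 < ρ t := hf.conformalFactor_pos t x
  have hρd : DifferentiableAt ℝ ρ t :=
    ((contMDiff_iff_contDiff.1 ((hf.contMDiff_conformalFactor (e := e)).comp
      (contMDiff_id.prodMk (contMDiff_const (c := x))))).differentiable (by simp)) t
  have hpull : ∀ (τ : ℝ) (w : 𝔼), (OneForm.pullback (I := 𝓡 d) (f τ) lam.form x : 𝔼 →L[ℝ] ℝ) w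
      = ρ τ * (lam.form x : 𝔼 →L[ℝ] ℝ) w := fun τ w =>
    congrArg (fun T : 𝔼 →L[ℝ] ℝ => T w) (hf.pullback_eq (e := e) τ x)
  -- Differentiating `f_t^* λ = ρ_t λ` by Cartan's formula gives `dλ(v, ·) + dh = (ρ' / ρ) λ`. The
  -- Reeb vector then identifies `ρ' / ρ` with `dh(R)`, and these are the equations defining the
  -- contact field.
  have hmain : ∀ u : 𝔼, lam.form.d (f t x) v u + scalarDeriv (𝓡 d) h (f t x) u
      = deriv ρ t / ρ t * (lam.form (f t x) : 𝔼 →L[ℝ] ℝ) u := by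
    intro u
    obtain ⟨w, rfl⟩ := hPsurj u
    have h1 := OneForm.hasDerivAt_pullback lam.smooth (ψ := fun τ y => f τ y) hf.smooth t x w
    have h2 : (fun τ => (OneForm.pullback (I := 𝓡 d) (fun y => f τ y) lam.form x : 𝔼 →L[ℝ] ℝ) w)
        = fun τ => ρ τ * (lam.form x : 𝔼 →L[ℝ] ℝ) w := funext fun τ => hpull τ w
    rw [h2] at h1
    have h3 := h1.unique (hρd.hasDerivAt.mul_const _)
    have h4 : (fun y => lam.form (f t y) (velocity (𝓡 d) (fun σ => f σ y) t)) = h ∘ f t :=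
      funext hr
    have h5 : (mfderiv (𝓡 d) 𝓘(ℝ, ℝ) (h ∘ f t) x : 𝔼 →L[ℝ] ℝ) w
        = scalarDeriv (𝓡 d) h (f t x) (P w) :=
      congrArg (fun T : 𝔼 →L[ℝ] ℝ => T w) (mfderiv_comp x (hh.mdifferentiableAt (by simp))
        ((hf.slice t).mdifferentiableAt (by simp)))
    have h6 : (mfderiv (𝓡 d) 𝓘(ℝ, ℝ)
        (fun y => lam.form (f t y) (velocity (𝓡 d) (fun σ => f σ y) t)) x : 𝔼 →L[ℝ] ℝ) w
        = scalarDeriv (𝓡 d) h (f t x) (P w) := by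
      rw [← h5, ← h4]
    have h7 : (lam.form (f t x) : 𝔼 →L[ℝ] ℝ) (P w) = ρ t * (lam.form x : 𝔼 →L[ℝ] ℝ) w :=
      hpull t w
    rw [h7, div_mul_eq_mul_div, ← mul_assoc, mul_right_comm, mul_div_cancel_right₀ _ hρ.ne', ← h3]
    exact congrArg (fun c : ℝ => lam.form.d (f t x) v (P w) + c) h6.symm
  have hκ : deriv ρ t / ρ t = reebDeriv e h (f t x) := by
    have h1 := hmain (reebField e (f t x))
    rw [OneForm.d_swap, d_reebField, form_reebField, mul_one, neg_zero, zero_add] at h1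
    exact h1.symm
  refine (contactField_eq fun u => ?_).symm
  have h1 := hmain u
  have h2 : (lam.form (f t x) : 𝔼 →L[ℝ] ℝ) v = h (f t x) := hr x
  rw [hκ] at h1
  refine (contactMap_apply (f t x) v u).trans ?_
  rw [contactCovector_apply, h2]
  linarith

/-- A contact isotopy with a time-independent contact Hamiltonian is a one-parameter group. -/
theorem IsContactFamily.map_add [T2Space V] (e : ReebCircleAction lam) {f : ℝ → Equiv.Perm V}
    (hf : IsContactFamily lam f) (h0 : f 0 = 1) {h : V → ℝ}
    (hh : ContMDiff (𝓡 d) 𝓘(ℝ, ℝ) ∞ h) (hr : ∀ t x, rate lam f t x = h (f t x)) (s t : ℝ) :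
    f (s + t) = f s * f t := by
  have hcurve : ∀ x, IsMIntegralCurve (fun τ => f τ x) (fun x => contactField e h x) := fun x =>
    isMIntegralCurve_of_velocity (hf.mdifferentiableAt_time · x)
      (fun τ => hf.velocity_eq e hh (hr τ) x)
  refine Equiv.ext fun x => ?_
  exact congrFun (isMIntegralCurve_Ioo_eq_of_contMDiff_boundaryless (t₀ := 0)
    ((contMDiff_contactField hh).of_le (by simp)) ((hcurve x).comp_add t) (hcurve (f t x))
    (by simp [h0])) s

end ContactFlow

/-! ### Linear growth, cutoff Hamiltonians and one-parameter groups -/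

section Main

variable {d : ℕ} {V : Type*} [TopologicalSpace V] [ChartedSpace (EuclideanSpace ℝ (Fin d)) V]
  [IsManifold (𝓡 d) ∞ V] {lam : ContactForm d V} {e : ReebCircleAction lam}

theorem hasLowerBound_of_hamiltonian {B : Set (Symplectization V)} {p : contactPath e}
    {F : ℝ → Symplectization V → ℝ} (hF : IsContactHamiltonianOf lam F p.1) {c : ℝ}
    (hc : ∀ t ∈ Set.Icc (0 : ℝ) 1, ∀ z ∈ B, c * z.2.1 < F t z) :
    HasLowerBound (Prod.fst '' B) (cls p) c := by
  refine hasLowerBound_of_le p fun t ht x hx => ?_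
  obtain ⟨z, hz, hzx⟩ := hx
  have h1 := hc t ht z hz
  rw [hF.eq_rate p.2.1.isContactFamily p.2.2 e, hzx, mul_comm] at h1
  have h2 := lt_of_mul_lt_mul_left h1 z.2.2.le
  rw [show (p.1 t)⁻¹ (p.1 t x) = x from Equiv.symm_apply_apply _ _] at h2
  exact h2.le

/-- For positive powers lower bounds add up; negative powers follow from the invariance of `ν` under
inversion. -/
theorem HasLowerBound.mul_abs_le_nu_zpow {B : Set V} (hB : ∀ t, ∀ x ∈ B, e.flow t x ∈ B)
    (hL : NoPositiveLoop e B) {f : TildeGe e} {c : ℝ} (hf : HasLowerBound B f c) (k : ℤ) :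
    c * |(k : ℝ)| ≤ nu (f ^ k) := by
  have hnat : ∀ n : ℕ, c * n ≤ nu (f ^ n) := fun n => by
    have h1 := (hf.pow n).le_nuPlus hB hL
    have h2 : (nuPlus (f ^ n) : ℝ) ≤ nu (f ^ n) := by exact_mod_cast nuPlus_le_nu (f ^ n)
    linarith
  obtain ⟨n, rfl | rfl⟩ := k.eq_nat_or_neg
  · simpa using hnat n
  · simpa [nu_inv hB hL] using hnat n

/-- A smooth compactly supported cutoff function. -/
theorem exists_cutoff [T2Space V] [SecondCountableTopology V] {K : Set V} (hK : IsCompact K) :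
    ∃ ψ : V → ℝ, ContMDiff (𝓡 d) 𝓘(ℝ, ℝ) ∞ ψ ∧ HasCompactSupport ψ ∧
      (∀ x ∈ K, ψ x = 1) ∧ ∀ x, ψ x ≤ 1 := by
  have : LocallyCompactSpace V := Manifold.locallyCompact_of_finiteDimensional (𝓡 d)
  have : SigmaCompactSpace V := sigmaCompactSpace_of_locallyCompact_secondCountable
  obtain ⟨K', hK', hKK'⟩ := exists_compact_superset hK
  obtain ⟨f, hf0, hf1, hf⟩ := exists_contMDiffMap_zero_one_of_isClosed (n := (⊤ : ℕ∞)) (𝓡 d)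
    (s := (interior K')ᶜ) (t := K) isOpen_interior.isClosed_compl hK.isClosed
    (Set.disjoint_left.2 fun x hx hxK => hx (hKK' hxK))
  exact ⟨f, f.contMDiff, HasCompactSupport.intro hK' fun x hx =>
    hf0 fun h => hx (interior_subset h), fun x hx => hf1 hx, fun x => (hf x).2⟩

/-- The Hamiltonian is `s C ψ(x)` with `ψ ≤ 1` a cutoff equal to `1` over the compact projection of
`B`; there it equals `C s > c s`. -/
theorem exists_autonomous_hamiltonian [T2Space V] [SecondCountableTopology V]
    (e : ReebCircleAction lam) {B : Set (Symplectization V)} (hB : IsCompact B) {c C : ℝ}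
    (hc : 0 < c) (hcC : c < C) :
    ∃ (p : contactPath e) (F : Symplectization V → ℝ),
      p ∈ compactPaths e ∧ IsContactHamiltonianOf lam (fun _ => F) p.1 ∧
      (∀ z ∈ B, c * z.2.1 < F z) ∧ ∀ z, F z ≤ C * z.2.1 := by
  obtain ⟨ψ, hψ, hψc, hψ1, hψle⟩ := exists_cutoff (d := d) (hB.image continuous_fst)
  obtain ⟨p, hp, hrate⟩ := exists_contactPath e (h := fun x => C * ψ x)
    ((contDiff_const.mul contDiff_id).contMDiff.comp hψ) hψc.mul_left
  refine ⟨p, fun z => z.2.1 * (C * ψ z.1), hp, ?_, fun z hz => ?_, fun z => ?_⟩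
  · have h := isContactHamiltonianOf_rate p.2.1.isContactFamily p.2.2 e
    have hinv : ∀ t x, p.1 t ((p.1 t)⁻¹ x) = x := fun t x => Equiv.apply_symm_apply _ _
    simpa only [hrate, hinv] using h
  · beta_reduce
    rw [hψ1 _ ⟨z, hz, rfl⟩, mul_one, mul_comm]
    exact mul_lt_mul_of_pos_left hcC z.2.2
  · beta_reduce
    rw [mul_comm]
    exact mul_le_mul_of_nonneg_right (mul_le_of_le_one_right (hc.trans hcC).le (hψle _)) z.2.2.le

/-- The restriction to `s = 1` of a time-independent contact Hamiltonian. -/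
theorem IsContactHamiltonianOf.rate_eq {p : contactPath e} {F : Symplectization V → ℝ}
    (hF : IsContactHamiltonianOf lam (fun _ => F) p.1) :
    ∃ h : V → ℝ, ContMDiff (𝓡 d) 𝓘(ℝ, ℝ) ∞ h ∧ (∀ z, F z = z.2.1 * h z.1) ∧
      ∀ t x, rate lam p.1 t x = h (p.1 t x) := by
  let u : posRay := ⟨1, show (0 : ℝ) < 1 from one_pos⟩
  have hr : ∀ t x, rate lam p.1 t x = F (p.1 t x, u) := fun t x => by
    have h := hF.eq_rate p.2.1.isContactFamily p.2.2 e t (p.1 t x, u)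
    have hinv : (p.1 t)⁻¹ (p.1 t x) = x := Equiv.symm_apply_apply _ _
    rw [hinv] at h
    exact (h.trans (one_mul _)).symm
  refine ⟨fun x => F (x, u), ?_, fun z => ?_, hr⟩
  · obtain ⟨-, fbar, -, hflow⟩ := hF
    exact hflow.smooth_hamiltonian.comp
      ((contMDiff_const (c := (0 : ℝ))).prodMk (contMDiff_id.prodMk contMDiff_const))
  · rw [hF.eq_rate p.2.1.isContactFamily p.2.2 e 0 z, hr,
      show p.1 0 ((p.1 0)⁻¹ z.1) = z.1 from Equiv.apply_symm_apply _ _]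

/-- The one-parameter subgroup generated by a time-independent contact Hamiltonian. -/
def oneParameterGroup (p : contactPath e) (hp : p ∈ compactPaths e)
    (hadd : ∀ s t, p.1 (s + t) = p.1 s * p.1 t) : Multiplicative ℝ →* tildeGc e :=
  MonoidHom.mk' (fun t => ⟨cls (rescale p t.toAdd), rescale p t.toAdd, by
      obtain ⟨K, hK, h⟩ := hp
      exact ⟨K, hK, fun τ x hx => h _ x hx⟩, rfl⟩)
    fun s t => Subtype.ext (congrArg QuotientGroup.mk (Subtype.ext (funext fun τ => by
      change p.1 ((s.toAdd + t.toAdd) * τ) = p.1 (s.toAdd * τ) * p.1 (t.toAdd * τ)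
      rw [add_mul, hadd])))

/-- The class at time `T` has rate `T h`. The lower bound on `h` over `B` gives `c |T| ≤ ν`, and a
global bound `D` on `|h|` gives `ν ≤ D |T| + 1`, the `1` coming from rounding to integers. -/
theorem oneParameterGroup_isQuasiIsometricMono {B : Set V} (hB : ∀ t, ∀ x ∈ B, e.flow t x ∈ B)
    (hL : NoPositiveLoop e B) (p : contactPath e) (hp : p ∈ compactPaths e)
    (hadd : ∀ s t, p.1 (s + t) = p.1 s * p.1 t) {h : V → ℝ}
    (hrate : ∀ t x, rate lam p.1 t x = h (p.1 t x)) {c : ℝ} (hc : 0 < c)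
    (hcB : ∀ x ∈ B, c ≤ h x) : IsQuasiIsometricMono (oneParameterGroup p hp hadd) := by
  set ρ := oneParameterGroup p hp hadd with hρ
  have hval : ∀ T : ℝ, (ρ (Multiplicative.ofAdd T) : TildeGe e) = cls (rescale p T) := fun _ => rfl
  have hinv : ∀ T : ℝ, cls (rescale p (-T)) = (cls (rescale p T))⁻¹ := fun T => by
    rw [← hval, ← hval, ofAdd_neg, map_inv]
    rfl
  have hdiff : ∀ s t : ℝ, ((ρ (Multiplicative.ofAdd s) * (ρ (Multiplicative.ofAdd t))⁻¹ :
      tildeGc e) : TildeGe e) = cls (rescale p (s - t)) := fun s t => by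
    rw [← hval, ofAdd_sub, map_div, div_eq_mul_inv]
  have hrescale : ∀ T t x, rate lam (rescale p T).1 t x = T * h (p.1 (T * t) x) := fun T t x => by
    rw [rate_rescale, hrate]
  have hlow : ∀ T : ℝ, 0 ≤ T → HasLowerBound B (cls (rescale p T)) (c * T) := fun T hT => by
    refine hasLowerBound_of_le _ fun t _ x hx => ?_
    rw [hrescale, mul_comm]
    exact mul_le_mul_of_nonneg_left (hcB _ hx) hT
  have hlow' : ∀ T : ℝ, c * |T| ≤ nu (cls (rescale p T)) := by
    have hpos : ∀ T : ℝ, 0 ≤ T → c * T ≤ nu (cls (rescale p T)) := fun T hT =>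
      ((hlow T hT).le_nuPlus hB hL).trans (by exact_mod_cast nuPlus_le_nu _)
    intro T
    rcases le_total 0 T with hT | hT
    · rw [abs_of_nonneg hT]
      exact hpos T hT
    · rw [abs_of_nonpos hT, ← nu_inv hB hL, ← hinv]
      exact hpos (-T) (neg_nonneg.2 hT)
  obtain ⟨D, hD⟩ := exists_rate_bound p
  have hhD : ∀ x, |h x| ≤ D := fun x => by
    have := hD 0 (by norm_num) x
    rw [hrate, p.2.2] at this
    exact this
  have hup' : ∀ T : ℝ, |(nuPlus (cls (rescale p T)) : ℝ)| ≤ |T| * D + 1 := fun T =>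
    abs_nuPlus_le hB hL (rescale p T) fun t _ x => by
      rw [hrescale, abs_mul]
      exact mul_le_mul_of_nonneg_left (hhD _) (abs_nonneg T)
  have hup : ∀ T : ℝ, (nu (cls (rescale p T)) : ℝ) ≤ |T| * D + 1 := fun T => by
    have h1 := hup' (-T)
    rw [abs_neg T] at h1
    unfold nu
    rw [nuMinus_eq hB hL, ← hinv, abs_neg]
    push_cast
    exact max_le (hup' T) h1
  refine ⟨?_, max (max D c⁻¹) 1, 1, le_max_right _ _, zero_le_one, fun s t => ?_⟩
  -- For `T > 0` the identity class would have the positive lower bound `c T`, although its inverse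
  -- is non-negative by the constant path. Applied to both signs of a difference, this gives
  -- injectivity.
  · have hone : ∀ T : ℝ, cls (rescale p T) = 1 → T ≤ 0 := fun T hT => by
      by_contra! hpos
      have h1 := hlow T hpos.le
      rw [hT] at h1
      have h2 := h1.nonpos hB hL (nonnegElt_iff.2 ⟨1, by rw [inv_one]; rfl, fun t _ x =>
        (rate_one (lam := lam) t x).ge⟩)
      exact absurd h2 (not_le.2 (mul_pos hc hpos))
    have hle : ∀ s t : Multiplicative ℝ, ρ s = ρ t → s.toAdd ≤ t.toAdd := fun s t hst => by
      have h1 := hone (s.toAdd - t.toAdd) (by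
        rw [← hdiff, ofAdd_toAdd, ofAdd_toAdd, hst, mul_inv_cancel]
        rfl)
      linarith
    exact fun s t hst => Multiplicative.toAdd.injective (le_antisymm (hle s t hst) (hle t s hst.symm))
  · rw [hdiff]
    have hK1 : D ≤ max (max D c⁻¹) 1 := (le_max_left _ _).trans (le_max_left _ _)
    have hK2 : (max (max D c⁻¹) 1)⁻¹ ≤ c :=
      inv_le_of_inv_le₀ hc ((le_max_right _ _).trans (le_max_left _ _))
    constructor
    · have h1 := mul_le_mul_of_nonneg_right hK2 (abs_nonneg (s - t))
      linarith [hlow' (s - t)]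
    · have h1 := mul_le_mul_of_nonneg_right hK1 (abs_nonneg (s - t))
      linarith [hup (s - t)]

end Main

end ContactNorm

end

open ContactNorm in
theorem theorem2p4 {n : ℕ} {V : Type*} [TopologicalSpace V] [T2Space V]
    [SecondCountableTopology V] [ChartedSpace (EuclideanSpace ℝ (Fin (2 * n + 1))) V]
    [IsManifold (modelWithCornersSelf ℝ (EuclideanSpace ℝ (Fin (2 * n + 1)))) ∞ V]
    (lam : ContactForm (2 * n + 1) V) (e : ReebCircleAction lam)
    (A B : Set (Symplectization V)) (hAB : HasStableIntersection lam A B)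
    (hB : ∀ t, ∀ z ∈ B, liftedReeb e t z ∈ B) :
    -- `ν_+` and `ν_-` are well defined: the minimum and the maximum exist
    (∀ f : TildeGe e, IsLeast {m : ℤ | Dominates (reebElt e m) f} (nuPlus f) ∧
      IsGreatest {m : ℤ | Dominates f (reebElt e m)} (nuMinus f)) ∧
    -- the lower bounds for `ν_+(f)`, `ν(f)` and `ν(f ^ k)`
    (∀ (f : TildeGe e) (p : contactPath e) (F : ℝ → Symplectization V → ℝ) (c : ℝ),
      cls p = f → IsContactHamiltonianOf lam F p.1 → 0 < c →
      (∀ t ∈ Set.Icc (0 : ℝ) 1, ∀ z ∈ B, c * z.2.1 < F t z) →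
      ⌊c⌋ ≤ nuPlus f ∧ ⌊c⌋ ≤ nu f ∧ ∀ k : ℕ, ⌊c⌋ * k ≤ nu (f ^ k)) ∧
    -- such `F` exist, time-independent, with compactly supported flow and with `F ≤ C s`
    (∀ c C : ℝ, 0 < c → c < C → ∃ (p : contactPath e) (F : Symplectization V → ℝ),
      p ∈ compactPaths e ∧ IsContactHamiltonianOf lam (fun _ => F) p.1 ∧
      (∀ z ∈ B, c * z.2.1 < F z) ∧ ∀ z, F z ≤ C * z.2.1) ∧
    -- stable unboundedness
    NuIsStablyUnboundedOnTildeGc e ∧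
    -- the flow of such an `F` is a quasi-isometric monomorphism
    (∀ (p : contactPath e) (F : Symplectization V → ℝ) (c : ℝ), p ∈ compactPaths e →
      IsContactHamiltonianOf lam (fun _ => F) p.1 → 0 < c → (∀ z ∈ B, c * z.2.1 < F z) →
      ∃ ρ : Multiplicative ℝ →* tildeGc e,
        (∀ t : ℝ, (ρ (Multiplicative.ofAdd t) : TildeGe e) = cls (rescale p t)) ∧
        IsQuasiIsometricMono ρ) := by
  have hBv : ∀ t, ∀ x ∈ Prod.fst '' B, e.flow t x ∈ Prod.fst '' B := by
    rintro t _ ⟨z, hz, rfl⟩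
    exact ⟨_, hB t z hz, rfl⟩
  have hL : NoPositiveLoop e (Prod.fst '' B) := noPositiveLoop hAB hBv
  refine ⟨fun f => ⟨isLeast_nuPlus hBv hL f, isGreatest_nuMinus hBv hL f⟩, ?_,
    fun c C hc hcC => exists_autonomous_hamiltonian e hAB.compact_right hc hcC, ?_, ?_⟩
  · rintro _ p F c rfl hF _ hFc
    have hlow := hasLowerBound_of_hamiltonian hF hFc
    have hfloor := Int.floor_le c
    have h1 : ⌊c⌋ ≤ nuPlus (cls p) := by
      exact_mod_cast hfloor.trans (hlow.le_nuPlus hBv hL)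
    refine ⟨h1, h1.trans (nuPlus_le_nu _), fun k => ?_⟩
    have h2 := hlow.mul_abs_le_nu_zpow hBv hL k
    have h3 := mul_le_mul_of_nonneg_right hfloor (Nat.cast_nonneg (α := ℝ) k)
    rw [Int.cast_natCast, Nat.abs_cast, zpow_natCast] at h2
    exact_mod_cast h3.trans h2
  · obtain ⟨p, F, hp, hF, hFB, -⟩ :=
      -- Any `0 < c < C` would do; `c = 1` gives stable unboundedness with `a = 1`.
      exists_autonomous_hamiltonian e hAB.compact_right one_pos one_lt_two
    refine ⟨⟨cls p, p, hp, rfl⟩, 1, one_pos, fun k => ?_⟩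
    exact (hasLowerBound_of_hamiltonian hF fun _ _ => hFB).mul_abs_le_nu_zpow hBv hL k
  · intro p F c hp hF hc hFB
    obtain ⟨h, hh, hFh, hrate⟩ := hF.rate_eq
    have hadd := p.2.1.isContactFamily.map_add e p.2.2 hh hrate
    refine ⟨oneParameterGroup p hp hadd, fun _ => rfl,
      oneParameterGroup_isQuasiIsometricMono hBv hL p hp hadd hrate hc ?_⟩
    rintro _ ⟨z, hz, rfl⟩
    have h1 := hFB z hz
    rw [hFh, mul_comm] at h1
    exact (lt_of_mul_lt_mul_left h1 z.2.2.le).le
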